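/- Let $H$ be a separable real Hilbert space and $A:D(A)\subset H\to H$ a self-adjoint positive operator with an orthonormal eigenbasis $\{e_k\}_{k\ge1}$ of $H$, $Ae_k=\lambda_ke_k$, $0<\lambda_1\le\lambda_2\le\dots$, $\lambda_k\to\infty$. For $s\ge0$ let $F_s=D(A^s)=\{v\in H:\sum_k\lambda_k^{2s}(v,e_k)^2<\infty\}$ with $(v,w)_s=(A^sv,A^sw)$, $\|v\|_s=\|A^sv\|$, so that $F_0=H$, and let $F_{-s}\supset H$ be the dual of $F_s$ with respect to $H$. Let $\beta,\nu>0$, $\omega\in[0,1)$, $\mathbb R_+=(0,\infty)$, and let $\mu_1,\mu_2$ satisfy, with constants $\delta_1,\delta_2>0$, $$\mu_i\in C^1(\mathbb R_+)\cap L^1(\mathbb R_+)\cap C[0,\infty),\qquad \mu_i\ge0,\qquad \mu_i'+\delta_i\mu_i\le0\ \text{ on }\mathbb R_+ ;$$ if $\omega=0$, assume also that $\mu_2$ is not identically zero on $\mathbb R_+$. Let $M\in C^2([0,\infty))$ be real-valued with $$\int_0^zM(\xi)\,d\xi\ge-az-b\quad(z\ge0)\qquad\text{for some }a\in(0,\lambda_1),\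 b\in\mathbb R,$$ and let $p\in H$. Let $L^2_{\mu}(\mathbb R_+;E)$ be the space of $E$-valued functions that are square integrable on $\mathbb R_+$ with respect to $\mu(s)\,ds$, and let $$\mathcal H=F_1\times H\times H\times L^2_{\mu_1}(\mathbb R_+;F_1)\times L^2_{\mu_2}(\mathbb R_+;F_{1/2})$$ be the product Hilbert space. Define $\mathcal L:D(\mathcal L)\subset\mathcal H\to\mathcal H$ on $U=(u,w,v,\bar\eta,\eta)$ by $$\mathcal LU=\Big(w,\ -\beta A^2u-\int_0^\infty\mu_1(s)A^2\bar\eta(s)\,ds+\nu Av,\ -\omega Av-\int_0^\infty\mu_2(s)A\eta(s)\,ds-\nu Aw,\ -\bar\eta_s+w,\ -\eta_s+v\Big),$$ where $D(\mathcal L)$ consists of all $U\in\mathcal H$ such that $w\in F_1$, $v\in F_{1/2}$; $\bar\eta_s\in L^2_{\mu_1}(\mathbb R_+;F_1)$ and $\eta_s\in L^2_{\mu_2}(\mathbb R_+;F_{1/2})$ (distributional derivatives on $\{s>0:\mu_1(s)>0\}$ and on $\{s>0:\mu_2(s)>0\}$, respectively); $\bar\eta(0)=\eta(0)=0$; and $\beta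 A^2u+\int_0^\infty\mu_1A^2\bar\eta\,ds-\nu Av\in F_{-1}$ and $\omega Av+\int_0^\infty\mu_2A\eta\,ds\in F_{-1/2}$ both belong to $H$. Let $$f(U)=\big(0,\,-M(\|A^{1/2}u\|^2)Au+p,\,0,\,0,\,0\big)$$ and consider the problem $$\dot U(t)=\mathcal LU(t)+f(U(t)),\qquad U(0)=U_0. \tag{P}$$ Then $\mathcal L$ is the infinitesimal generator of a strongly continuous semigroup $e^{t\mathcal L}$ on $\mathcal H$, and the following hold. 1. For all $U_0\in\mathcal H$ and $T>0$ there is a unique mild solution of (P) on $[0,T]$, that is, a unique $U\in C([0,T];\mathcal H)$ with $U(t)=e^{t\mathcal L}U_0+\int_0^te^{(t-\tau)\mathcal L}f(U(\tau))\,d\tau$ for all $t\in[0,T]$. Write $S_tU_0=U(t)$; this does not depend on $T\ge t$. 2. For all $R$ and all $T>0$ there is a constant $C_{R,T}>0$ such that $\|S_tU_1-S_tU_2\|_{\mathcal H}\le C_{R,T}\|U_1-U_2\|_{\mathcal H}$ for all $t\in[0,T]$ and all $U_1,U_2\in\mathcal H$ with $\|U_1\|_{\mathcal H},\|U_2\|_{\mathcal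 H}\le R$. 3. If $U_0\in D(\mathcal L)$, then for every $T>0$ the mild solution $U(t)=S_tU_0$ is a classical solution on $[0,T)$: it is continuously differentiable on $[0,T)$ (one-sidedly at $0$), its values lie in $D(\mathcal L)$, and it satisfies (P). -/

import Mathlib

open MeasureTheory Set Filter Topology

noncomputable section

namespace BergerPlate

/-! ### The operator `A` and the scale `F_s = D(A^s)` -/

/-- A self-adjoint operator `A : D(A) ⊆ H → H` together with an orthonormal eigenbasis
`e_0, e_1, …` of `H`, whose eigenvalues satisfy `0 < lam 0 ≤ lam 1 ≤ …` and tend to infinity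
(so that `A` is positive). Indices start at `0`, hence `lam 0` is the lowest eigenvalue. -/
structure SpectralOperator (H : Type*) [NormedAddCommGroup H] [InnerProductSpace ℝ H]
    [CompleteSpace H] where
  /-- the operator itself, with its domain -/
  op : H →ₗ.[ℝ] H
  isSelfAdjoint : IsSelfAdjoint op
  /-- the eigenbasis -/
  e : HilbertBasis ℕ ℝ H
  /-- the eigenvalues -/
  lam : ℕ → ℝ
  e_mem : ∀ k, e k ∈ op.domain
  op_e : ∀ k, op ⟨e k, e_mem k⟩ = lam k • e k
  lam_zero_pos : 0 < lam 0
  lam_mono : Monotone lam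
  lam_tendsto : Tendsto lam atTop atTop

variable {H : Type*} [NormedAddCommGroup H] [InnerProductSpace ℝ H] [CompleteSpace H]

namespace SpectralOperator

theorem lam_pos (A : SpectralOperator H) (k : ℕ) : 0 < A.lam k :=
  A.lam_zero_pos.trans_le (A.lam_mono (Nat.zero_le k))

/-- The condition `∑ lam_k^{2s} (v, e_k)^2 < ∞` says that the coefficients of `A^s v` lie
in `ℓ²`. -/
theorem summable_iff_memlp (A : SpectralOperator H) (s : ℝ) (v : H) :
    (Summable fun k => A.lam k ^ (2 * s) * inner ℝ v (A.e k) ^ 2) ↔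
      Memℓp (fun k => A.lam k ^ s * inner ℝ v (A.e k)) 2 := by
  rw [memℓp_gen_iff (by norm_num)]
  refine summable_congr fun k => ?_
  have h : A.lam k ^ (2 * s) = (A.lam k ^ s) ^ 2 := by
    rw [mul_comm, Real.rpow_mul (A.lam_pos k).le]; norm_num
  simp only [h, Real.norm_eq_abs, ENNReal.toReal_ofNat, Real.rpow_ofNat, sq_abs, mul_pow]

/-- `D(A^s) = {v = ∑ c_k e_k : ∑ c_k^2 lam_k^{2s} < ∞}`, as a subspace of `H`; it is used for
`s ≥ 0` only (`s = 1` and `s = 1/2`). -/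
def powDomain (A : SpectralOperator H) (s : ℝ) : Submodule ℝ H where
  carrier := {v | Summable fun k => A.lam k ^ (2 * s) * inner ℝ v (A.e k) ^ 2}
  zero_mem' := by simp [summable_zero]
  add_mem' {v w} hv hw := by
    simp only [mem_ofPred_eq, summable_iff_memlp] at hv hw ⊢
    convert hv.add hw using 1
    funext k
    simp [inner_add_left, mul_add]
  smul_mem' c v hv := by
    simp only [mem_ofPred_eq, summable_iff_memlp] at hv ⊢
    convert hv.const_smul c using 1
    funext k
    simp [inner_smul_left]
    ring

/-- The space `F_s = D(A^s)`, `s ≥ 0`, which carries its own norm `‖v‖_s = ‖A^s v‖` (and not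
the norm of `H`). -/
def F (A : SpectralOperator H) (s : ℝ) : Type _ := A.powDomain s

instance (A : SpectralOperator H) (s : ℝ) : AddCommGroup (A.F s) :=
  inferInstanceAs (AddCommGroup (A.powDomain s))

instance (A : SpectralOperator H) (s : ℝ) : Module ℝ (A.F s) :=
  inferInstanceAs (Module ℝ (A.powDomain s))

/-- The inclusion `F_s ⊆ H`. -/
def toH (A : SpectralOperator H) (s : ℝ) : A.F s →ₗ[ℝ] H := (A.powDomain s).subtype

/-- An element of the subspace `D(A^s)` of `H`, viewed in `F_s`. -/
def ofMem (A : SpectralOperator H) {s : ℝ} {v : H} (hv : v ∈ A.powDomain s) : A.F s := ⟨v, hv⟩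

theorem toH_ofMem (A : SpectralOperator H) {s : ℝ} {v : H} (hv : v ∈ A.powDomain s) :
    A.toH s (A.ofMem hv) = v := rfl

theorem toH_injective (A : SpectralOperator H) (s : ℝ) : Function.Injective (A.toH s) :=
  Subtype.val_injective

theorem memlp_toH (A : SpectralOperator H) (s : ℝ) (v : A.F s) :
    Memℓp (fun k => A.lam k ^ s * inner ℝ (A.toH s v) (A.e k)) 2 :=
  (A.summable_iff_memlp s _).1 v.2

/-- The power `A^s : F_s → H`, `A^s v = ∑ lam_k^s (v, e_k) e_k`. -/
def pow (A : SpectralOperator H) (s : ℝ) : A.F s →ₗ[ℝ] H where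
  toFun v := A.e.repr.symm ⟨fun k => A.lam k ^ s * inner ℝ (A.toH s v) (A.e k), A.memlp_toH s v⟩
  map_add' v w := by
    rw [← map_add]
    congr 1
    ext k
    simp only [map_add, inner_add_left, mul_add]
    rfl
  map_smul' c v := by
    rw [RingHom.id_apply, ← map_smul]
    congr 1
    ext k
    simp [inner_smul_left]
    ring

theorem inner_pow_e (A : SpectralOperator H) (s : ℝ) (v : A.F s) (k : ℕ) :
    inner ℝ (A.pow s v) (A.e k) = A.lam k ^ s * inner ℝ (A.toH s v) (A.e k) := by
  rw [real_inner_comm, ← A.e.repr_apply_apply]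
  simp [pow]

theorem pow_injective (A : SpectralOperator H) (s : ℝ) : Function.Injective (A.pow s) := by
  refine (injective_iff_map_eq_zero _).2 fun v hv => ?_
  apply A.toH_injective s
  rw [map_zero]
  apply A.e.repr.injective
  ext k
  have h := A.inner_pow_e s v k
  rw [hv, inner_zero_left] at h
  have h2 := (mul_eq_zero.1 h.symm).resolve_left (Real.rpow_pos_of_pos (A.lam_pos k) s).ne'
  rw [A.e.repr_apply_apply, real_inner_comm, h2]
  simp

/-- The norm `‖v‖_s = ‖A^s v‖` of `F_s`. -/
instance (A : SpectralOperator H) (s : ℝ) : NormedAddCommGroup (A.F s) :=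
  NormedAddCommGroup.induced (A.F s) H (A.pow s) (A.pow_injective s)

/-- The inner product `(v, w)_s = (A^s v, A^s w)` of `F_s`. -/
instance (A : SpectralOperator H) (s : ℝ) : InnerProductSpace ℝ (A.F s) where
  norm_smul_le c v := by
    change ‖A.pow s (c • v)‖ ≤ ‖c‖ * ‖A.pow s v‖
    rw [map_smul, norm_smul]
  inner v w := inner ℝ (A.pow s v) (A.pow s w)
  norm_sq_eq_re_inner v := by
    change ‖A.pow s v‖ ^ 2 = _
    simp
  conj_inner_symm v w := by simp [real_inner_comm]
  add_left u v w := by simp [inner_add_left]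
  smul_left v w c := by simp [inner_smul_left]

theorem norm_F (A : SpectralOperator H) (s : ℝ) (v : A.F s) : ‖v‖ = ‖A.pow s v‖ := rfl

theorem hasSum_norm_sq (A : SpectralOperator H) (v : H) :
    HasSum (fun k => inner ℝ v (A.e k) ^ 2) (‖v‖ ^ 2) := by
  rw [← real_inner_self_eq_norm_sq]
  have h := A.e.hasSum_inner_mul_inner v v
  simpa only [real_inner_comm v, sq] using h

theorem lam_rpow_le (A : SpectralOperator H) {r s : ℝ} (h : r ≤ s) (k : ℕ) :
    A.lam k ^ (2 * r) ≤ A.lam 0 ^ (2 * (r - s)) * A.lam k ^ (2 * s) := by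
  have h0 := A.lam_mono (Nat.zero_le k)
  have e1 : A.lam k ^ (2 * r) = A.lam k ^ (2 * (r - s)) * A.lam k ^ (2 * s) := by
    rw [← Real.rpow_add (A.lam_pos k)]; ring_nf
  rw [e1]
  exact mul_le_mul_of_nonneg_right
    (Real.rpow_le_rpow_of_nonpos A.lam_zero_pos h0 (by linarith))
    (Real.rpow_nonneg (A.lam_pos k).le _)

theorem hasSum_inner' (A : SpectralOperator H) (v w : H) :
    HasSum (fun k => inner ℝ v (A.e k) * inner ℝ w (A.e k)) (inner ℝ v w) := by
  have h := A.e.hasSum_inner_mul_inner v w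
  simpa only [real_inner_comm w] using h

theorem op_symm (A : SpectralOperator H) (x y : A.op.domain) :
    inner ℝ (A.op x) (y : H) = inner ℝ (x : H) (A.op y) := by
  have h := A.op.adjoint_isFormalAdjoint A.isSelfAdjoint.dense_domain
  have h2 : A.op.adjoint = A.op := A.isSelfAdjoint
  rw [h2] at h
  exact h x y

theorem inner_op_e (A : SpectralOperator H) (x : A.op.domain) (k : ℕ) :
    inner ℝ (A.op x) (A.e k) = A.lam k * inner ℝ (x : H) (A.e k) := by
  have := A.op_symm x ⟨A.e k, A.e_mem k⟩
  rw [A.op_e, inner_smul_right] at this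
  exact this

/-- `D(A) = F_1`. -/
theorem mem_domain_iff (A : SpectralOperator H) (v : H) : v ∈ A.op.domain ↔ v ∈ A.powDomain 1 := by
  constructor
  · intro hv
    change Summable _
    refine (A.hasSum_norm_sq (A.op ⟨v, hv⟩)).summable.congr fun k => ?_
    rw [A.inner_op_e, mul_pow]
    norm_num
  · intro hv
    have h2 : A.op.adjoint = A.op := A.isSelfAdjoint
    rw [← h2]
    refine LinearPMap.mem_adjoint_domain_of_exists v ⟨A.pow 1 (A.ofMem hv), fun x => ?_⟩
    refine (A.hasSum_inner' _ _).unique ?_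
    convert A.hasSum_inner' v (A.op x) using 2 with k
    rw [A.inner_op_e, A.inner_pow_e, Real.rpow_one, A.toH_ofMem]
    ring

/-- On `D(A) = F_1` the first power is the operator. -/
theorem pow_one (A : SpectralOperator H) (v : A.op.domain) :
    A.pow 1 (A.ofMem ((A.mem_domain_iff v).1 v.2)) = A.op v := by
  apply A.e.repr.injective
  ext k
  have h := (A.inner_pow_e 1 (A.ofMem ((A.mem_domain_iff v).1 v.2)) k).trans
    ((by rw [Real.rpow_one, A.toH_ofMem] : _ = _).trans (A.inner_op_e v k).symm)
  simpa only [A.e.repr_apply_apply, real_inner_comm (A.e k)] using h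

theorem pow_surjective (A : SpectralOperator H) {s : ℝ} (hs : 0 ≤ s) :
    Function.Surjective (A.pow s) := by
  intro z
  have hm : Memℓp (fun k => A.lam k ^ (-s) * inner ℝ z (A.e k)) 2 := by
    rw [← A.summable_iff_memlp]
    refine Summable.of_nonneg_of_le (fun k => mul_nonneg (Real.rpow_nonneg (A.lam_pos k).le _)
      (sq_nonneg _)) (fun k => ?_) ((A.hasSum_norm_sq z).summable.mul_left (A.lam 0 ^ (2 * -s)))
    exact mul_le_mul_of_nonneg_right (Real.rpow_le_rpow_of_nonpos A.lam_zero_pos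
      (A.lam_mono (Nat.zero_le k)) (by linarith)) (sq_nonneg _)
  set v : H := A.e.repr.symm ⟨_, hm⟩ with hv
  have hve : ∀ k, inner ℝ v (A.e k) = A.lam k ^ (-s) * inner ℝ z (A.e k) := fun k => by
    rw [real_inner_comm, ← A.e.repr_apply_apply, hv, LinearIsometryEquiv.apply_symm_apply]
  have key : ∀ k, A.lam k ^ s * inner ℝ v (A.e k) = inner ℝ z (A.e k) := fun k => by
    rw [hve, ← mul_assoc, ← Real.rpow_add (A.lam_pos k)]; simp
  have hvd : v ∈ A.powDomain s := by
    refine (A.hasSum_norm_sq z).summable.congr fun k => ?_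
    rw [← key, mul_pow, mul_comm 2 s, Real.rpow_mul (A.lam_pos k).le]; norm_num
  refine ⟨A.ofMem hvd, A.e.repr.injective ?_⟩
  ext k
  have h := (A.inner_pow_e s (A.ofMem hvd) k).trans (key k)
  simpa only [A.e.repr_apply_apply, real_inner_comm (A.e k)] using h

/-- The space `F_s`, `s ≥ 0`, is a Hilbert space. -/
theorem completeSpace_F (A : SpectralOperator H) {s : ℝ} (hs : 0 ≤ s) : CompleteSpace (A.F s) := by
  let φ : A.F s →ₗᵢ[ℝ] H := ⟨A.pow s, fun _ => rfl⟩
  let ψ := LinearIsometryEquiv.ofSurjective φ (A.pow_surjective hs)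
  exact (completeSpace_congr (e := ψ.toEquiv) ψ.isometry.isUniformEmbedding).2 inferInstance

/-- The inclusion `F_s ⊆ F_r` for `r ≤ s`. -/
def incl (A : SpectralOperator H) {r s : ℝ} (h : r ≤ s) : A.F s →ₗ[ℝ] A.F r :=
  Submodule.inclusion (p := A.powDomain s) (p' := A.powDomain r) fun v hv => by
    refine Summable.of_nonneg_of_le (fun k => mul_nonneg (Real.rpow_nonneg (A.lam_pos k).le _)
      (sq_nonneg _)) (fun k => ?_) (Summable.mul_left (A.lam 0 ^ (2 * (r - s))) hv)
    rw [← mul_assoc]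
    exact mul_le_mul_of_nonneg_right (A.lam_rpow_le h k) (sq_nonneg _)

theorem norm_toH_le (A : SpectralOperator H) {s : ℝ} (hs : 0 ≤ s) (v : A.F s) :
    ‖A.toH s v‖ ≤ A.lam 0 ^ (-s) * ‖v‖ := by
  have hpos := Real.rpow_pos_of_pos A.lam_zero_pos (-s)
  refine abs_le_of_sq_le_sq' ?_ (by positivity) |>.2
  rw [mul_pow, norm_F]
  refine hasSum_le (fun k => ?_) (A.hasSum_norm_sq (A.toH s v))
    ((A.hasSum_norm_sq (A.pow s v)).mul_left _)
  rw [A.inner_pow_e, mul_pow, ← mul_assoc, ← mul_pow]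
  refine le_mul_of_one_le_left (sq_nonneg _) (one_le_pow₀ ?_)
  rw [Real.rpow_neg A.lam_zero_pos.le, inv_mul_eq_div,
    one_le_div (Real.rpow_pos_of_pos A.lam_zero_pos s)]
  exact Real.rpow_le_rpow A.lam_zero_pos.le (A.lam_mono (Nat.zero_le k)) hs

/-- The inclusion `F_s ⊆ H`, `s ≥ 0`, as a continuous map. -/
def toHL (A : SpectralOperator H) {s : ℝ} (hs : 0 ≤ s) : A.F s →L[ℝ] H :=
  (A.toH s).mkContinuous (A.lam 0 ^ (-s)) (A.norm_toH_le hs)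

/-- The power `A^s : F_s → H` as a continuous map (it is an isometry). -/
def powL (A : SpectralOperator H) (s : ℝ) : A.F s →L[ℝ] H :=
  (A.pow s).mkContinuous 1 fun v => by rw [one_mul, norm_F]

/-- The space `F_{-s}`, `s ≥ 0`: the dual of `F_s` with respect to the pivot space `H`. -/
abbrev Fneg (A : SpectralOperator H) (s : ℝ) : Type _ := A.F s →L[ℝ] ℝ

/-- The embedding `H = F_0 ⊆ F_{-s}`, `z ↦ (z, ·)`. -/
def ofH (A : SpectralOperator H) {s : ℝ} (hs : 0 ≤ s) (z : H) : A.Fneg s :=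
  (innerSL ℝ z).comp (A.toHL hs)

/-- The operator `A^{2s} : F_s → F_{-s}`, `⟨A^{2s} v, φ⟩ = (A^s v, A^s φ)`. -/
def powNeg (A : SpectralOperator H) (s : ℝ) (v : A.F s) : A.Fneg s := innerSL ℝ v

/-- The operator `A : H → F_{-1}`, `⟨A v, φ⟩ = (v, A φ)`. -/
def opNeg (A : SpectralOperator H) (v : H) : A.Fneg 1 := (innerSL ℝ v).comp (A.powL 1)

end SpectralOperator

/-! ### Memory kernels, the weighted spaces and differentiation in the memory variable -/

/-- The assumptions on a memory kernel `μ` on `ℝ₊ = (0, ∞)`: it is in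
`C¹(ℝ₊) ∩ L¹(ℝ₊) ∩ C[0, ∞)`, it is nonnegative, and `μ' + δ μ ≤ 0` on `ℝ₊`. -/
structure IsMemoryKernel (μ : ℝ → ℝ) (δ : ℝ) : Prop where
  contDiffOn : ContDiffOn ℝ 1 μ (Ioi 0)
  integrableOn : IntegrableOn μ (Ioi 0)
  continuousOn : ContinuousOn μ (Ici 0)
  nonneg : ∀ s > 0, 0 ≤ μ s
  deriv_le : ∀ s > 0, deriv μ s + δ * μ s ≤ 0

/-- The measure `μ(s) ds` on `ℝ₊`. -/
def memMeasure (μ : ℝ → ℝ) : Measure ℝ :=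
  (volume.restrict (Ioi 0)).withDensity fun s => ENNReal.ofReal (μ s)

/-- The weighted space `L²_μ(ℝ₊; E)`. -/
abbrev L2mem (μ : ℝ → ℝ) (E : Type*) [NormedAddCommGroup E] : Type _ := Lp E 2 (memMeasure μ)

/-- `η ∈ L²_μ(ℝ₊; E)` has the distributional derivative `η_s = ζ ∈ L²_μ(ℝ₊; E)` and satisfies
`η(0) = 0`.  Elements of `L²_μ(ℝ₊; E)` are functions on `{s > 0 : μ s > 0}` only (an interval
`(0, s₀)` with `s₀ ≤ ∞`, for a memory kernel), so this is the set in which the test functions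
are supported; the value at `0` is taken by the representative of `η` with limit at `0`. -/
def HasMemDeriv {μ : ℝ → ℝ} {E : Type*} [NormedAddCommGroup E] [NormedSpace ℝ E]
    (η ζ : L2mem μ E) : Prop :=
  (∀ φ : ℝ → ℝ, ContDiff ℝ (⊤ : ℕ∞) φ → HasCompactSupport φ → tsupport φ ⊆ {s | 0 < s ∧ 0 < μ s} →
    ∫ s in Ioi 0, deriv φ s • η s = -∫ s in Ioi 0, φ s • ζ s) ∧
  ∃ g : ℝ → E, g =ᵐ[memMeasure μ] η ∧ Tendsto g (𝓝[>] 0) (𝓝 0)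

/-! ### The phase space, the operator `𝓛` and the nonlinearity -/

/-- The phase space `F_1 × H × H × L²_{μ₁}(ℝ₊; F_1) × L²_{μ₂}(ℝ₊; F_{1/2})`, with the
Hilbert space norm of the product. Its elements are `U = (u; w; v; η₁; η₂)`, where `η₁` is the
memory of the displacement and `η₂` the memory of the temperature. -/
abbrev Phase (A : SpectralOperator H) (μ₁ μ₂ : ℝ → ℝ) : Type _ :=
  WithLp 2 (A.F 1 × WithLp 2 (H × WithLp 2 (H × WithLp 2
    (L2mem μ₁ (A.F 1) × L2mem μ₂ (A.F (1 / 2))))))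

section Components

variable {A : SpectralOperator H} {μ₁ μ₂ : ℝ → ℝ}

/-- The element `(u; w; v; η₁; η₂)` of the phase space. -/
def Phase.mk (u : A.F 1) (w v : H) (η₁ : L2mem μ₁ (A.F 1)) (η₂ : L2mem μ₂ (A.F (1 / 2))) :
    Phase A μ₁ μ₂ :=
  WithLp.toLp 2 (u, WithLp.toLp 2 (w, WithLp.toLp 2 (v, WithLp.toLp 2 (η₁, η₂))))

/-- The displacement `u`. -/
def Phase.u (U : Phase A μ₁ μ₂) : A.F 1 := U.fst
/-- The velocity `w`. -/
def Phase.w (U : Phase A μ₁ μ₂) : H := U.snd.fst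
/-- The temperature `v`. -/
def Phase.v (U : Phase A μ₁ μ₂) : H := U.snd.snd.fst
/-- The memory `η₁` of the displacement. -/
def Phase.η₁ (U : Phase A μ₁ μ₂) : L2mem μ₁ (A.F 1) := U.snd.snd.snd.fst
/-- The memory `η₂` of the temperature. -/
def Phase.η₂ (U : Phase A μ₁ μ₂) : L2mem μ₂ (A.F (1 / 2)) := U.snd.snd.snd.snd

end Components

/-- The graph of the linear operator `𝓛`: `LGraph … U V` says `U ∈ D(𝓛)` and `𝓛 U = V`, i.e.
* `w ∈ F_1`, `v ∈ F_{1/2}`, the memories `η₁`, `η₂` have distributional derivatives `ζ₁`, `ζ₂`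
  in the weighted spaces and vanish at `0`;
* `β A²u + ∫ μ₁ A²η₁ ds - ν A v` (in `F_{-1}`) and `ω A v + ∫ μ₂ A η₂ ds` (in `F_{-1/2}`) are
  elements of `H`;
* `V` consists of `w`, of `-(β A²u + ∫ μ₁ A²η₁ ds - ν A v)`, of
  `-(ω A v + ∫ μ₂ A η₂ ds) - ν A w`, of `-ζ₁ + w`, and of `-ζ₂ + v`. -/
def LGraph (A : SpectralOperator H) (β ν ω : ℝ) (μ₁ μ₂ : ℝ → ℝ) (U V : Phase A μ₁ μ₂) : Prop :=
  ∃ (w : A.F 1) (v : A.F (1 / 2)) (ζ₁ : L2mem μ₁ (A.F 1)) (ζ₂ : L2mem μ₂ (A.F (1 / 2)))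
    (x y : H),
    A.toH 1 w = Phase.w U ∧ A.toH (1 / 2) v = Phase.v U ∧
    HasMemDeriv (Phase.η₁ U) ζ₁ ∧ HasMemDeriv (Phase.η₂ U) ζ₂ ∧
    β • A.powNeg 1 (Phase.u U) + (∫ s in Ioi 0, μ₁ s • A.powNeg 1 (Phase.η₁ U s))
      - ν • A.opNeg (Phase.v U) = A.ofH zero_le_one x ∧
    ω • A.powNeg (1 / 2) v + (∫ s in Ioi 0, μ₂ s • A.powNeg (1 / 2) (Phase.η₂ U s))
      = A.ofH one_half_pos.le y ∧
    Phase.u V = w ∧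
    Phase.w V = -x ∧
    Phase.v V = -y - ν • A.pow 1 w ∧
    (Phase.η₁ V =ᵐ[memMeasure μ₁] fun s => -ζ₁ s + w) ∧
    (Phase.η₂ V =ᵐ[memMeasure μ₂] fun s => -ζ₂ s + v)

/-- The domain `D(𝓛)`. -/
def LDomain (A : SpectralOperator H) (β ν ω : ℝ) (μ₁ μ₂ : ℝ → ℝ) : Set (Phase A μ₁ μ₂) :=
  {U | ∃ V, LGraph A β ν ω μ₁ μ₂ U V}

/-- The nonlinearity `f(U) = (0; -M(‖A^{1/2}u‖²) A u + p; 0; 0; 0)`. -/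
def nonlin (A : SpectralOperator H) (μ₁ μ₂ : ℝ → ℝ) (M : ℝ → ℝ) (p : H) (U : Phase A μ₁ μ₂) :
    Phase A μ₁ μ₂ :=
  Phase.mk 0
    (-(M (‖A.pow (1 / 2) (A.incl one_half_lt_one.le (Phase.u U))‖ ^ 2) • A.pow 1 (Phase.u U)) + p)
    0 0 0

/-! ### Semigroups, mild and classical solutions -/

section Abstract

variable {X : Type*} [NormedAddCommGroup X] [NormedSpace ℝ X]

/-- `S` is a strongly continuous semigroup of bounded linear operators (only its values at
times `t ≥ 0` matter). -/
structure IsC0Semigroup (S : ℝ → X →L[ℝ] X) : Prop where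
  zero : S 0 = ContinuousLinearMap.id ℝ X
  add : ∀ s ≥ 0, ∀ t ≥ 0, S (s + t) = (S s).comp (S t)
  tendsto : ∀ x, Tendsto (fun t => S t x) (𝓝[>] 0) (𝓝 x)

/-- The operator with graph `G` is the infinitesimal generator of `S`: `x` is in its domain and
is mapped to `y` if and only if `(S h x - x) / h → y` as `h → 0+`. -/
def IsGenerator (G : X → X → Prop) (S : ℝ → X →L[ℝ] X) : Prop :=
  ∀ x y, G x y ↔ Tendsto (fun h : ℝ => h⁻¹ • (S h x - x)) (𝓝[>] 0) (𝓝 y)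

/-- `U ∈ C([0,T]; X)` is a mild solution of `U' = 𝓛 U + f(U)`, `U(0) = U₀`, where `S t` is the
semigroup `e^{t𝓛}`: `U(t) = e^{t𝓛} U₀ + ∫₀ᵗ e^{(t-τ)𝓛} f(U(τ)) dτ` on `[0,T]`. -/
def IsMildSolution (S : ℝ → X →L[ℝ] X) (f : X → X) (T : ℝ) (U₀ : X) (U : ℝ → X) : Prop :=
  ContinuousOn U (Icc 0 T) ∧
    ∀ t ∈ Icc 0 T, U t = S t U₀ + ∫ τ in (0 : ℝ)..t, S (t - τ) (f (U τ))

/-- `U` is a classical solution of `U' = 𝓛 U + f(U)`, `U(0) = U₀` on `[0,T)`, where `G` is the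
graph of `𝓛`: it is continuously differentiable on `[0,T)` (one-sided at `0`), and for each
`t ∈ [0,T)` we have `U(t) ∈ D(𝓛)` and `U'(t) = 𝓛 U(t) + f(U(t))`. -/
def IsClassicalSolution (G : X → X → Prop) (f : X → X) (T : ℝ) (U₀ : X) (U : ℝ → X) : Prop :=
  U 0 = U₀ ∧ ∃ U' V : ℝ → X, ContinuousOn U' (Ico 0 T) ∧
    ∀ t ∈ Ico 0 T, HasDerivWithinAt U (U' t) (Ico 0 T) t ∧ G (U t) (V t) ∧
      U' t = V t + f (U t)

end Abstract

end BergerPlate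

end

/-! The linear part is dissipative in a suitable norm, the nonlinearity is `C¹` and Lipschitz on
balls, and an energy bound excludes blow-up.

Linear part. Once the displacement is rescaled by `√β`, the pairing of `𝓛 U` with `U` loses all its
mixed terms: the elastic terms, the `ν`-coupling and the pairings of the memories with `w` and `v`
cancel. What remains is `-ω ‖v‖²_{1/2}` and `-(ζᵢ, ηᵢ)`, where `ζᵢ` is the derivative of `ηᵢ`; the
latter is nonpositive because the kernels decrease. To solve `l U - 𝓛 U = F`, eliminate the
displacement and the memories. The memory equations are first order ODEs in `s`, and the means of
their solutions depend affinely on `w` and `v`, with slopes `c₁, c₂ ≥ 0`. There remain two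
variational equations for `(w, v)` with a skew coupling, which Lax–Milgram solves because `β / l +
c₁ > 0` and `ω + c₂ > 0`; the second inequality is the role of the condition on `ω` and `μ₂`. Hence
`isMaxDissipative_lGraph`, and Lumer–Phillips (`IsMaxDissipative.exists_semigroup`, by Yosida
approximation) gives a semigroup of contractions in the rescaled norm, bounded in the original one.

Nonlinear part. The energy is the rescaled squared norm plus `P(‖A^{1/2} u‖²) - 2 (p, u) + K ‖u‖²`,
with `P` the primitive of `M`. The force `f` is cancelled by the derivative of the second and third
terms, so only `2 K (u, w)` can make the energy grow. The possibly negative `P` is controlled by the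
interpolation `‖A^{1/2} u‖² ≤ ‖u‖_1 ‖u‖` and a large `K`. So the energy grows at most exponentially
(`exists_apriori_bound`).

The energy can be differentiated only along classical solutions, so regularity is needed before
globality: for `C¹` nonlinearities, mild solutions from the domain are classical
(`classical_of_mild`), since their difference quotients converge to the solution of the linearised
Volterra equation. Density of the domain and a Lipschitz cutoff of `f` carry the bound over to all
data (`exists_mild`). Uniqueness and Lipschitz dependence are Grönwall's inequality on a ball. -/

noncomputable section

namespace BergerPlate

/-! ### Maximal dissipative relations and their resolvents. -/

section LumerPhillips

variable {X : Type*} [NormedAddCommGroup X] [InnerProductSpace ℝ X]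

/-- A linear, single-valued, maximal dissipative relation in a Hilbert space: the graph of a
maximal dissipative operator. -/
structure IsMaxDissipative (G : X → X → Prop) : Prop where
  add : ∀ {x y x' y'}, G x y → G x' y' → G (x + x') (y + y')
  smul : ∀ (c : ℝ) {x y}, G x y → G (c • x) (c • y)
  single_valued : ∀ {y}, G 0 y → y = 0
  dissip : ∀ {x y}, G x y → inner ℝ y x ≤ 0
  range : ∀ l > (0 : ℝ), ∀ z, ∃ x y, G x y ∧ l • x - y = z

namespace IsMaxDissipative

variable {G : X → X → Prop}

theorem sub (hG : IsMaxDissipative G) {x y x' y' : X} (h : G x y) (h' : G x' y') :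
    G (x - x') (y - y') := by
  have := hG.add h (hG.smul (-1) h')
  simpa [sub_eq_add_neg] using this

/-- Pair `l • x - y` with `x` and drop the term `-(y, x) ≥ 0`. -/
theorem mul_norm_le (hG : IsMaxDissipative G) {x y : X} (h : G x y) (l : ℝ) :
    l * ‖x‖ ≤ ‖l • x - y‖ := by
  have h1 : l * ‖x‖ * ‖x‖ ≤ ‖l • x - y‖ * ‖x‖ := by
    have h2 := real_inner_le_norm (l • x - y) x
    rw [inner_sub_left, inner_smul_left, real_inner_self_eq_norm_sq] at h2
    have h3 := hG.dissip h
    simp only [conj_trivial] at h2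
    nlinarith
  rcases (norm_nonneg x).eq_or_lt with h0 | h0
  · rw [← h0]; simp
  · exact le_of_mul_le_mul_right h1 h0

/-- Existence of preimages is the range condition; `mul_norm_le` makes them unique, so that the
chosen preimage depends linearly on `z`, and bounds them. -/
theorem exists_resolvent (hG : IsMaxDissipative G) {l : ℝ} (hl : 0 < l) :
    ∃ R : X →L[ℝ] X, (∀ z, l * ‖R z‖ ≤ ‖z‖) ∧ ∀ z, G (R z) (l • R z - z) := by
  have inj : ∀ {x y x' y'}, G x y → G x' y' → l • x - y = l • x' - y' → x = x' := by
    intro x y x' y' h h' e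
    have := hG.mul_norm_le (hG.sub h h') l
    rw [show l • (x - x') - (y - y') = 0 by
      rw [smul_sub, sub_sub_sub_comm, e, sub_self], norm_zero] at this
    have h3 : ‖x - x'‖ ≤ 0 := by
      by_contra h4
      have : 0 < l * ‖x - x'‖ := mul_pos hl (not_le.1 h4)
      linarith
    exact sub_eq_zero.1 (norm_le_zero_iff.1 h3)
  choose r s hrs e using hG.range l hl
  let R : X →ₗ[ℝ] X :=
    { toFun := r
      map_add' := fun z z' => inj (hrs _) (hG.add (hrs z) (hrs z')) <| by
        rw [e, smul_add, add_sub_add_comm, e, e]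
      map_smul' := fun c z => inj (hrs _) (hG.smul c (hrs z)) <| by
        rw [e, RingHom.id_apply, smul_comm, ← smul_sub, e] }
  have hR : ∀ z, l * ‖R z‖ ≤ ‖z‖ := fun z => by
    have := hG.mul_norm_le (hrs z) l
    rwa [e] at this
  refine ⟨R.mkContinuous l⁻¹ fun z => ?_, hR, fun z => ?_⟩
  · rw [inv_mul_eq_div, le_div_iff₀ hl, mul_comm]
    exact hR z
  · change G (r z) (l • r z - z)
    rw [show l • r z - z = s z by rw [sub_eq_iff_eq_add, ← sub_eq_iff_eq_add', e]]
    exact hrs z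

end IsMaxDissipative

end LumerPhillips

/-! ### Exponentials of bounded dissipative operators. -/

section BoundedDissipative

variable {X : Type*} [NormedAddCommGroup X] [InnerProductSpace ℝ X] [CompleteSpace X]

/-- The group generated by a bounded operator. -/
def expOp (B : X →L[ℝ] X) (t : ℝ) : X →L[ℝ] X := NormedSpace.exp (t • B)

omit [CompleteSpace X] in
theorem expOp_zero (B : X →L[ℝ] X) : expOp B 0 = 1 := by simp [expOp, NormedSpace.exp_zero]

theorem expOp_add (B : X →L[ℝ] X) (s t : ℝ) : expOp B (s + t) = expOp B s * expOp B t := by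
  let _ : NormedAlgebra ℚ (X →L[ℝ] X) := .restrictScalars ℚ ℝ _
  rw [expOp, add_smul, NormedSpace.exp_add_of_commute]
  · rfl
  · exact ((Commute.refl B).smul_left s).smul_right t

theorem hasDerivAt_expOp_apply (B : X →L[ℝ] X) (x : X) (t : ℝ) :
    HasDerivAt (fun t => expOp B t x) (expOp B t (B x)) t := by
  have h := hasDerivAt_exp_smul_const (𝕂 := ℝ) B t
  exact h.clm_apply (hasDerivAt_const t x) |>.congr_deriv (by simp [expOp])

omit [CompleteSpace X] in
theorem commute_expOp {B B' : X →L[ℝ] X} (h : Commute B' B) (t : ℝ) (x : X) :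
    B' (expOp B t x) = expOp B t (B' x) :=
  congrArg (· x) ((h.smul_right t).exp_right).eq

/-- The derivative of `‖e^{tB} x‖²` is `2 (B e^{tB} x, e^{tB} x) ≤ 0`. -/
theorem norm_expOp_apply_le {B : X →L[ℝ] X} (hB : ∀ x, inner ℝ (B x) x ≤ 0) {t : ℝ} (ht : 0 ≤ t)
    (x : X) : ‖expOp B t x‖ ≤ ‖x‖ := by
  have hd : ∀ t, HasDerivAt (fun t => ‖expOp B t x‖ ^ 2)
      (2 * inner ℝ (expOp B t x) (expOp B t (B x))) t := fun t =>
    (hasDerivAt_expOp_apply B x t).norm_sq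
  have ha : Antitone (fun t => ‖expOp B t x‖ ^ 2) := by
    refine antitone_of_deriv_nonpos (fun t => (hd t).differentiableAt) fun t => ?_
    rw [(hd t).deriv, ← commute_expOp (Commute.refl B), real_inner_comm]
    linarith [hB (expOp B t x)]
  have := ha ht
  simp only [expOp_zero, one_apply_eq_self] at this
  exact abs_le_of_sq_le_sq' this (norm_nonneg _) |>.2

/-- The path `s ↦ e^{sB} e^{(t-s)B'} x` joins the two exponentials. As `B` and `B'` commute, its
derivative is a product of contractions applied to `B x - B' x`. -/
theorem norm_expOp_sub_le {B B' : X →L[ℝ] X} (hB : ∀ x, inner ℝ (B x) x ≤ 0)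
    (hB' : ∀ x, inner ℝ (B' x) x ≤ 0) (hc : Commute B B') {t : ℝ} (ht : 0 ≤ t) (x : X) :
    ‖expOp B t x - expOp B' t x‖ ≤ t * ‖B x - B' x‖ := by
  let u : ℝ → X := fun s => expOp B s (expOp B' (t - s) x)
  have hu : ∀ s, HasDerivAt u (expOp B s (expOp B' (t - s) (B x - B' x))) s := fun s => by
    have h1 : HasDerivAt (fun s => expOp B' (t - s) x) (-(expOp B' (t - s) (B' x))) s := by
      have := (hasDerivAt_expOp_apply B' x (t - s)).scomp s ((hasDerivAt_id s).const_sub t)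
      simpa [Function.comp_def] using this
    have h2 : HasDerivAt (fun t => expOp B t) (expOp B s * B) s :=
      hasDerivAt_exp_smul_const (𝕂 := ℝ) B s
    refine (h2.clm_apply h1).congr_deriv ?_
    rw [map_sub, map_sub, map_neg, mul_apply_eq_comp, commute_expOp hc]
    abel
  have h := norm_image_sub_le_of_norm_deriv_le_segment' (f := u) (a := 0) (b := t)
    (C := ‖B x - B' x‖) (fun s _ => (hu s).hasDerivWithinAt) (fun s hs => ?_) t ⟨ht, le_rfl⟩
  · simpa [u, expOp_zero, mul_comm] using h
  · exact (norm_expOp_apply_le hB hs.1 _).trans (norm_expOp_apply_le hB' (by linarith [hs.2]) _)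

end BoundedDissipative

/-! ### Continuity and averages of semigroups. -/

section SemigroupFacts

variable {X : Type*} [NormedAddCommGroup X] [NormedSpace ℝ X]

theorem norm_semigroup_sub_le {S : ℝ → X →L[ℝ] X} {C : ℝ}
    (hadd : ∀ s ≥ 0, ∀ t ≥ 0, S (s + t) = (S s).comp (S t))
    (hC : ∀ t ≥ 0, ∀ x, ‖S t x‖ ≤ C * ‖x‖)
    {s t : ℝ} (hs : 0 ≤ s) (hst : s ≤ t) (x : X) :
    ‖S t x - S s x‖ ≤ C * ‖S (t - s) x - x‖ := by
  have h : S t x = S s (S (t - s) x) := by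
    rw [← ContinuousLinearMap.comp_apply, ← hadd s hs _ (by linarith)]; simp
  rw [h, ← map_sub]
  exact hC s hs _

/-- The semigroup law spreads continuity at `0` to all times, and the uniform bound upgrades it to
joint continuity. Freezing `S` at the identity for negative times (`hneg`) avoids one-sided
statements later. -/
theorem continuous_semigroup {S : ℝ → X →L[ℝ] X} {C : ℝ} (h0 : S 0 = ContinuousLinearMap.id ℝ X)
    (hadd : ∀ s ≥ 0, ∀ t ≥ 0, S (s + t) = (S s).comp (S t))
    (hC : ∀ t ≥ 0, ∀ x, ‖S t x‖ ≤ C * ‖x‖)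
    (hneg : ∀ t, S t = S (max t 0))
    (ht : ∀ x, Tendsto (fun t => S t x) (𝓝[>] 0) (𝓝 x)) :
    Continuous (fun p : ℝ × X => S p.1 p.2) := by
  have hlim : ∀ x, Tendsto (fun t => ‖S t x - x‖) (𝓝 0) (𝓝 0) := by
    intro x
    have h1 : Tendsto (fun t => S t x) (𝓝 0) (𝓝 x) := by
      rw [← nhdsLE_sup_nhdsGT, tendsto_sup]
      refine ⟨tendsto_const_nhds.congr' ?_, ht x⟩
      filter_upwards [self_mem_nhdsWithin] with t ht
      rw [hneg t, max_eq_right ht, h0]; rfl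
    simpa using (h1.sub_const x).norm
  have hcont : ∀ x, Continuous fun t => S t x := by
    intro x
    rw [continuous_iff_continuousAt]
    intro t
    rw [ContinuousAt, tendsto_iff_norm_sub_tendsto_zero]
    have hm : Tendsto (fun s : ℝ => |max s 0 - max t 0|) (𝓝 t) (𝓝 0) := by
      have : Continuous fun s : ℝ => |max s 0 - max t 0| := by fun_prop
      simpa using this.tendsto t
    have h2 := ((hlim x).comp hm).const_mul C
    rw [mul_zero] at h2
    refine squeeze_zero (fun _ => norm_nonneg _) (fun s => ?_) h2
    rw [hneg s, hneg t]
    rcases le_total (max s 0) (max t 0) with h | h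
    · rw [norm_sub_rev, Function.comp, abs_sub_comm, abs_of_nonneg (sub_nonneg.2 h)]
      exact norm_semigroup_sub_le hadd hC (le_max_right _ _) h x
    · rw [Function.comp, abs_of_nonneg (sub_nonneg.2 h)]
      exact norm_semigroup_sub_le hadd hC (le_max_right _ _) h x
  rw [continuous_iff_continuousAt]
  rintro ⟨t, x⟩
  rw [ContinuousAt, tendsto_iff_norm_sub_tendsto_zero]
  have h3 : Tendsto (fun p : ℝ × X => C * ‖p.2 - x‖ + ‖S p.1 x - S t x‖) (𝓝 (t, x)) (𝓝 0) := by
    have : Continuous fun p : ℝ × X => C * ‖p.2 - x‖ + ‖S p.1 x - S t x‖ := by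
      have := (hcont x).comp (continuous_fst (X := ℝ) (Y := X))
      simp only [Function.comp_def] at this
      fun_prop
    simpa using this.tendsto (t, x)
  refine squeeze_zero (fun _ => norm_nonneg _) (fun p => ?_) h3
  have h4 : S p.1 p.2 - S t x = S p.1 (p.2 - x) + (S p.1 x - S t x) := by rw [map_sub]; abel
  simp only
  rw [h4]
  refine (norm_add_le _ _).trans (add_le_add_left ?_ _)
  rw [hneg]
  exact hC _ (le_max_right _ _) _

/-- Used to read off the generator from `S h x - x = ∫₀ʰ S s y ds`. -/
theorem tendsto_average_right {g : ℝ → X} [CompleteSpace X] {a : ℝ} {b : ℝ} (hab : a < b)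
    (hg : ContinuousOn g (Icc a b)) :
    Tendsto (fun h : ℝ => h⁻¹ • ∫ s in a..(a + h), g s) (𝓝[>] 0) (𝓝 (g a)) := by
  have hI : IntervalIntegrable g volume a a := by simp
  have hw : ContinuousWithinAt g (Ici a) a :=
    (hg a ⟨le_rfl, hab.le⟩).mono_of_mem_nhdsWithin (Icc_mem_nhdsGE hab)
  have hm : StronglyMeasurableAtFilter g (𝓝[>] a) volume := by
    refine ⟨Ioc a b, Ioc_mem_nhdsGT hab, ?_⟩
    exact (hg.mono Ioc_subset_Icc_self).aestronglyMeasurable measurableSet_Ioc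
  have h := intervalIntegral.integral_hasDerivWithinAt_right (s := Ici a) (t := Ioi a) hI hm
    (hw.mono Ioi_subset_Ici_self)
  have h2 := (hasDerivWithinAt_iff_tendsto_slope' (by simp : a ∉ Ioi a)).1
    (h.mono Ioi_subset_Ici_self)
  have h3 : Tendsto (fun h : ℝ => a + h) (𝓝[>] 0) (𝓝[>] a) := by
    refine tendsto_nhdsWithin_iff.2 ⟨?_, ?_⟩
    · have : Continuous fun h : ℝ => a + h := by fun_prop
      simpa using (this.tendsto 0).mono_left nhdsWithin_le_nhds
    · filter_upwards [self_mem_nhdsWithin] with h hh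
      simpa using hh
  refine (h2.comp h3).congr fun h => ?_
  simp [slope]

end SemigroupFacts

/-! ### Yosida approximation and the Lumer–Phillips theorem. -/

section LumerPhillips

variable {X : Type*} [NormedAddCommGroup X] [InnerProductSpace ℝ X] [CompleteSpace X]
  {G : X → X → Prop}

namespace IsMaxDissipative

/-- The domain of a maximal dissipative operator. -/
def domain (hG : IsMaxDissipative G) : Submodule ℝ X where
  carrier := {x | ∃ y, G x y}
  zero_mem' := by
    obtain ⟨x, y, h, -⟩ := hG.range 1 one_pos 0
    exact ⟨0 • y, by simpa using hG.smul 0 h⟩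
  add_mem' := fun ⟨_, h⟩ ⟨_, h'⟩ => ⟨_, hG.add h h'⟩
  smul_mem' := fun c _ ⟨_, h⟩ => ⟨_, hG.smul c h⟩

/-- Let `x` be orthogonal to the domain and write `x = r - y` with `G r y`. Then `0 ≥ (y, r) =
‖r‖²`, hence `r = 0`, and single-valuedness gives `y = 0`. -/
theorem dense_domain (hG : IsMaxDissipative G) : Dense (hG.domain : Set X) := by
  rw [Submodule.dense_iff_topologicalClosure_eq_top, Submodule.topologicalClosure_eq_top_iff,
    Submodule.eq_bot_iff]
  intro x hx
  obtain ⟨r, y, h, e⟩ := hG.range 1 one_pos x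
  have h1 := hG.dissip h
  have h2 : inner ℝ r x = 0 := (Submodule.mem_orthogonal _ _).1 hx r ⟨y, h⟩
  rw [one_smul] at e
  have h3 : y = r - x := by rw [← e]; abel
  rw [h3, inner_sub_left, real_inner_comm r x, h2, sub_zero, real_inner_self_eq_norm_sq] at h1
  have h4 : r = 0 := by
    rw [← norm_eq_zero]
    nlinarith [norm_nonneg r]
  subst h4
  rw [← e, hG.single_valued h]
  simp

/-- The Yosida approximations. -/
theorem exists_approx (hG : IsMaxDissipative G) :
    ∃ Y : ℕ → X →L[ℝ] X, (∀ n x, inner ℝ (Y n x) x ≤ 0) ∧ (∀ n m, Commute (Y n) (Y m)) ∧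
      ∀ {x y}, G x y → Tendsto (fun n => Y n x) atTop (𝓝 y) := by
  have hpos : ∀ n : ℕ, (0 : ℝ) < n + 1 := fun n => by positivity
  choose R hR hRG using fun n : ℕ => hG.exists_resolvent (hpos n)
  have uniq : ∀ n {x y}, G x y → R n (((n : ℝ) + 1) • x - y) = x := by
    intro n x y h
    have h1 := hG.mul_norm_le (hG.sub (hRG n (((n : ℝ) + 1) • x - y)) h) (n + 1)
    rw [smul_sub] at h1
    have h2 : ∀ a b c : X, a - b - (a - (b - c) - c) = 0 := fun a b c => by abel
    rw [h2, norm_zero] at h1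
    have h3 : ‖R n (((n : ℝ) + 1) • x - y) - x‖ ≤ 0 := by
      by_contra h4
      have := mul_pos (hpos n) (not_le.1 h4)
      linarith
    exact sub_eq_zero.1 (norm_le_zero_iff.1 h3)
  -- The resolvent identity; dividing by `m - n` it yields commutation.
  have hres : ∀ n m z, R n z - R m z = ((m : ℝ) - n) • R n (R m z) := by
    intro n m z
    rw [← map_smul, ← uniq n (hG.sub (hRG n z) (hRG m z))]
    congr 1
    module
  have hcomm : ∀ n m, Commute (R n) (R m) := by
    intro n m
    ext z
    change R n (R m z) = R m (R n z)
    rcases eq_or_ne n m with rfl | h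
    · rfl
    · have h1 := hres n m z
      have h2 := hres m n z
      have h3 : ((m : ℝ) - n) • (R n (R m z) - R m (R n z)) = 0 := by
        rw [smul_sub, ← h1, ← neg_sub (n : ℝ) m, neg_smul, ← h2]; abel
      have h4 : (m : ℝ) - n ≠ 0 := sub_ne_zero.2 (by exact_mod_cast h.symm)
      exact sub_eq_zero.1 ((smul_eq_zero.1 h3).resolve_left h4)
  -- On the domain `(n + 1) R n x - x = R n y`, which is `O(1 / n)`; the operators `(n + 1) R n` are
  -- contractions, so the limit extends by density.
  have hlim : ∀ z, Tendsto (fun n : ℕ => ((n : ℝ) + 1) • R n z) atTop (𝓝 z) := by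
    have hn : ∀ (n : ℕ) z, ‖((n : ℝ) + 1) • R n z‖ ≤ ‖z‖ := fun n z => by
      rw [norm_smul, Real.norm_of_nonneg (hpos n).le]; exact hR n z
    intro z
    rw [Metric.tendsto_atTop]
    intro ε hε
    obtain ⟨x, hx, y, hxy⟩ := Metric.dense_iff.1 hG.dense_domain z (ε / 4) (by positivity)
    obtain ⟨N, hN⟩ := exists_nat_gt (‖y‖ / (ε / 4))
    refine ⟨N, fun n hnN => ?_⟩
    have h1 : ((n : ℝ) + 1) • R n x - x = R n y := by
      have := uniq n hxy
      rw [map_sub, map_smul, sub_eq_iff_eq_add] at this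
      rw [this]; abel
    have h2 : ‖R n y‖ ≤ ε / 4 := by
      have h3 := hR n y
      rw [div_lt_iff₀ (by positivity)] at hN
      have h5 : (N : ℝ) ≤ n := by exact_mod_cast hnN
      by_contra h4
      push Not at h4
      have : ((n : ℝ) + 1) * (ε / 4) < (n + 1) * ‖R n y‖ := mul_lt_mul_of_pos_left h4 (hpos n)
      nlinarith
    have h6 : ((n : ℝ) + 1) • R n z - z
        = ((n : ℝ) + 1) • R n (z - x) + R n y + (x - z) := by
      rw [← h1, map_sub, smul_sub]; abel
    rw [Metric.mem_ball, dist_eq_norm] at hx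
    rw [dist_eq_norm, h6]
    have h7 := hn n (z - x)
    rw [norm_sub_rev] at h7
    have h8 := hx
    calc _ ≤ ‖((n : ℝ) + 1) • R n (z - x)‖ + ‖R n y‖ + ‖x - z‖ := norm_add₃_le
      _ < ε := by linarith
  -- The Yosida operator is `(n + 1)` times the generator applied to `R n x`; on the domain it
  -- equals `(n + 1) R n y`, which converges to `y`.
  refine ⟨fun n => ((n : ℝ) + 1) • (((n : ℝ) + 1) • R n - 1), fun n x => ?_, fun n m => ?_,
    fun {x y} h => ?_⟩
  · have h1 := hG.dissip (hRG n x)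
    have h2 : inner ℝ (((n : ℝ) + 1) • R n x - x) x
        = (n + 1) * inner ℝ (((n : ℝ) + 1) • R n x - x) (R n x)
          - ‖((n : ℝ) + 1) • R n x - x‖ ^ 2 := by
      rw [← real_inner_self_eq_norm_sq, ← inner_smul_right, ← inner_sub_right]
      congr 1; abel
    simp only [smul_apply, sub_apply, one_apply_eq_self]
    rw [inner_smul_left, h2, conj_trivial]
    have := hpos n
    refine mul_nonpos_of_nonneg_of_nonpos this.le ?_
    nlinarith [sq_nonneg ‖((n : ℝ) + 1) • R n x - x‖]
  · have h1 : Commute (((n : ℝ) + 1) • R n - 1) (((m : ℝ) + 1) • R m - 1) :=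
      ((((hcomm n m).smul_left _).smul_right _).sub_right (Commute.one_right _)).sub_left
        (Commute.one_left _)
    exact (h1.smul_left _).smul_right _
  · refine (hlim y).congr fun n => ?_
    simp only [smul_apply, sub_apply, one_apply_eq_self]
    congr 1
    have := uniq n h
    rw [map_sub, map_smul, sub_eq_iff_eq_add] at this
    rw [this]; abel

/-- **Lumer–Phillips**: a maximal dissipative operator in a Hilbert space generates a strongly
continuous semigroup of contractions. -/
theorem exists_semigroup (hG : IsMaxDissipative G) :
    ∃ S : ℝ → X →L[ℝ] X, IsC0Semigroup S ∧ IsGenerator G S ∧ (∀ t x, ‖S t x‖ ≤ ‖x‖) ∧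
      ∀ t, S t = S (max t 0) := by
  obtain ⟨Y, hY, hYc, hYl⟩ := hG.exists_approx
  have hle : ∀ n t x, 0 ≤ t → ‖expOp (Y n) t x‖ ≤ ‖x‖ := fun n t x ht =>
    norm_expOp_apply_le (hY n) ht x
  -- On the domain the exponentials differ by at most `t ‖Y m z - Y n z‖`, and `Y n z` converges
  -- there; contractivity and density do the rest.
  have hcau : ∀ t, 0 ≤ t → ∀ x, CauchySeq fun n => expOp (Y n) t x := by
    intro t ht x
    rw [Metric.cauchySeq_iff]
    intro ε hε
    obtain ⟨z, hz, y, hzy⟩ := Metric.dense_iff.1 hG.dense_domain x (ε / 4) (by positivity)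
    rw [Metric.mem_ball, dist_eq_norm] at hz
    obtain ⟨N, hN⟩ := Metric.cauchySeq_iff.1 (hYl hzy).cauchySeq (ε / 4 / (t + 1)) (by positivity)
    refine ⟨N, fun m hm n hn => ?_⟩
    have h1 := norm_expOp_sub_le (hY m) (hY n) (hYc m n) ht z
    have h2 := hN m hm n hn
    rw [dist_eq_norm] at h2 ⊢
    have h3 : t * ‖Y m z - Y n z‖ ≤ ε / 4 := by
      rw [lt_div_iff₀ (by positivity)] at h2
      nlinarith [norm_nonneg (Y m z - Y n z)]
    have h4 : expOp (Y m) t x - expOp (Y n) t x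
        = expOp (Y m) t (x - z) + (expOp (Y m) t z - expOp (Y n) t z)
          + expOp (Y n) t (z - x) := by
      rw [map_sub, map_sub]; abel
    have h5 := hle m t (x - z) ht
    have h6 := hle n t (z - x) ht
    rw [norm_sub_rev] at h5
    rw [h4]
    have h8 := hz
    calc _ ≤ _ := norm_add₃_le
      _ < ε := by linarith
  -- Evaluating at `max t 0` freezes the limit at the identity for negative times.
  have hex : ∀ t, ∃ T : X →L[ℝ] X, ∀ x,
      Tendsto (fun n => expOp (Y n) (max t 0) x) atTop (𝓝 (T x)) := by
    intro t
    have h0 := le_max_right t 0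
    choose T hT using fun x => cauchySeq_tendsto_of_complete (hcau _ h0 x)
    let T' : X →ₗ[ℝ] X :=
      { toFun := T
        map_add' := fun x y => tendsto_nhds_unique (hT _) <| by
          simpa only [map_add] using (hT x).add (hT y)
        map_smul' := fun c x => tendsto_nhds_unique (hT _) <| by
          simpa only [map_smul, RingHom.id_apply] using (hT x).const_smul c }
    refine ⟨T'.mkContinuous 1 fun x => ?_, hT⟩
    rw [one_mul]
    exact le_of_tendsto (hT x).norm (Eventually.of_forall fun n => hle n _ x h0)
  choose S hS using hex
  have hSle : ∀ t x, ‖S t x‖ ≤ ‖x‖ := fun t x =>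
    le_of_tendsto (hS t x).norm (Eventually.of_forall fun n => hle n _ x (le_max_right _ _))
  have hSneg : ∀ t, S t = S (max t 0) := fun t => by
    ext x
    refine tendsto_nhds_unique (hS t x) ?_
    simpa using hS (max t 0) x
  have hS' : ∀ t, 0 ≤ t → ∀ x, Tendsto (fun n => expOp (Y n) t x) atTop (𝓝 (S t x)) := by
    intro t ht x
    simpa [max_eq_left ht] using hS t x
  have hS0 : S 0 = ContinuousLinearMap.id ℝ X := by
    ext x
    refine tendsto_nhds_unique (hS' 0 le_rfl x) ?_
    simp [expOp_zero]
  have hSadd : ∀ s ≥ 0, ∀ t ≥ 0, S (s + t) = (S s).comp (S t) := by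
    intro s hs t ht
    ext x
    refine tendsto_nhds_unique (hS' _ (add_nonneg hs ht) x) ?_
    have h1 := hS' s hs (S t x)
    have h2 : Tendsto (fun n => expOp (Y n) s (expOp (Y n) t x - S t x)) atTop (𝓝 0) := by
      have h3 := ((hS' t ht x).sub_const (S t x)).norm
      rw [sub_self, norm_zero] at h3
      exact squeeze_zero_norm (fun n => hle n s _ hs) h3
    have h3 := h1.add h2
    rw [add_zero] at h3
    refine h3.congr fun n => ?_
    rw [expOp_add, map_sub]; simp
  have hlip : ∀ {x y}, G x y → ∀ t, 0 ≤ t → ‖S t x - x‖ ≤ t * ‖y‖ := by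
    intro x y h t ht
    refine le_of_tendsto_of_tendsto ((hS' t ht x).sub_const x).norm ((hYl h).norm.const_mul t)
      (Eventually.of_forall fun n => ?_)
    have := norm_expOp_sub_le (B' := 0) (hY n) (fun x => by simp) (Commute.zero_right _) ht x
    simpa [expOp, NormedSpace.exp_zero] using this
  have hStend : ∀ x, Tendsto (fun t => S t x) (𝓝[>] 0) (𝓝 x) := by
    intro x
    rw [Metric.tendsto_nhds]
    intro ε hε
    obtain ⟨z, hz, y, hzy⟩ := Metric.dense_iff.1 hG.dense_domain x (ε / 4) (by positivity)
    rw [Metric.mem_ball, dist_eq_norm] at hz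
    filter_upwards [Ioc_mem_nhdsGT (show (0 : ℝ) < ε / 4 / (‖y‖ + 1) by positivity)] with t ht
    rw [dist_eq_norm, show S t x - x = S t (x - z) + (S t z - z) + (z - x) by rw [map_sub]; abel]
    have h1 := hSle t (x - z)
    rw [norm_sub_rev] at h1
    have h2 := hlip hzy t ht.1.le
    have h3 : t * ‖y‖ ≤ ε / 4 := by
      have := (le_div_iff₀ (by positivity)).1 ht.2
      nlinarith [ht.1]
    have h8 := hz
    calc _ ≤ _ := norm_add₃_le
      _ < ε := by linarith
  have hScont := continuous_semigroup (C := 1) hS0 hSadd (fun t _ x => by simpa using hSle t x)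
    hSneg hStend
  have hScont' : ∀ x, Continuous fun t => S t x := fun x =>
    hScont.comp (continuous_id.prodMk continuous_const)
  -- The limit of the same formula for the Yosida exponentials, by dominated convergence.
  have hint : ∀ {x y}, G x y → ∀ t, 0 ≤ t → S t x - x = ∫ s in (0 : ℝ)..t, S s y := by
    intro x y h t ht
    have h1 : ∀ n, expOp (Y n) t x - x = ∫ s in (0 : ℝ)..t, expOp (Y n) s (Y n x) := by
      intro n
      have hc : Continuous fun s => expOp (Y n) s (Y n x) :=
        continuous_iff_continuousAt.2 fun s => (hasDerivAt_expOp_apply (Y n) (Y n x) s).continuousAt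
      rw [intervalIntegral.integral_eq_sub_of_hasDerivAt
        (fun s _ => hasDerivAt_expOp_apply (Y n) x s) (hc.intervalIntegrable _ _), expOp_zero]
      simp
    refine tendsto_nhds_unique ((hS' t ht x).sub_const x) ?_
    simp_rw [h1]
    obtain ⟨K, hK⟩ := (hYl h).norm.bddAbove_range
    refine intervalIntegral.tendsto_integral_filter_of_dominated_convergence (fun _ => K) ?_ ?_ ?_ ?_
    · refine Eventually.of_forall fun n => Continuous.aestronglyMeasurable ?_
      exact continuous_iff_continuousAt.2 fun s =>
        (hasDerivAt_expOp_apply (Y n) (Y n x) s).continuousAt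
    · refine Eventually.of_forall fun n => Eventually.of_forall fun s hs => ?_
      rw [uIoc_of_le ht] at hs
      exact (hle n s _ hs.1.le).trans (hK ⟨n, rfl⟩)
    · simp
    · refine Eventually.of_forall fun s hs => ?_
      rw [uIoc_of_le ht] at hs
      have h2 := hS' s hs.1.le y
      have h3 : Tendsto (fun n => expOp (Y n) s (Y n x - y)) atTop (𝓝 0) := by
        have h4 := ((hYl h).sub_const y).norm
        rw [sub_self, norm_zero] at h4
        exact squeeze_zero_norm (fun n => hle n s _ hs.1.le) h4
      have h5 := h2.add h3
      rw [add_zero] at h5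
      exact h5.congr fun n => by rw [map_sub]; abel
  have hgen : ∀ {x y}, G x y → Tendsto (fun h : ℝ => h⁻¹ • (S h x - x)) (𝓝[>] 0) (𝓝 y) := by
    intro x y h
    have h1 := tendsto_average_right (g := fun s => S s y) (a := 0) one_pos
      (hScont' y).continuousOn
    simp only [hS0, ContinuousLinearMap.id_apply, zero_add] at h1
    refine h1.congr' ?_
    filter_upwards [self_mem_nhdsWithin] with t ht
    rw [hint h t (le_of_lt ht)]
  refine ⟨S, ⟨hS0, hSadd, hStend⟩, fun x y => ⟨hgen, fun h => ?_⟩, hSle, hSneg⟩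
  -- The generator of `S` extends `G` and is dissipative because `S` is contractive; maximality
  -- excludes a proper extension. Here `x' - y' = x - y`, so `y - y' = x - x'`, and dissipativity
  -- forces both to vanish.
  obtain ⟨x', y', h', e⟩ := hG.range 1 one_pos (x - y)
  have h1 : Tendsto (fun h : ℝ => inner ℝ (h⁻¹ • (S h (x - x') - (x - x'))) (x - x')) (𝓝[>] 0)
      (𝓝 (inner ℝ (y - y') (x - x'))) := by
    refine ((h.sub (hgen h')).congr fun t => ?_).inner tendsto_const_nhds
    rw [← smul_sub, map_sub]; congr 1; abel
  have h2 : inner ℝ (y - y') (x - x') ≤ 0 := by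
    refine le_of_tendsto h1 ?_
    filter_upwards [self_mem_nhdsWithin] with t ht
    have h3 : inner ℝ (S t (x - x')) (x - x') ≤ ‖x - x'‖ * ‖x - x'‖ :=
      (real_inner_le_norm _ _).trans (mul_le_mul_of_nonneg_right (hSle _ _) (norm_nonneg _))
    rw [inner_smul_left, inner_sub_left, real_inner_self_eq_norm_mul_norm, conj_trivial]
    exact mul_nonpos_of_nonneg_of_nonpos (inv_nonneg.2 (le_of_lt ht)) (by linarith)
  have h3 : y - y' = x - x' := by
    rw [one_smul] at e
    rw [sub_eq_sub_iff_add_eq_add] at e ⊢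
    rw [add_comm y, e, add_comm]
  rw [h3, real_inner_self_eq_norm_sq] at h2
  have h4 : x - x' = 0 := by
    rw [← norm_eq_zero]
    nlinarith [norm_nonneg (x - x')]
  rw [h4] at h3
  rwa [sub_eq_zero.1 h3, sub_eq_zero.1 h4]

end IsMaxDissipative

end LumerPhillips

/-! ### Grönwall's inequality and Volterra equations. -/

section Mild

/-- **Grönwall's inequality**, integral form. -/
theorem le_mul_exp_of_le_add_integral {φ : ℝ → ℝ} {a K T : ℝ} (hK : 0 ≤ K)
    (hφ : ContinuousOn φ (Icc 0 T))
    (h : ∀ t ∈ Icc 0 T, φ t ≤ a + K * ∫ s in (0 : ℝ)..t, φ s) :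
    ∀ t ∈ Icc 0 T, φ t ≤ a * Real.exp (K * t) := by
  intro t ht
  have hT : 0 ≤ T := ht.1.trans ht.2
  let ψ : ℝ → ℝ := IccExtend hT ((Icc 0 T).domRestrict φ)
  have hψ : Continuous ψ := (continuousOn_iff_continuous_domRestrict.1 hφ).Icc_extend'
  have hψφ : ∀ s ∈ Icc 0 T, ψ s = φ s := fun s hs => IccExtend_of_mem hT _ hs
  have hint : ∀ t ∈ Icc 0 T, ∫ s in (0 : ℝ)..t, φ s = ∫ s in (0 : ℝ)..t, ψ s := fun t ht =>
    intervalIntegral.integral_congr fun s hs => by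
      rw [uIcc_of_le ht.1] at hs
      exact (hψφ s ⟨hs.1, hs.2.trans ht.2⟩).symm
  -- The function `φ` is only continuous, but its majorant `F` is differentiable with `F' = K ψ ≤ K
  -- F`.
  let F : ℝ → ℝ := fun t => a + K * ∫ s in (0 : ℝ)..t, ψ s
  have hF : ∀ t, HasDerivAt F (K * ψ t) t := fun t =>
    ((intervalIntegral.integral_hasDerivAt_right (hψ.intervalIntegrable _ _)
      (hψ.stronglyMeasurableAtFilter _ _) hψ.continuousAt).const_mul K).const_add a
  have hle : ∀ t ∈ Icc 0 T, φ t ≤ F t := fun t ht => by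
    have := h t ht
    rwa [hint t ht] at this
  refine (hle t ht).trans ?_
  have := le_gronwallBound_of_liminf_deriv_right_le (f := F) (f' := fun t => K * ψ t) (δ := a)
    (K := K) (ε := 0) (a := 0) (b := T)
    (fun t _ => (hF t).continuousAt.continuousWithinAt)
    (fun t _ r hr => (hF t).hasDerivWithinAt.liminf_right_slope_le hr) (by simp [F])
    (fun t ht => by
      rw [add_zero, hψφ t ⟨ht.1, ht.2.le⟩]
      exact mul_le_mul_of_nonneg_left (hle t ⟨ht.1, ht.2.le⟩) hK) t ht
  simpa [gronwallBound_ε0] using this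

variable {X : Type*} [NormedAddCommGroup X] [NormedSpace ℝ X]

/-- A bounded strongly continuous semigroup, extended to negative times in such a way that it is
jointly continuous. -/
structure IsBddSemigroup (S : ℝ → X →L[ℝ] X) (C : ℝ) : Prop where
  zero : S 0 = ContinuousLinearMap.id ℝ X
  add : ∀ s ≥ 0, ∀ t ≥ 0, S (s + t) = (S s).comp (S t)
  cont : Continuous (fun p : ℝ × X => S p.1 p.2)
  nonneg : 0 ≤ C
  bound : ∀ t x, ‖S t x‖ ≤ C * ‖x‖

namespace IsBddSemigroup

variable {S : ℝ → X →L[ℝ] X} {C : ℝ}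

theorem continuous_comp (hS : IsBddSemigroup S C) {Y : Type*} [TopologicalSpace Y] {a : Y → ℝ}
    {k : Y → X} (ha : Continuous a) (hk : Continuous k) : Continuous fun y => S (a y) (k y) :=
  hS.cont.comp (ha.prodMk hk)

theorem continuous_conv (hS : IsBddSemigroup S C) {k : ℝ → X} (hk : Continuous k) :
    Continuous fun t => ∫ τ in (0 : ℝ)..t, S (t - τ) (k τ) :=
  intervalIntegral.continuous_parametric_intervalIntegral_of_continuous
    (f := fun t τ => S (t - τ) (k τ))
    (hS.continuous_comp (continuous_fst.sub continuous_snd) (hk.comp continuous_snd)) continuous_id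

theorem norm_conv_le (hS : IsBddSemigroup S C) {k : ℝ → X} {φ : ℝ → ℝ} {t : ℝ} (ht : 0 ≤ t)
    (hφ : IntervalIntegrable φ volume 0 t) (hk : ∀ τ ∈ Ioc 0 t, ‖k τ‖ ≤ φ τ) :
    ‖∫ τ in (0 : ℝ)..t, S (t - τ) (k τ)‖ ≤ C * ∫ τ in (0 : ℝ)..t, φ τ := by
  rw [← intervalIntegral.integral_const_mul]
  refine intervalIntegral.norm_integral_le_of_norm_le ht (ae_of_all _ fun τ hτ => ?_)
    (hφ.const_mul C)
  exact (hS.bound _ _).trans (mul_le_mul_of_nonneg_left (hk τ hτ) hS.nonneg)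

/-- This is the contribution of the Duhamel term to the right derivative of a mild solution. -/
theorem tendsto_average_conv [CompleteSpace X] (hS : IsBddSemigroup S C) {k : ℝ → X}
    (hk : Continuous k) :
    Tendsto (fun h : ℝ => h⁻¹ • ∫ τ in (0 : ℝ)..h, S (h - τ) (k τ)) (𝓝[>] 0) (𝓝 (k 0)) := by
  rw [Metric.tendsto_nhds]
  intro ε hε
  have hc : Continuous fun p : ℝ × ℝ => S (p.1 - p.2) (k p.2) :=
    hS.continuous_comp (continuous_fst.sub continuous_snd) (hk.comp continuous_snd)
  obtain ⟨δ, hδ, h⟩ := Metric.continuous_iff.1 hc (0, 0) (ε / 2) (by positivity)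
  filter_upwards [Ioo_mem_nhdsGT hδ] with h' hh'
  have h1 : ‖∫ τ in (0 : ℝ)..h', (S (h' - τ) (k τ) - k 0)‖ ≤ ε / 2 * |h' - 0| := by
    refine intervalIntegral.norm_integral_le_of_norm_le_const fun τ hτ => ?_
    rw [uIoc_of_le hh'.1.le] at hτ
    have := h (h', τ) (by
      rw [Prod.dist_eq, max_lt_iff]
      simp only [Real.dist_eq, sub_zero]
      rw [abs_of_pos hh'.1, abs_of_pos hτ.1]
      exact ⟨hh'.2, hτ.2.trans_lt hh'.2⟩)
    rw [dist_eq_norm] at this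
    simpa [hS.zero] using this.le
  rw [intervalIntegral.integral_sub
    ((hS.continuous_comp (by fun_prop) hk).intervalIntegrable _ _) (by simp),
    intervalIntegral.integral_const, sub_zero, abs_of_pos hh'.1] at h1
  rw [dist_eq_norm]
  have h2 : h'⁻¹ • (∫ τ in (0 : ℝ)..h', S (h' - τ) (k τ)) - k 0
      = h'⁻¹ • ((∫ τ in (0 : ℝ)..h', S (h' - τ) (k τ)) - h' • k 0) := by
    rw [smul_sub, inv_smul_smul₀ hh'.1.ne']
  rw [h2, norm_smul, norm_inv, Real.norm_of_nonneg hh'.1.le, inv_mul_lt_iff₀ hh'.1]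
  nlinarith [hh'.1]

/-- Comparison of two Volterra equations. -/
theorem norm_sub_le (hS : IsBddSemigroup S C) {T K a b : ℝ} (hK : 0 ≤ K) (hb : 0 ≤ b)
    {U₁ U₂ h₁ h₂ g₁ g₂ : ℝ → X} (hU₁ : ContinuousOn U₁ (Icc 0 T)) (hU₂ : ContinuousOn U₂ (Icc 0 T))
    (hg₁ : ContinuousOn g₁ (Icc 0 T)) (hg₂ : ContinuousOn g₂ (Icc 0 T))
    (e₁ : ∀ t ∈ Icc 0 T, U₁ t = h₁ t + ∫ τ in (0 : ℝ)..t, S (t - τ) (g₁ τ))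
    (e₂ : ∀ t ∈ Icc 0 T, U₂ t = h₂ t + ∫ τ in (0 : ℝ)..t, S (t - τ) (g₂ τ))
    (hh : ∀ t ∈ Icc 0 T, ‖h₁ t - h₂ t‖ ≤ a)
    (hg : ∀ t ∈ Icc 0 T, ‖g₁ t - g₂ t‖ ≤ K * ‖U₁ t - U₂ t‖ + b) :
    ∀ t ∈ Icc 0 T, ‖U₁ t - U₂ t‖ ≤ (a + C * b * T) * Real.exp (C * K * t) := by
  refine le_mul_exp_of_le_add_integral (mul_nonneg hS.nonneg hK) (hU₁.sub hU₂).norm fun t ht => ?_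
  have hsub : Icc 0 t ⊆ Icc 0 T := Icc_subset_Icc_right ht.2
  have hi : ∀ {g : ℝ → X}, ContinuousOn g (Icc 0 T) →
      IntervalIntegrable (fun τ => S (t - τ) (g τ)) volume 0 t := fun hg =>
    ContinuousOn.intervalIntegrable_of_Icc ht.1
      (hS.cont.comp_continuousOn (ContinuousOn.prodMk (by fun_prop) (hg.mono hsub)))
  have hφ : IntervalIntegrable (fun τ => ‖U₁ τ - U₂ τ‖) volume 0 t :=
    ContinuousOn.intervalIntegrable_of_Icc ht.1 ((hU₁.sub hU₂).norm.mono hsub)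
  rw [e₁ t ht, e₂ t ht, add_sub_add_comm, ← intervalIntegral.integral_sub (hi hg₁) (hi hg₂)]
  simp_rw [← map_sub]
  have h1 := hS.norm_conv_le (k := fun τ => g₁ τ - g₂ τ) ht.1
    ((hφ.const_mul K).add (intervalIntegrable_const (c := b)))
    fun τ hτ => hg τ (hsub (Ioc_subset_Icc_self hτ))
  rw [intervalIntegral.integral_add (hφ.const_mul K) intervalIntegrable_const,
    intervalIntegral.integral_const_mul, intervalIntegral.integral_const, sub_zero,
    smul_eq_mul] at h1
  have h2 := hh t ht
  have h3 : C * b * t ≤ C * b * T := mul_le_mul_of_nonneg_left ht.2 (mul_nonneg hS.nonneg hb)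
  calc _ ≤ _ := norm_add_le _ _
    _ ≤ a + C * (K * (∫ τ in (0 : ℝ)..t, ‖U₁ τ - U₂ τ‖) + t * b) := add_le_add h2 h1
    _ ≤ _ := by linarith

/-- Volterra equations with a globally Lipschitz right-hand side are solvable. -/
theorem exists_volterra [CompleteSpace X] (hS : IsBddSemigroup S C) {T : ℝ} (hT : 0 ≤ T)
    {g : ℝ → X → X} (hg : Continuous (fun p : ℝ × X => g p.1 p.2)) {K : ℝ} (hK : 0 ≤ K)
    (hL : ∀ t x y, ‖g t x - g t y‖ ≤ K * ‖x - y‖) {h : ℝ → X} (hh : Continuous h) :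
    ∃ U : ℝ → X, Continuous U ∧
      ∀ t ∈ Icc 0 T, U t = h t + ∫ τ in (0 : ℝ)..t, S (t - τ) (g τ (U τ)) := by
  have hex : ∀ u : C(Icc 0 T, X), Continuous (IccExtend hT u) := fun u => u.continuous.Icc_extend'
  have hgu : ∀ u : C(Icc 0 T, X), Continuous fun τ => g τ (IccExtend hT u τ) := fun u =>
    hg.comp (continuous_id.prodMk (hex u))
  let F : C(Icc 0 T, X) → C(Icc 0 T, X) := fun u =>
    ⟨fun t => h t + ∫ τ in (0 : ℝ)..t, S (t - τ) (g τ (IccExtend hT u τ)),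
      (hh.add (hS.continuous_conv (hgu u))).comp continuous_subtype_val⟩
  have hCK : 0 ≤ C * K := mul_nonneg hS.nonneg hK
  -- The factorial gained by iterating makes some iterate a contraction on the whole interval, with
  -- no smallness of `T`.
  have hF : ∀ (n : ℕ) (u v : C(Icc 0 T, X)) (t : Icc 0 T),
      ‖F^[n] u t - F^[n] v t‖ ≤ (C * K * t) ^ n / n.factorial * dist u v := by
    intro n
    induction n with
    | zero =>
      intro u v t
      simpa [dist_eq_norm] using (u - v).norm_coe_le_norm t
    | succ n ih =>
      intro u v t
      rw [Function.iterate_succ_apply', Function.iterate_succ_apply']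
      set u' := F^[n] u
      set v' := F^[n] v
      have hi : ∀ w : C(Icc 0 T, X), IntervalIntegrable
          (fun τ => S (t - τ) (g τ (IccExtend hT w τ))) volume 0 t := fun w =>
        (hS.continuous_comp (by fun_prop) (hgu w)).intervalIntegrable _ _
      have e : F u' t - F v' t = ∫ τ in (0 : ℝ)..t,
          S (t - τ) (g τ (IccExtend hT u' τ) - g τ (IccExtend hT v' τ)) := by
        simp_rw [map_sub]
        rw [intervalIntegral.integral_sub (hi u') (hi v')]
        simp [F]
      have hφ : Continuous fun τ : ℝ => K * ((C * K * τ) ^ n / n.factorial * dist u v) := by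
        fun_prop
      rw [e]
      refine (hS.norm_conv_le t.2.1 (hφ.intervalIntegrable _ _) fun τ hτ => ?_).trans ?_
      · have hτ' : τ ∈ Icc 0 T := ⟨hτ.1.le, hτ.2.trans t.2.2⟩
        refine (hL _ _ _).trans (mul_le_mul_of_nonneg_left ?_ hK)
        rw [IccExtend_of_mem hT _ hτ', IccExtend_of_mem hT _ hτ']
        exact ih u v ⟨τ, hτ'⟩
      · have : ∀ τ : ℝ, K * ((C * K * τ) ^ n / n.factorial * dist u v)
            = (K * (C * K) ^ n / n.factorial * dist u v) * τ ^ n := fun τ => by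
          rw [mul_pow]; ring
        simp_rw [this]
        rw [intervalIntegral.integral_const_mul, integral_pow, Nat.factorial_succ]
        have h1 : ((n : ℝ) + 1) ≠ 0 := by positivity
        have h2 : (n.factorial : ℝ) ≠ 0 := by positivity
        apply le_of_eq
        push_cast
        simp only [ne_eq, Nat.add_eq_zero_iff, one_ne_zero, and_false, not_false_eq_true,
          zero_pow, sub_zero]
        field_simp
        ring
  obtain ⟨n, hn⟩ := ((FloorSemiring.tendsto_pow_div_factorial_atTop (C * K * T)).eventually
    (gt_mem_nhds one_pos)).exists
  have hn0 : 0 ≤ (C * K * T) ^ n / n.factorial := by positivity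
  have hc : ContractingWith ((C * K * T) ^ n / n.factorial).toNNReal F^[n] := by
    refine ⟨Real.toNNReal_lt_one.2 hn, LipschitzWith.of_dist_le_mul fun u v => ?_⟩
    rw [Real.coe_toNNReal _ hn0, ContinuousMap.dist_le (mul_nonneg hn0 dist_nonneg)]
    intro t
    rw [dist_eq_norm]
    refine (hF n u v t).trans (mul_le_mul_of_nonneg_right ?_ dist_nonneg)
    have h1 := t.2.1
    have h2 := t.2.2
    gcongr
  have : Nonempty C(Icc 0 T, X) := ⟨0⟩
  -- The fixed point of a contracting iterate is unique, hence is also fixed by `F` itself.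
  have hfix := hc.isFixedPt_fixedPoint_iterate
  set u := ContractingWith.fixedPoint F^[n] hc
  refine ⟨IccExtend hT u, hex u, fun t ht => ?_⟩
  have : F u ⟨t, ht⟩ = u ⟨t, ht⟩ := congrArg (fun w : C(Icc 0 T, X) => w ⟨t, ht⟩) hfix
  rw [IccExtend_of_mem hT _ ht, ← this]
  rfl

end IsBddSemigroup

end Mild

/-! ### Semilinear equations: uniqueness, regularity, global existence. -/

section MildNonlinear

variable {X : Type*} [NormedAddCommGroup X] [NormedSpace ℝ X]
  {S : ℝ → X →L[ℝ] X} {C : ℝ} {f : X → X}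

theorem IsMildSolution.mono {T T' : ℝ} {U₀ : X} {U : ℝ → X} (h : IsMildSolution S f T U₀ U)
    (hT : T' ≤ T) : IsMildSolution S f T' U₀ U :=
  ⟨h.1.mono (Icc_subset_Icc_right hT), fun t ht => h.2 t ⟨ht.1, ht.2.trans hT⟩⟩

theorem IsMildSolution.congr {g : X → X} {T : ℝ} {U₀ : X} {U V : ℝ → X}
    (h : IsMildSolution S f T U₀ U)
    (hV : ∀ t ∈ Icc 0 T, V t = U t) (hg : ∀ t ∈ Icc 0 T, g (U t) = f (U t)) :
    IsMildSolution S g T U₀ V := by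
  refine ⟨h.1.congr hV, fun t ht => ?_⟩
  rw [hV t ht, h.2 t ht]
  congr 1
  refine intervalIntegral.integral_congr fun τ hτ => ?_
  rw [uIcc_of_le ht.1] at hτ
  have hτ' : τ ∈ Icc 0 T := ⟨hτ.1, hτ.2.trans ht.2⟩
  rw [hV τ hτ', hg τ hτ']

theorem IsMildSolution.initial {T : ℝ} {U₀ : X} {U : ℝ → X} (hS : IsBddSemigroup S C) (hT : 0 ≤ T)
    (h : IsMildSolution S f T U₀ U) : U 0 = U₀ := by
  have := h.2 0 ⟨le_rfl, hT⟩
  simpa [hS.zero] using this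

namespace IsBddSemigroup

theorem mild_dist_le (hS : IsBddSemigroup S C) {T K R : ℝ} (hK : 0 ≤ K) (hf : Continuous f)
    (hL : ∀ x y, ‖x‖ ≤ R → ‖y‖ ≤ R → ‖f x - f y‖ ≤ K * ‖x - y‖) {U₀ V₀ : X} {U V : ℝ → X}
    (hU : IsMildSolution S f T U₀ U) (hV : IsMildSolution S f T V₀ V)
    (hUR : ∀ t ∈ Icc 0 T, ‖U t‖ ≤ R) (hVR : ∀ t ∈ Icc 0 T, ‖V t‖ ≤ R) :
    ∀ t ∈ Icc 0 T, ‖U t - V t‖ ≤ C * ‖U₀ - V₀‖ * Real.exp (C * K * t) := by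
  have := hS.norm_sub_le (a := C * ‖U₀ - V₀‖) hK le_rfl hU.1 hV.1 (hf.comp_continuousOn hU.1)
    (hf.comp_continuousOn hV.1) hU.2 hV.2 (fun t _ => by rw [← map_sub]; exact hS.bound _ _)
    (fun t ht => by rw [add_zero]; exact hL _ _ (hUR t ht) (hVR t ht))
  simpa using this

/-- Both solutions are bounded on the compact interval, so the Lipschitz constant of one ball serves
for both. -/
theorem mild_unique (hS : IsBddSemigroup S C) (hf : Continuous f)
    (hL : ∀ R, ∃ K ≥ 0, ∀ x y, ‖x‖ ≤ R → ‖y‖ ≤ R → ‖f x - f y‖ ≤ K * ‖x - y‖) {T : ℝ}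
    {U₀ : X} {U V : ℝ → X} (hU : IsMildSolution S f T U₀ U) (hV : IsMildSolution S f T U₀ V) :
    ∀ t ∈ Icc 0 T, U t = V t := by
  obtain ⟨R₁, h₁⟩ := isCompact_Icc.exists_bound_of_continuousOn hU.1
  obtain ⟨R₂, h₂⟩ := isCompact_Icc.exists_bound_of_continuousOn hV.1
  obtain ⟨K, hK, hLK⟩ := hL (max R₁ R₂)
  intro t ht
  have := hS.mild_dist_le hK hf hLK hU hV (fun t ht => (h₁ t ht).trans (le_max_left _ _))
    (fun t ht => (h₂ t ht).trans (le_max_right _ _)) t ht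
  rw [sub_self, norm_zero, mul_zero, zero_mul] at this
  exact sub_eq_zero.1 (norm_le_zero_iff.1 this)

/-- Restarting at time `s`: split the Duhamel integral at `s` and pull `S h` out of the first piece.
-/
theorem mild_shift [CompleteSpace X] (hS : IsBddSemigroup S C) (hf : Continuous f) {T : ℝ} {U₀ : X}
    {U : ℝ → X} (hU : IsMildSolution S f T U₀ U) {s h : ℝ} (hs : 0 ≤ s) (hh : 0 ≤ h)
    (hsh : s + h ≤ T) :
    U (s + h) = S h (U s) + ∫ τ in (0 : ℝ)..h, S (h - τ) (f (U (s + τ))) := by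
  have hT : 0 ≤ T := by linarith
  have hi : ∀ {a b : ℝ}, 0 ≤ a → a ≤ b → b ≤ T →
      IntervalIntegrable (fun τ => S (s + h - τ) (f (U τ))) volume a b := fun ha hab hb =>
    ContinuousOn.intervalIntegrable_of_Icc hab (hS.cont.comp_continuousOn
      (ContinuousOn.prodMk (by fun_prop)
        (hf.comp_continuousOn (hU.1.mono (Icc_subset_Icc ha hb)))))
  have h1 : ∫ τ in (0 : ℝ)..s, S (s + h - τ) (f (U τ))
      = S h (∫ τ in (0 : ℝ)..s, S (s - τ) (f (U τ))) := by
    rw [← ContinuousLinearMap.intervalIntegral_comp_comm]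
    · refine intervalIntegral.integral_congr fun τ hτ => ?_
      rw [uIcc_of_le hs] at hτ
      rw [← ContinuousLinearMap.comp_apply, ← hS.add h hh _ (sub_nonneg.2 hτ.2)]
      congr 2; ring
    · exact ContinuousOn.intervalIntegrable_of_Icc hs (hS.cont.comp_continuousOn
        (ContinuousOn.prodMk (by fun_prop)
          (hf.comp_continuousOn (hU.1.mono (Icc_subset_Icc_right (by linarith))))))
  have h2 : ∫ τ in s..(s + h), S (s + h - τ) (f (U τ))
      = ∫ τ in (0 : ℝ)..h, S (h - τ) (f (U (s + τ))) := by
    have := intervalIntegral.integral_comp_add_left (a := 0) (b := h)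
      (fun τ => S (s + h - τ) (f (U τ))) s
    rw [add_zero] at this
    rw [← this]
    refine intervalIntegral.integral_congr fun τ _ => ?_
    congr 2; ring
  rw [hU.2 (s + h) ⟨by linarith, hsh⟩, hU.2 s ⟨hs, by linarith⟩, map_add, ← h1,
    ← ContinuousLinearMap.comp_apply, ← hS.add h hh s hs, add_comm h s, add_assoc, ← h2,
    intervalIntegral.integral_add_adjacent_intervals (hi le_rfl hs (by linarith))
      (hi hs (by linarith) hsh)]

/-- A mild solution for a `C¹` nonlinearity which starts in the domain of the generator is
differentiable from the right, with a continuous derivative. -/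
theorem exists_right_deriv [CompleteSpace X] (hS : IsBddSemigroup S C) {G : X → X → Prop}
    (hG : IsGenerator G S) (hf : ContDiff ℝ 1 f) {T : ℝ} (hT : 0 < T) {U₀ V₀ : X} {U : ℝ → X}
    (hU : IsMildSolution S f T U₀ U) (h₀ : G U₀ V₀) :
    ∃ W : ℝ → X, Continuous W ∧ ∀ t ∈ Ico 0 T,
      Tendsto (fun h : ℝ => h⁻¹ • (U (t + h) - U t)) (𝓝[>] 0) (𝓝 (W t)) := by
  have hfc := hf.continuous
  -- Extending `U` by constants makes `A τ` uniformly bounded for all real `τ`, as `exists_volterra`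
  -- demands.
  let Ue : ℝ → X := IccExtend hT.le ((Icc 0 T).domRestrict U)
  have hUe : Continuous Ue := (continuousOn_iff_continuous_domRestrict.1 hU.1).Icc_extend'
  have hUeU : ∀ s ∈ Icc 0 T, Ue s = U s := fun s hs => IccExtend_of_mem hT.le _ hs
  let A : ℝ → X →L[ℝ] X := fun τ => fderiv ℝ f (Ue τ)
  have hA : Continuous A := (hf.continuous_fderiv (by norm_num)).comp hUe
  obtain ⟨K, hK⟩ := isCompact_Icc.exists_bound_of_continuousOn (hA.continuousOn (s := Icc 0 T))
  have hK' : ∀ τ, ‖A τ‖ ≤ K := fun τ => by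
    have h1 : Ue τ = Ue (projIcc 0 T hT.le τ) := by
      rw [hUeU _ (Subtype.coe_prop _)]; rfl
    have h2 := hK _ (Subtype.coe_prop (projIcc 0 T hT.le τ))
    simp only [A] at h2 ⊢
    rwa [h1]
  have hK0 : 0 ≤ K := (norm_nonneg _).trans (hK' 0)
  -- The candidate `W` solves the formally differentiated equation, with initial value `𝓛 U₀ + f
  -- U₀`.
  obtain ⟨W, hWc, hW⟩ := hS.exists_volterra hT.le (g := fun τ x => A τ x) (K := K)
    ((hA.comp continuous_fst).clm_apply continuous_snd) hK0
    (fun t x y => by rw [← map_sub]; exact (A t).le_of_opNorm_le (hK' t) _)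
    (h := fun t => S t (V₀ + f U₀)) (hS.continuous_comp continuous_id continuous_const)
  refine ⟨W, hWc, fun t ht => ?_⟩
  obtain ⟨B, hB⟩ := isCompact_Icc.exists_bound_of_continuousOn (hWc.continuousOn (s := Icc 0 T))
  have hB0 : 0 ≤ B := (norm_nonneg _).trans (hB 0 ⟨le_rfl, hT.le⟩)
  have hq : Tendsto (fun h : ℝ => ‖h⁻¹ • (U h - U 0) - (V₀ + f U₀)‖) (𝓝[>] 0) (𝓝 0) := by
    have h1 := (hG _ _).1 h₀
    have h2 := hS.tendsto_average_conv (hfc.comp hUe)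
    simp only [Function.comp_apply] at h2
    rw [hUeU 0 ⟨le_rfl, hT.le⟩, hU.initial hS hT.le] at h2
    have h3 := ((h1.add h2).sub_const (V₀ + f U₀)).norm
    rw [sub_self, norm_zero] at h3
    refine h3.congr' ?_
    filter_upwards [Ioo_mem_nhdsGT hT] with h hh
    rw [hU.initial hS hT.le, hU.2 h ⟨hh.1.le, hh.2.le⟩, ← smul_add]
    congr 3
    rw [add_sub_right_comm]
    congr 1
    refine intervalIntegral.integral_congr fun τ hτ => ?_
    rw [uIcc_of_le hh.1.le] at hτ
    rw [hUeU τ ⟨hτ.1, hτ.2.trans hh.2.le⟩]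
  -- First order Taylor expansion of `f`, uniform along the orbit because the orbit is compact.
  have hrem : ∀ ε > 0, ∃ δ > 0, ∀ τ ∈ Icc 0 T, ∀ y, ‖y - U τ‖ < δ →
      ‖f y - f (U τ) - A τ (y - U τ)‖ ≤ ε * ‖y - U τ‖ := by
    intro ε hε
    have hcomp : IsCompact (U '' Icc 0 T) := isCompact_Icc.image_of_continuousOn hU.1
    have h1 := hcomp.uniformContinuousAt_of_continuousAt (fderiv ℝ f)
      (fun a _ => (hf.continuous_fderiv (by norm_num)).continuousAt) (Metric.dist_mem_uniformity hε)
    obtain ⟨δ, hδ, h2⟩ := Metric.mem_uniformity_dist.1 h1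
    refine ⟨δ, hδ, fun τ hτ y hy => ?_⟩
    refine (convex_ball (U τ) δ).norm_image_sub_le_of_norm_fderiv_le' (𝕜 := ℝ)
      (fun x _ => (hf.differentiable (by norm_num)) x) (fun x hx => ?_) (Metric.mem_ball_self hδ)
      (by rwa [Metric.mem_ball, dist_eq_norm])
    have h3 : dist (U τ) x < δ := by rwa [dist_comm]
    have h4 : dist (fderiv ℝ f (U τ)) (fderiv ℝ f x) < ε := h2 h3 ⟨τ, hτ, rfl⟩
    rw [dist_comm, dist_eq_norm] at h4
    simp only [A]
    rw [hUeU τ hτ]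
    exact h4.le
  rw [tendsto_iff_norm_sub_tendsto_zero, Metric.tendsto_nhds]
  intro ε' hε'
  -- The difference quotient `q` and `W` satisfy Volterra equations whose data differ by `C ε`. The
  -- Taylor remainder is at most `ε ‖q‖ ≤ ‖q - W‖ + ε B`, using `ε ≤ 1`: hence the constant `K + 1`
  -- and the defect `ε B` in the Grönwall bound.
  obtain ⟨ε, hε, hε1, hε2⟩ : ∃ ε > 0, ε ≤ 1 ∧
      (C * ε + C * (ε * B) * T) * Real.exp (C * (K + 1) * T) < ε' := by
    have hc : Continuous fun ε : ℝ => (C * ε + C * (ε * B) * T) * Real.exp (C * (K + 1) * T) := by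
      fun_prop
    have h1 := (hc.tendsto 0).eventually (gt_mem_nhds (by simpa using hε'))
    have h2 : ∀ᶠ ε in 𝓝[>] (0 : ℝ), _ := nhdsWithin_le_nhds h1
    obtain ⟨ε, h3, h4⟩ := (h2.and (Ioc_mem_nhdsGT one_pos)).exists
    exact ⟨ε, h4.1, h4.2, h3⟩
  obtain ⟨δ, hδ, hδr⟩ := hrem ε hε
  obtain ⟨δ₂, hδ₂, hδu⟩ := Metric.uniformContinuousOn_iff.1
    (isCompact_Icc.uniformContinuousOn_of_continuous hU.1) δ hδ
  have hTt : 0 < T - t := by linarith [ht.2]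
  filter_upwards [hq.eventually (gt_mem_nhds hε), Ioo_mem_nhdsGT hδ₂, Ioo_mem_nhdsGT hTt]
    with h h1 h2 h3
  have hh := h2.1
  have hmem : ∀ {τ}, τ ∈ Icc 0 (T - h) → τ ∈ Icc 0 T ∧ h + τ ∈ Icc 0 T := fun {τ} hτ =>
    ⟨⟨hτ.1, by linarith [hτ.2]⟩, ⟨by linarith [hτ.1], by linarith [hτ.2]⟩⟩
  have hUh : ContinuousOn (fun τ => U (h + τ)) (Icc 0 (T - h)) :=
    hU.1.comp (by fun_prop) fun τ hτ => (hmem hτ).2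
  have hU1 : ContinuousOn U (Icc 0 (T - h)) := hU.1.mono fun τ hτ => (hmem hτ).1
  have key := hS.norm_sub_le (T := T - h) (K := K + 1) (a := C * ε) (b := ε * B)
    (U₁ := fun τ => h⁻¹ • (U (h + τ) - U τ)) (U₂ := W)
    (h₁ := fun τ => S τ (h⁻¹ • (U h - U 0))) (h₂ := fun t => S t (V₀ + f U₀))
    (g₁ := fun τ => h⁻¹ • (f (U (h + τ)) - f (U τ))) (g₂ := fun τ => A τ (W τ))
    (by positivity) (by positivity) ((hUh.sub hU1).const_smul _) hWc.continuousOn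
    (((hfc.comp_continuousOn hUh).sub (hfc.comp_continuousOn hU1)).const_smul _)
    (hA.clm_apply hWc).continuousOn
    (fun s hs => by
      have e1 := hS.mild_shift hfc hU hh.le hs.1 (hmem hs).2.2
      have e2 := hU.2 s (hmem hs).1
      have hi1 : IntervalIntegrable (fun τ => S (s - τ) (f (U (h + τ)))) volume 0 s :=
        ContinuousOn.intervalIntegrable_of_Icc hs.1 (hS.cont.comp_continuousOn
          (ContinuousOn.prodMk (by fun_prop)
            (hfc.comp_continuousOn (hUh.mono (Icc_subset_Icc_right hs.2)))))
      have hi2 : IntervalIntegrable (fun τ => S (s - τ) (f (U τ))) volume 0 s :=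
        ContinuousOn.intervalIntegrable_of_Icc hs.1 (hS.cont.comp_continuousOn
          (ContinuousOn.prodMk (by fun_prop)
            (hfc.comp_continuousOn (hU1.mono (Icc_subset_Icc_right hs.2)))))
      simp only [map_smul, map_sub]
      rw [intervalIntegral.integral_smul, intervalIntegral.integral_sub hi1 hi2, ← smul_add, e1, e2,
        hU.initial hS hT.le]
      congr 1; abel)
    (fun s hs => hW s (hmem hs).1)
    (fun s hs => by
      rw [← map_sub]
      exact (hS.bound _ _).trans (mul_le_mul_of_nonneg_left h1.le hS.nonneg))
    (fun s hs => by
      have r := hδr s (hmem hs).1 (U (h + s)) (by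
        rw [← dist_eq_norm]
        refine hδu _ (hmem hs).2 _ (hmem hs).1 ?_
        rw [Real.dist_eq, add_sub_cancel_right, abs_of_pos hh]
        exact h2.2)
      set D := U (h + s) - U s with hD
      have e : h⁻¹ • (f (U (h + s)) - f (U s)) - A s (W s)
          = h⁻¹ • (f (U (h + s)) - f (U s) - A s D) + A s (h⁻¹ • D - W s) := by
        rw [(A s).map_sub (h⁻¹ • D), map_smul, smul_sub h⁻¹ (f (U (h + s)) - f (U s))]; abel
      have n1 : ‖h⁻¹ • (f (U (h + s)) - f (U s) - A s D)‖ ≤ ε * ‖h⁻¹ • D‖ := by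
        rw [norm_smul, norm_smul, mul_left_comm]
        exact mul_le_mul_of_nonneg_left r (norm_nonneg _)
      have n2 : ‖A s (h⁻¹ • D - W s)‖ ≤ K * ‖h⁻¹ • D - W s‖ := (A s).le_of_opNorm_le (hK' s) _
      have n3 : ‖h⁻¹ • D‖ ≤ ‖h⁻¹ • D - W s‖ + ‖W s‖ := by
        simpa using norm_add_le (h⁻¹ • D - W s) (W s)
      have n4 := hB s (hmem hs).1
      rw [e]
      have n5 : ε * ‖h⁻¹ • D‖ ≤ 1 * ‖h⁻¹ • D - W s‖ + ε * B :=
        calc ε * ‖h⁻¹ • D‖ ≤ ε * (‖h⁻¹ • D - W s‖ + B) := by gcongr; linarith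
          _ ≤ 1 * ‖h⁻¹ • D - W s‖ + ε * B := by
            rw [mul_add]; gcongr
      calc _ ≤ _ := norm_add_le _ _
        _ ≤ _ := by linarith)
    t ⟨ht.1, by linarith [h3.2]⟩
  have hfin : (C * ε + C * (ε * B) * (T - h)) * Real.exp (C * (K + 1) * t)
      ≤ (C * ε + C * (ε * B) * T) * Real.exp (C * (K + 1) * T) := by
    have := hS.nonneg
    have : 0 ≤ T - h := by linarith [h3.2, ht.1]
    have := ht.2.le
    gcongr
    linarith
  rw [Real.dist_eq, sub_zero, abs_norm, add_comm t h]
  exact (key.trans hfin).trans_lt hε2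

/-- A continuous function with continuous right derivative `W` is a primitive of `W`. Subtracting
the Duhamel average from the difference quotient leaves `(S h U(t) - U(t)) / h`, so `U(t)` lies in
the domain. -/
theorem classical_of_mild [CompleteSpace X] (hS : IsBddSemigroup S C) {G : X → X → Prop}
    (hG : IsGenerator G S) (hf : ContDiff ℝ 1 f) {T : ℝ} (hT : 0 < T) {U₀ V₀ : X} {U : ℝ → X}
    (hU : IsMildSolution S f T U₀ U) (h₀ : G U₀ V₀) : IsClassicalSolution G f T U₀ U := by
  obtain ⟨W, hWc, hW⟩ := hS.exists_right_deriv hG hf hT hU h₀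
  refine ⟨hU.initial hS hT.le, W, fun t => W t - f (U t), hWc.continuousOn, fun t ht => ⟨?_, ?_, ?_⟩⟩
  · have hV : ∀ t, HasDerivAt (fun t => U₀ + ∫ s in (0 : ℝ)..t, W s) (W t) t := fun t =>
      (intervalIntegral.integral_hasDerivAt_right (hWc.intervalIntegrable _ _)
        (hWc.stronglyMeasurableAtFilter _ _) hWc.continuousAt).const_add U₀
    have heq := eq_of_has_deriv_right_eq (f := U) (f' := W) (a := 0) (b := T)
      (g := fun t => U₀ + ∫ s in (0 : ℝ)..t, W s)
      (fun x hx => by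
        refine HasDerivWithinAt.Ici_of_Ioi ?_
        rw [hasDerivWithinAt_iff_tendsto_slope' (by simp)]
        have h3 : Tendsto (fun y : ℝ => y - x) (𝓝[>] x) (𝓝[>] 0) := by
          refine tendsto_nhdsWithin_iff.2 ⟨?_, ?_⟩
          · have : Continuous fun y : ℝ => y - x := by fun_prop
            simpa using (this.tendsto x).mono_left nhdsWithin_le_nhds
          · filter_upwards [self_mem_nhdsWithin] with y hy
            simpa using hy
        refine ((hW x hx).comp h3).congr fun y => ?_
        simp [slope])
      (fun x _ => (hV x).hasDerivWithinAt) hU.1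
      (fun x _ => (hV x).continuousAt.continuousWithinAt)
      (by simp [hU.initial hS hT.le])
    exact (hV t).hasDerivWithinAt.congr (fun y hy => heq y ⟨hy.1, hy.2.le⟩) (heq t ⟨ht.1, ht.2.le⟩)
  · rw [hG]
    let Ue : ℝ → X := IccExtend hT.le ((Icc 0 T).domRestrict U)
    have hUe : Continuous Ue := (continuousOn_iff_continuous_domRestrict.1 hU.1).Icc_extend'
    have hUeU : ∀ s ∈ Icc 0 T, Ue s = U s := fun s hs => IccExtend_of_mem hT.le _ hs
    have h2 := hS.tendsto_average_conv (k := fun τ => f (Ue (t + τ)))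
      (hf.continuous.comp (hUe.comp (by fun_prop)))
    rw [add_zero, hUeU t ⟨ht.1, ht.2.le⟩] at h2
    refine ((hW t ht).sub h2).congr' ?_
    filter_upwards [Ioo_mem_nhdsGT (show 0 < T - t by linarith [ht.2])] with h hh
    rw [← smul_sub, hS.mild_shift hf.continuous hU ht.1 hh.1.le (by linarith [hh.2])]
    congr 1
    have : ∫ τ in (0 : ℝ)..h, S (h - τ) (f (U (t + τ)))
        = ∫ τ in (0 : ℝ)..h, S (h - τ) (f (Ue (t + τ))) := by
      refine intervalIntegral.integral_congr fun τ hτ => ?_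
      rw [uIcc_of_le hh.1.le] at hτ
      rw [hUeU _ ⟨by linarith [ht.1, hτ.1], by linarith [hh.2, hτ.2]⟩]
    rw [this]; abel
  · simp

end IsBddSemigroup

/-- A map which is Lipschitz on balls agrees on a given ball with a globally Lipschitz map. -/
theorem exists_lipschitz_cutoff (hL : ∀ R, ∃ K ≥ 0, ∀ x y, ‖x‖ ≤ R → ‖y‖ ≤ R →
    ‖f x - f y‖ ≤ K * ‖x - y‖) {R : ℝ} (hR : 0 < R) :
    ∃ g : X → X, (∃ K ≥ 0, ∀ x y, ‖g x - g y‖ ≤ K * ‖x - y‖) ∧ ∀ x, ‖x‖ ≤ R → g x = f x := by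
  obtain ⟨K, hK, hLK⟩ := hL (2 * R)
  have hb : ∀ x, ‖x‖ ≤ 2 * R → ‖f x‖ ≤ ‖f 0‖ + K * (2 * R) := fun x hx => by
    have h1 := hLK x 0 hx (by rw [norm_zero]; positivity)
    rw [sub_zero] at h1
    have h2 : ‖f x‖ ≤ ‖f x - f 0‖ + ‖f 0‖ := by simpa using norm_add_le (f x - f 0) (f 0)
    have h3 : K * ‖x‖ ≤ K * (2 * R) := mul_le_mul_of_nonneg_left hx hK
    linarith
  set M := ‖f 0‖ + K * (2 * R) with hM
  have hM0 : 0 ≤ M := by positivity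
  let χ : X → ℝ := fun x => max 0 (min 1 (2 - ‖x‖ / R))
  have hχ0 : ∀ x, 2 * R ≤ ‖x‖ → χ x = 0 := fun x hx => by
    refine max_eq_left (min_le_of_right_le ?_)
    rw [sub_nonpos, le_div_iff₀ hR]; exact hx
  have hχ1 : ∀ x, ‖x‖ ≤ R → χ x = 1 := fun x hx => by
    have : ‖x‖ / R ≤ 1 := (div_le_one hR).2 hx
    simp only [χ]
    rw [min_eq_left (by linarith), max_eq_right zero_le_one]
  have hχle : ∀ x, |χ x| ≤ 1 := fun x => by
    rw [abs_of_nonneg (le_max_left _ _)]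
    exact max_le zero_le_one (min_le_left _ _)
  have hχL : ∀ x y, |χ x - χ y| ≤ ‖x - y‖ / R := fun x y => by
    have h1 := abs_max_sub_max_le_abs (min 1 (2 - ‖x‖ / R)) (min 1 (2 - ‖y‖ / R)) 0
    have h2 := abs_min_sub_min_le_max (1 : ℝ) (2 - ‖x‖ / R) 1 (2 - ‖y‖ / R)
    rw [sub_self, abs_zero, max_eq_right (abs_nonneg _)] at h2
    have h3 : |2 - ‖x‖ / R - (2 - ‖y‖ / R)| ≤ ‖x - y‖ / R := by
      rw [show 2 - ‖x‖ / R - (2 - ‖y‖ / R) = (‖y‖ - ‖x‖) / R by ring, abs_div, abs_of_pos hR,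
        abs_sub_comm]
      exact div_le_div_of_nonneg_right (abs_norm_sub_norm_le x y) hR.le
    rw [max_comm, max_comm _ (0 : ℝ)] at h1
    exact h1.trans (h2.trans h3)
  refine ⟨fun x => χ x • f x, ⟨K + M / R, by positivity, ?_⟩, fun x hx => by simp [hχ1 x hx]⟩
  -- The increment of `χ` is paired with `f y`, evaluated at the point known to lie in the ball
  -- where `f` is bounded.
  have key : ∀ x y, ‖y‖ ≤ 2 * R → ‖χ x • f x - χ y • f y‖ ≤ (K + M / R) * ‖x - y‖ := by
    intro x y hy
    have h1 : ‖(χ x - χ y) • f y‖ ≤ M / R * ‖x - y‖ := by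
      rw [norm_smul, Real.norm_eq_abs, div_mul_eq_mul_div, mul_comm M, ← div_mul_eq_mul_div]
      exact mul_le_mul (hχL x y) (hb y hy) (norm_nonneg _) (by positivity)
    rcases le_total ‖x‖ (2 * R) with hx | hx
    · have e : χ x • f x - χ y • f y = χ x • (f x - f y) + (χ x - χ y) • f y := by
        rw [smul_sub, sub_smul]; abel
      have h2 : ‖χ x • (f x - f y)‖ ≤ K * ‖x - y‖ := by
        rw [norm_smul, Real.norm_eq_abs]
        exact (mul_le_of_le_one_left (norm_nonneg _) (hχle x)).trans (hLK x y hx hy)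
      rw [e, add_mul]
      exact (norm_add_le _ _).trans (add_le_add h2 h1)
    · have e : χ x • f x - χ y • f y = (χ x - χ y) • f y := by
        rw [hχ0 x hx]; simp
      rw [e, add_mul]
      exact h1.trans (le_add_of_nonneg_left (by positivity))
  intro x y
  rcases le_total ‖y‖ (2 * R) with hy | hy
  · exact key x y hy
  · rcases le_total ‖x‖ (2 * R) with hx | hx
    · have := key y x hx
      rwa [norm_sub_rev, norm_sub_rev y] at this
    · simp only [hχ0 x hx, hχ0 y hy, zero_smul, sub_self, norm_zero]
      positivity

/-- Global solvability, under an a priori bound for solutions which start in the domain of the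
generator. -/
theorem IsBddSemigroup.exists_mild [CompleteSpace X] (hS : IsBddSemigroup S C) {D : Set X}
    (hD : Dense D) (hL : ∀ R, ∃ K ≥ 0, ∀ x y, ‖x‖ ≤ R → ‖y‖ ≤ R →
      ‖f x - f y‖ ≤ K * ‖x - y‖) {T : ℝ} (hT : 0 ≤ T)
    (hap : ∀ ρ, ∃ B, ∀ T' ∈ Icc 0 T, ∀ U₀ ∈ D, ∀ U, ‖U₀‖ ≤ ρ → IsMildSolution S f T' U₀ U →
      ‖U T'‖ ≤ B) (ρ : ℝ) :
    ∃ B, ∀ U₀, ‖U₀‖ ≤ ρ → ∃ U, IsMildSolution S f T U₀ U ∧ ∀ t ∈ Icc 0 T, ‖U t‖ ≤ B := by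
  -- Room of size `1` is left for approximating the datum from `D`; the cutoff radius `max B 0 + 1`
  -- then exceeds the bound strictly.
  obtain ⟨B, hB⟩ := hap (ρ + 1)
  have hR : 0 < max B 0 + 1 := by positivity
  obtain ⟨g, ⟨K, hK, hgL⟩, hgf⟩ := exists_lipschitz_cutoff hL hR
  have hgc : Continuous g :=
    (LipschitzWith.of_dist_le_mul (K := K.toNNReal) fun x y => by
      rw [Real.coe_toNNReal _ hK, dist_eq_norm, dist_eq_norm]; exact hgL x y).continuous
  have hsol : ∀ U₀, ∃ U, IsMildSolution S g T U₀ U := fun U₀ => by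
    obtain ⟨U, hU, h⟩ := hS.exists_volterra hT (g := fun _ => g) (hgc.comp continuous_snd) hK
      (fun _ => hgL) (h := fun t => S t U₀) (hS.continuous_comp continuous_id continuous_const)
    exact ⟨U, hU.continuousOn, h⟩
  have hbD : ∀ U₀ ∈ D, ‖U₀‖ ≤ ρ + 1 → ∀ U, IsMildSolution S g T U₀ U →
      ∀ t ∈ Icc 0 T, ‖U t‖ ≤ B := by
    intro U₀ hU₀ hρ U hU
    have hlt : ∀ t ∈ Icc 0 T, (∀ s ∈ Icc 0 t, ‖U s‖ ≤ max B 0 + 1) → ‖U t‖ ≤ B := by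
      intro t ht h
      refine hB t ht U₀ hU₀ U hρ ((hU.mono ht.2).congr (fun _ _ => rfl) fun s hs => ?_)
      exact (hgf _ (h s hs)).symm
    -- Continuation argument: at the first time `m` when the norm reaches the cutoff radius, the
    -- solution has solved the original equation up to `m`, so its norm there is at most `B`.
    have hno : ∀ t ∈ Icc 0 T, ‖U t‖ < max B 0 + 1 := by
      by_contra! hne
      let Z : Set ℝ := {t ∈ Icc 0 T | max B 0 + 1 ≤ ‖U t‖}
      have hZc : IsClosed Z := by
        have := hU.1.norm.preimage_isClosed_of_isClosed isClosed_Icc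
          (isClosed_Ici (a := max B 0 + 1))
        exact this
      have hZne : Z.Nonempty := let ⟨t, ht, h⟩ := hne; ⟨t, ht, h⟩
      have hZb : BddBelow Z := ⟨0, fun t ht => ht.1.1⟩
      have hm := hZc.csInf_mem hZne hZb
      set m := sInf Z
      have hlt' : ∀ s ∈ Ico 0 m, ‖U s‖ ≤ max B 0 + 1 := fun s hs => by
        by_contra h
        have := csInf_le hZb (show s ∈ Z from ⟨⟨hs.1, hs.2.le.trans hm.1.2⟩, (not_le.1 h).le⟩)
        exact absurd hs.2 (not_lt.2 this)
      have hmB : ‖U m‖ ≤ max B 0 + 1 := by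
        rcases hm.1.1.eq_or_lt with h0 | h0
        · have h1 := hlt 0 ⟨le_rfl, hT⟩
          -- If `m = 0` there is no earlier time to argue from; the a priori bound on the degenerate
          -- interval `[0, 0]` bounds the datum.
          have h2 : IsMildSolution S f 0 U₀ (fun _ => U₀) :=
            ⟨continuousOn_const, fun t ht => by
              have : t = 0 := le_antisymm ht.2 ht.1
              subst this
              simp [hS.zero]⟩
          have h3 := hB 0 ⟨le_rfl, hT⟩ U₀ hU₀ _ hρ h2
          rw [← h0, hU.initial hS hT]
          exact h3.trans ((le_max_left _ _).trans (by linarith))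
        · have hc : ContinuousWithinAt (fun s => ‖U s‖) (Ico 0 m) m :=
            (hU.1.norm m hm.1).mono fun s hs => ⟨hs.1, hs.2.le.trans hm.1.2⟩
          have hcl : m ∈ closure (Ico 0 m) := by
            rw [closure_Ico h0.ne]; exact ⟨h0.le, le_rfl⟩
          have := hc.mem_closure (t := Iic (max B 0 + 1)) hcl hlt'
          rwa [closure_Iic] at this
      have h4 := hlt m hm.1 fun s hs => by
        rcases hs.2.eq_or_lt with h | h
        · rw [h]; exact hmB
        · exact hlt' s ⟨hs.1, h⟩
      have h5 := hm.2
      linarith [le_max_left B 0]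
    exact fun t ht => hlt t ht fun s hs => (hno s ⟨hs.1, hs.2.trans ht.2⟩).le
  refine ⟨B, fun U₀ hU₀ => ?_⟩
  obtain ⟨U, hU⟩ := hsol U₀
  -- For a general datum the bound is the limit of the bounds for data in `D`; solutions for the
  -- globally Lipschitz `g` depend continuously on the datum.
  have hUB : ∀ t ∈ Icc 0 T, ‖U t‖ ≤ B := by
    intro t ht
    refine le_of_forall_pos_le_add fun ε hε => ?_
    have hE : 0 < C * Real.exp (C * K * t) + 1 := by
      have := hS.nonneg
      positivity
    obtain ⟨V₀, hV₀, hV₀D⟩ := Metric.dense_iff.1 hD U₀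
      (min 1 (ε / (C * Real.exp (C * K * t) + 1))) (by positivity)
    rw [Metric.mem_ball, dist_eq_norm, lt_min_iff] at hV₀
    obtain ⟨V, hV⟩ := hsol V₀
    have hVρ : ‖V₀‖ ≤ ρ + 1 := by
      have : ‖V₀‖ ≤ ‖V₀ - U₀‖ + ‖U₀‖ := by simpa using norm_add_le (V₀ - U₀) U₀
      linarith [hV₀.1]
    have h1 := hbD V₀ hV₀D hVρ V hV t ht
    have h2 := hS.norm_sub_le (a := C * ‖U₀ - V₀‖) hK le_rfl hU.1 hV.1 (hgc.comp_continuousOn hU.1)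
      (hgc.comp_continuousOn hV.1) hU.2 hV.2 (fun t _ => by rw [← map_sub]; exact hS.bound _ _)
      (fun t ht => by rw [add_zero]; exact hgL _ _) t ht
    have h3 : ‖U t‖ ≤ ‖U t - V t‖ + ‖V t‖ := by simpa using norm_add_le (U t - V t) (V t)
    have h4 := (lt_div_iff₀ hE).1 hV₀.2
    rw [norm_sub_rev] at h4
    simp only [mul_zero, zero_mul, add_zero] at h2
    nlinarith [norm_nonneg (U₀ - V₀)]
  refine ⟨U, hU.congr (fun _ _ => rfl) fun t ht => (hgf _ ?_).symm, hUB⟩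
  exact (hUB t ht).trans ((le_max_left _ _).trans (by linarith))

/-- Well-posedness of semilinear evolution equations under an a priori bound. -/
theorem IsBddSemigroup.wellposed [CompleteSpace X] (hS : IsBddSemigroup S C) {G : X → X → Prop}
    (hG : IsGenerator G S) (hD : Dense {x | ∃ y, G x y}) (hf : ContDiff ℝ 1 f)
    (hL : ∀ R, ∃ K ≥ 0, ∀ x y, ‖x‖ ≤ R → ‖y‖ ≤ R → ‖f x - f y‖ ≤ K * ‖x - y‖)
    (hap : ∀ T ≥ 0, ∀ ρ, ∃ B, ∀ T' ∈ Icc 0 T, ∀ U₀ U, ‖U₀‖ ≤ ρ → U 0 = U₀ →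
      ContinuousOn U (Icc 0 T') → (0 < T' → IsClassicalSolution G f T' U₀ U) → ‖U T'‖ ≤ B) :
    ∃ Sol : ℝ → X → X,
      (∀ U₀ : X, ∀ T > 0, IsMildSolution S f T U₀ (fun t => Sol t U₀) ∧
        ∀ U : ℝ → X, IsMildSolution S f T U₀ U → ∀ t ∈ Icc 0 T, U t = Sol t U₀) ∧
      (∀ R T : ℝ, 0 < T → ∃ C > 0, ∀ U₁ U₂ : X, ‖U₁‖ ≤ R → ‖U₂‖ ≤ R →
        ∀ t ∈ Icc 0 T, ‖Sol t U₁ - Sol t U₂‖ ≤ C * ‖U₁ - U₂‖) ∧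
      (∀ U₀ ∈ {x | ∃ y, G x y}, ∀ T > 0, IsClassicalSolution G f T U₀ (fun t => Sol t U₀)) := by
  have hex := fun T (hT : 0 ≤ T) => hS.exists_mild hD hL hT fun ρ => by
    obtain ⟨B, hB⟩ := hap T hT ρ
    exact ⟨B, fun T' hT' U₀ ⟨V₀, h₀⟩ U hρ hU => hB T' hT' U₀ U hρ (hU.initial hS hT'.1) hU.1
      fun h => hS.classical_of_mild hG hf h hU h₀⟩
  have hsol : ∀ U₀ (T : ℝ), ∃ U, IsMildSolution S f (max T 0) U₀ U := fun U₀ T => by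
    obtain ⟨B, hB⟩ := hex (max T 0) (le_max_right _ _) ‖U₀‖
    obtain ⟨U, hU, -⟩ := hB U₀ le_rfl
    exact ⟨U, hU⟩
  choose u hu using hsol
  -- Solve up to time `t` and evaluate at the endpoint; uniqueness makes the choices for different
  -- `t` consistent.
  let Sol : ℝ → X → X := fun t U₀ => u U₀ t t
  have hSol : ∀ {T U₀ U}, IsMildSolution S f T U₀ U → ∀ t ∈ Icc 0 T, U t = Sol t U₀ := by
    intro T U₀ U hU t ht
    have := hu U₀ t
    rw [max_eq_left ht.1] at this
    exact hS.mild_unique hf.continuous hL (hU.mono ht.2) this t ⟨ht.1, le_rfl⟩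
  have hmild : ∀ U₀ : X, ∀ T > 0, IsMildSolution S f T U₀ (fun t => Sol t U₀) := by
    intro U₀ T hT
    have := hu U₀ T
    rw [max_eq_left hT.le] at this
    exact this.congr (fun t ht => (hSol this t ht).symm) fun _ _ => rfl
  refine ⟨Sol, fun U₀ T hT => ⟨hmild U₀ T hT, fun U hU => hSol hU⟩, fun R T hT => ?_,
    fun U₀ ⟨V₀, h₀⟩ T hT => hS.classical_of_mild hG hf hT (hmild U₀ T hT) h₀⟩
  obtain ⟨B, hB⟩ := hex T hT.le R
  have hb : ∀ U₀, ‖U₀‖ ≤ R → ∀ t ∈ Icc 0 T, ‖Sol t U₀‖ ≤ B := by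
    intro U₀ h₀ t ht
    obtain ⟨U, hU, hUB⟩ := hB U₀ h₀
    rw [← hSol hU t ht]
    exact hUB t ht
  obtain ⟨K, hK, hLK⟩ := hL B
  have hC := hS.nonneg
  refine ⟨C * Real.exp (C * K * T) + 1, by positivity, fun U₁ U₂ h₁ h₂ t ht => ?_⟩
  refine (hS.mild_dist_le hK hf.continuous hLK (hmild U₁ T hT) (hmild U₂ T hT) (hb U₁ h₁)
    (hb U₂ h₂) t ht).trans ?_
  rw [mul_right_comm]
  refine mul_le_mul_of_nonneg_right (le_add_of_le_of_nonneg ?_ zero_le_one) (norm_nonneg _)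
  have := ht.2
  gcongr

end MildNonlinear

/-! ### Weak derivatives of vector-valued functions of one variable. -/

section WeakDerivatives

variable {E : Type*} [NormedAddCommGroup E] [InnerProductSpace ℝ E] [CompleteSpace E]

/-- Integration by parts against a primitive. -/
theorem integral_deriv_smul_primitive {ζ : ℝ → E} {a b : ℝ}
    (hζ : IntervalIntegrable ζ volume a b) {φ : ℝ → ℝ} (hφ : ContDiff ℝ 1 φ) (hb : φ b = 0) :
    ∫ s in a..b, deriv φ s • (∫ τ in a..s, ζ τ) = -∫ s in a..b, φ s • ζ s := by
  have hφ' : Continuous (deriv φ) := hφ.continuous_deriv (by norm_num)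
  have hZ : ContinuousOn (fun s => ∫ τ in a..s, ζ τ) (uIcc a b) :=
    intervalIntegral.continuousOn_primitive_interval' hζ left_mem_uIcc
  -- Pairing with a fixed vector reduces to scalar absolutely continuous functions; the boundary
  -- terms vanish by `φ b = 0` and because the primitive starts at `a`.
  refine ext_inner_left ℝ fun e => ?_
  have hi : IntervalIntegrable (fun s => inner ℝ e (ζ s)) volume a b :=
    ⟨hζ.1.const_inner e, hζ.2.const_inner e⟩
  set z : ℝ → ℝ := fun s => ∫ τ in a..s, inner ℝ e (ζ τ) with hz
  have hac : AbsolutelyContinuousOnInterval z a b :=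
    hi.absolutelyContinuousOnInterval_intervalIntegral left_mem_uIcc
  have hφac : AbsolutelyContinuousOnInterval φ a b := hφ.contDiffOn.absolutelyContinuousOnInterval
  have key := hac.integral_mul_deriv_eq_deriv_mul hφac
  have e1 : ∫ s in a..b, deriv z s * φ s = ∫ s in a..b, inner ℝ e (φ s • ζ s) := by
    refine intervalIntegral.integral_congr_ae ?_
    filter_upwards [hi.ae_hasDerivAt_integral] with s hs hs'
    rw [(hs (uIoc_subset_uIcc hs') a left_mem_uIcc).deriv, inner_smul_right, mul_comm]
  have e2 : ∫ s in a..b, z s * deriv φ s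
      = ∫ s in a..b, inner ℝ e (deriv φ s • (∫ τ in a..s, ζ τ)) := by
    refine intervalIntegral.integral_congr fun s hs => ?_
    have h1 := (innerSL ℝ e).intervalIntegral_comp_comm (hζ.mono_set (uIcc_subset_uIcc_left hs))
    simp only [innerSL_apply_apply] at h1
    rw [inner_smul_right, ← h1, mul_comm]
  have h3 := (innerSL ℝ e).intervalIntegral_comp_comm
    ((hZ.intervalIntegrable (μ := volume)).continuousOn_smul hφ'.continuousOn)
  have h4 := (innerSL ℝ e).intervalIntegral_comp_comm (hζ.continuousOn_smul hφ.continuous.continuousOn)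
  simp only [innerSL_apply_apply] at h3 h4
  rw [inner_neg_right, ← h3, ← h4, ← e1, ← e2, key, hb]
  simp [hz]

/-- **Lemma of du Bois-Reymond**: a function with vanishing weak derivative is constant. -/
theorem exists_ae_eq_const_of_integral_deriv_smul_eq_zero {P : Set ℝ} (hP : IsOpen P)
    (hc : P.OrdConnected) {h : ℝ → E} (hh : LocallyIntegrableOn h P)
    (h0 : ∀ φ : ℝ → ℝ, ContDiff ℝ (⊤ : ℕ∞) φ → HasCompactSupport φ → tsupport φ ⊆ P →
      ∫ s, deriv φ s • h s = 0) : ∃ c : E, ∀ᵐ s, s ∈ P → h s = c := by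
  rcases P.eq_empty_or_nonempty with rfl | ⟨x, hx⟩
  · exact ⟨0, by simp⟩
  obtain ⟨ψ, hψP, hψc, hψs, hψr, hψx⟩ := exists_contDiff_tsupport_subset (n := ⊤) (hP.mem_nhds hx)
  have hψI : 0 < ∫ s, ψ s := hψs.continuous.integral_pos_of_hasCompactSupport_nonneg_nonzero hψc
    (fun s => (hψr ⟨s, rfl⟩).1) (x := x) (by rw [hψx]; exact one_ne_zero)
  have hint : ∀ {φ : ℝ → ℝ}, Continuous φ → HasCompactSupport φ → tsupport φ ⊆ P →
      Integrable fun s => φ s • h s := by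
    intro φ hφ hφc hφP
    have h1 : IntegrableOn (fun s => φ s • h s) (tsupport φ) :=
      (hh.integrableOn_compact_subset hφP hφc).continuousOn_smul hφ.continuousOn hφc
    refine h1.integrable_of_forall_notMem_eq_zero fun s hs => ?_
    rw [image_eq_zero_of_notMem_tsupport hs, zero_smul]
  let c : E := (∫ s, ψ s)⁻¹ • ∫ s, ψ s • h s
  refine ⟨c, ?_⟩
  have := hP.ae_eq_zero_of_integral_contDiff_smul_eq_zero (μ := volume) (f := fun s => h s - c)
    (hh.sub ((locallyIntegrable_const c).locallyIntegrableOn P)) fun φ hφ hφc hφP => ?_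
  · filter_upwards [this] with s hs hs'
    exact sub_eq_zero.1 (hs hs')
  -- Subtracting `m ψ` gives `φ` integral zero, so the difference is the derivative of a test
  -- function `Φ`. Testing with `Φ` yields `∫ φ h = m ∫ ψ h = ∫ φ c`.
  let m : ℝ := (∫ s, φ s) * (∫ s, ψ s)⁻¹
  let k : ℝ → ℝ := fun s => φ s - m * ψ s
  have hks : ContDiff ℝ (⊤ : ℕ∞) k := hφ.sub (contDiff_const.mul hψs)
  -- The point `x` keeps the compact set nonempty; by order-connectedness the hull `[a, b]` lies in
  -- `P`.
  have hK : IsCompact (insert x (tsupport φ ∪ tsupport ψ)) :=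
    (IsCompact.union hφc hψc).insert x
  have hKP : insert x (tsupport φ ∪ tsupport ψ) ⊆ P :=
    insert_subset hx (union_subset hφP hψP)
  obtain ⟨a, haK, ha⟩ := hK.exists_isLeast ⟨x, mem_insert _ _⟩
  obtain ⟨b, hbK, hb⟩ := hK.exists_isGreatest ⟨x, mem_insert _ _⟩
  have hk0 : ∀ s, s ∉ Icc a b → k s = 0 := by
    intro s hs
    have h1 : s ∉ tsupport φ := fun h => hs ⟨ha (Or.inr (Or.inl h)), hb (Or.inr (Or.inl h))⟩
    have h2 : s ∉ tsupport ψ := fun h => hs ⟨ha (Or.inr (Or.inr h)), hb (Or.inr (Or.inr h))⟩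
    simp [k, image_eq_zero_of_notMem_tsupport h1, image_eq_zero_of_notMem_tsupport h2]
  have hkI : ∫ s, k s = 0 := by
    simp only [k]
    rw [integral_sub (hφ.continuous.integrable_of_hasCompactSupport hφc)
      ((hψs.continuous.integrable_of_hasCompactSupport hψc).const_mul m), integral_const_mul]
    simp only [m]
    field_simp
    simp
  have hab : a ≤ b := (ha (mem_insert _ _)).trans (hb (mem_insert _ _))
  let Φ : ℝ → ℝ := fun s => ∫ τ in a..s, k τ
  have hΦd : ∀ s, HasDerivAt Φ (k s) s := fun s =>
    intervalIntegral.integral_hasDerivAt_right (hks.continuous.intervalIntegrable _ _)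
      (hks.continuous.stronglyMeasurableAtFilter _ _) hks.continuous.continuousAt
  have hΦ' : deriv Φ = k := funext fun s => (hΦd s).deriv
  have hΦs : ContDiff ℝ (⊤ : ℕ∞) Φ :=
    contDiff_infty_iff_deriv.2 ⟨fun s => (hΦd s).differentiableAt, by rw [hΦ']; exact hks⟩
  have hΦ0 : ∀ s, s ∉ Icc a b → Φ s = 0 := by
    intro s hs
    rcases lt_or_ge s a with h1 | h1
    · simp only [Φ]
      rw [intervalIntegral.integral_symm, intervalIntegral.integral_of_le h1.le,
        integral_Ioc_eq_integral_Ioo, setIntegral_eq_zero_of_forall_eq_zero, neg_zero]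
      intro τ hτ
      exact hk0 τ fun h => absurd hτ.2 (not_lt.2 h.1)
    · have h2 : b < s := not_le.1 fun h => hs ⟨h1, h⟩
      simp only [Φ]
      rw [intervalIntegral.integral_of_le h1, ← integral_Icc_eq_integral_Ioc,
        setIntegral_eq_integral_of_forall_compl_eq_zero, hkI]
      intro τ hτ
      exact hk0 τ fun h => hτ ⟨h.1, h.2.trans h2.le⟩
  have hΦsupp : tsupport Φ ⊆ Icc a b :=
    closure_minimal (fun s hs => by_contra fun h => hs (hΦ0 s h)) isClosed_Icc
  have hΦc : HasCompactSupport Φ := isCompact_Icc.of_isClosed_subset (isClosed_tsupport _) hΦsupp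
  have h1 := h0 Φ hΦs hΦc (hΦsupp.trans (hc.out (hKP haK) (hKP hbK)))
  have hi1 := hint hφ.continuous hφc hφP
  have hi2 := hint hψs.continuous hψc hψP
  rw [hΦ'] at h1
  simp only [k, sub_smul, mul_smul] at h1
  rw [integral_sub hi1 (show Integrable (fun s => m • ψ s • h s) from hi2.smul m),
    integral_smul, sub_eq_zero] at h1
  have hi3 : Integrable fun s => φ s • c :=
    (hφ.continuous.integrable_of_hasCompactSupport hφc).smul_const c
  simp only [smul_sub]
  rw [integral_sub hi1 hi3, integral_smul_const, h1]
  simp only [c, m, mul_smul]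
  exact sub_self _

/-- The energy inequality for a primitive, with a weight that decays at the rate `2 l`. -/
theorem mul_integral_weight_norm_sq_le {ζ : ℝ → E} {r l : ℝ} (hr : 0 < r)
    (hζ : IntervalIntegrable ζ volume 0 r) {ρ : ℝ → ℝ} (hρc : ContinuousOn ρ (Icc 0 r))
    (hρ1 : ContDiffOn ℝ 1 ρ (Ioi 0)) (hρr : 0 ≤ ρ r)
    (hρ' : ∀ s > 0, deriv ρ s + 2 * l * ρ s ≤ 0) :
    l * ∫ s in (0 : ℝ)..r, ρ s * ‖∫ τ in (0 : ℝ)..s, ζ τ‖ ^ 2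
      ≤ ∫ s in (0 : ℝ)..r, ρ s * inner ℝ (∫ τ in (0 : ℝ)..s, ζ τ) (ζ s) := by
  set Z : ℝ → E := fun s => ∫ τ in (0 : ℝ)..s, ζ τ with hZ
  have h0r : uIcc 0 r = Icc 0 r := uIcc_of_le hr.le
  have hZc : ContinuousOn Z (Icc 0 r) := by
    rw [← h0r]
    exact intervalIntegral.continuousOn_primitive_interval' hζ left_mem_uIcc
  have hi1 : IntervalIntegrable (fun s => ρ s * ‖Z s‖ ^ 2) volume 0 r :=
    ContinuousOn.intervalIntegrable_of_Icc hr.le (hρc.mul (hZc.norm.pow 2))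
  have hi2 : IntervalIntegrable (fun s => ρ s * inner ℝ (Z s) (ζ s)) volume 0 r := by
    have h1 : IntervalIntegrable (fun s => (ρ s * ‖Z s‖) * ‖ζ s‖) volume 0 r :=
      hζ.norm.continuousOn_mul (by rw [h0r]; exact hρc.mul hZc.norm)
    refine h1.mono_fun ?_ ?_
    · rw [uIoc_of_le hr.le]
      have hs : MeasurableSet (Ioc 0 r) := measurableSet_Ioc
      refine ((hρc.mono Ioc_subset_Icc_self).aestronglyMeasurable hs).mul ?_
      refine AEStronglyMeasurable.inner ((hZc.mono Ioc_subset_Icc_self).aestronglyMeasurable hs) ?_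
      exact hζ.1.aestronglyMeasurable
    · refine Eventually.of_forall fun s => ?_
      simp only [norm_mul, norm_norm, mul_assoc]
      exact mul_le_mul_of_nonneg_left (norm_inner_le_norm _ _) (norm_nonneg _)
  set q : ℝ → ℝ := fun s => ρ s * ‖Z s‖ ^ 2 with hq
  set F : ℝ → ℝ := fun s => 2 * (ρ s * inner ℝ (Z s) (ζ s)) - 2 * l * (ρ s * ‖Z s‖ ^ 2) with hF
  have hFi : IntervalIntegrable F volume 0 r := (hi2.const_mul 2).sub (hi1.const_mul (2 * l))
  -- Increments of `‖Z‖` are dominated by those of the primitive of `‖ζ‖`.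
  have hZac : AbsolutelyContinuousOnInterval (fun s => ‖Z s‖) 0 r := by
    have hN := hζ.norm.absolutelyContinuousOnInterval_intervalIntegral left_mem_uIcc
    rw [absolutelyContinuousOnInterval_iff] at hN ⊢
    intro ε hε
    obtain ⟨δ, hδ, h⟩ := hN ε hε
    refine ⟨δ, hδ, fun I hI hs => (Finset.sum_le_sum fun i hi => ?_).trans_lt (h I hI hs)⟩
    have hm := hI.1 i hi
    have hj : ∀ {x}, x ∈ uIcc 0 r → IntervalIntegrable ζ volume 0 x := fun hx =>
      hζ.mono_set (uIcc_subset_uIcc_left hx)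
    rw [Real.dist_eq, Real.dist_eq]
    refine (abs_norm_sub_norm_le _ _).trans ?_
    simp only [hZ]
    rw [intervalIntegral.integral_interval_sub_left (hj hm.1) (hj hm.2),
      intervalIntegral.integral_interval_sub_left (hj hm.1).norm (hj hm.2).norm]
    exact intervalIntegral.norm_integral_le_abs_integral_norm
  -- The weight is `C¹` only on the open half-line, so integrate `q'` from `ε`, drop `q r ≥ 0`, and
  -- let `ε` tend to `0`, where `q` vanishes.
  have hqle : ∀ ε ∈ Ioc 0 r, -q ε ≤ ∫ s in ε..r, F s := by
    intro ε hε
    have hsub : uIcc ε r ⊆ uIcc 0 r := by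
      rw [h0r, uIcc_of_le hε.2]; exact Icc_subset_Icc_left hε.1.le
    have hρac : AbsolutelyContinuousOnInterval ρ ε r :=
      ContDiffOn.absolutelyContinuousOnInterval (hρ1.mono fun s hs => by
        rw [uIcc_of_le hε.2] at hs
        exact hε.1.trans_le hs.1)
    have hac : AbsolutelyContinuousOnInterval q ε r := by
      have h2 := hZac.mono hsub
      have h3 := hρac.fun_mul (h2.fun_mul h2)
      simpa only [hq, pow_two] using h3
    have h4 := hac.integral_deriv_eq_sub
    have h5 : ∫ s in ε..r, deriv q s ≤ ∫ s in ε..r, F s := by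
      refine intervalIntegral.integral_mono_ae_restrict hε.2 hac.intervalIntegrable_deriv
        (hFi.mono_set hsub) ?_
      rw [EventuallyLE, ae_restrict_iff' measurableSet_Icc]
      filter_upwards [hζ.ae_hasDerivAt_integral] with s hs hs'
      have hsm : s ∈ uIcc 0 r := hsub (by rwa [uIcc_of_le hε.2])
      have hs0 : 0 < s := hε.1.trans_le hs'.1
      have d1 : HasDerivAt Z (ζ s) s := hs hsm 0 left_mem_uIcc
      have d2 : HasDerivAt ρ (deriv ρ s) s :=
        ((hρ1.differentiableOn (by norm_num) s hs0).differentiableAt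
          (Ioi_mem_nhds hs0)).hasDerivAt
      have d3 : HasDerivAt q _ s := d2.mul d1.norm_sq
      rw [d3.deriv]
      simp only [hF]
      have := mul_le_mul_of_nonneg_right (hρ' s hs0) (sq_nonneg ‖Z s‖)
      linarith
    have h6 : 0 ≤ q r := mul_nonneg hρr (sq_nonneg _)
    linarith
  have hlim1 : Tendsto q (𝓝[>] 0) (𝓝 0) := by
    have h1 : ContinuousOn q (Icc 0 r) := hρc.mul (hZc.norm.pow 2)
    have h2 := (h1 0 ⟨le_rfl, hr.le⟩).mono_of_mem_nhdsWithin (Icc_mem_nhdsGT hr)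
    have h3 : q 0 = 0 := by simp [hq, hZ]
    rw [ContinuousWithinAt, h3] at h2
    exact h2
  have hlim2 : Tendsto (fun ε => ∫ s in ε..r, F s) (𝓝[>] 0) (𝓝 (∫ s in (0 : ℝ)..r, F s)) := by
    have h1 := intervalIntegral.continuousOn_primitive_interval_left
      (f := F) (a := 0) (b := r) (μ := volume)
      (by rw [h0r, integrableOn_Icc_iff_integrableOn_Ioc]; exact hFi.1)
    have h2 := (h1 0 left_mem_uIcc).mono_of_mem_nhdsWithin
      (by rw [h0r]; exact Icc_mem_nhdsGT hr)
    exact h2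
  have hfin : -(0 : ℝ) ≤ ∫ s in (0 : ℝ)..r, F s :=
    le_of_tendsto_of_tendsto hlim1.neg hlim2 (by
      filter_upwards [Ioc_mem_nhdsGT hr] with ε hε using hqle ε hε)
  simp only [hF] at hfin
  rw [intervalIntegral.integral_sub (hi2.const_mul 2) (hi1.const_mul (2 * l)),
    intervalIntegral.integral_const_mul, intervalIntegral.integral_const_mul] at hfin
  linarith

end WeakDerivatives

/-! ### The weighted measure and the interval on which the kernel is positive. -/

section MemoryMeasure

/-- The set where a memory kernel is positive. -/
def memSet (μ : ℝ → ℝ) : Set ℝ := {s | 0 < s ∧ 0 < μ s}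

namespace IsMemoryKernel

variable {μ : ℝ → ℝ} {δ : ℝ}

theorem deriv_nonpos (hμ : IsMemoryKernel μ δ) (hδ : 0 < δ) {s : ℝ} (hs : 0 < s) :
    deriv μ s ≤ 0 := by
  have h1 := hμ.deriv_le s hs
  have h2 := mul_nonneg hδ.le (hμ.nonneg s hs)
  linarith

theorem antitoneOn (hμ : IsMemoryKernel μ δ) (hδ : 0 < δ) : AntitoneOn μ (Ici 0) := by
  refine antitoneOn_of_deriv_nonpos (convex_Ici 0) hμ.continuousOn ?_ fun s hs => ?_
  · rw [interior_Ici]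
    exact hμ.contDiffOn.differentiableOn (by norm_num)
  · rw [interior_Ici] at hs
    exact hμ.deriv_nonpos hδ hs

theorem isOpen_memSet (hμ : IsMemoryKernel μ δ) : IsOpen (memSet μ) :=
  (hμ.continuousOn.mono Ioi_subset_Ici_self).isOpen_inter_preimage isOpen_Ioi isOpen_Ioi

theorem mem_memSet_of_le (hμ : IsMemoryKernel μ δ) (hδ : 0 < δ) {r s : ℝ} (hr : r ∈ memSet μ)
    (hs : 0 < s) (hsr : s ≤ r) : s ∈ memSet μ :=
  ⟨hs, hr.2.trans_le (hμ.antitoneOn hδ hs.le hr.1.le hsr)⟩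

theorem ordConnected_memSet (hμ : IsMemoryKernel μ δ) (hδ : 0 < δ) : (memSet μ).OrdConnected :=
  ⟨fun _ hx _ hy _ hz => hμ.mem_memSet_of_le hδ hy (hx.1.trans_le hz.1) hz.2⟩

theorem aemeasurable (hμ : IsMemoryKernel μ δ) :
    AEMeasurable (fun s => ENNReal.ofReal (μ s)) (volume.restrict (Ioi 0)) :=
  hμ.integrableOn.aestronglyMeasurable.aemeasurable.ennreal_ofReal

theorem isFiniteMeasure (hμ : IsMemoryKernel μ δ) : IsFiniteMeasure (memMeasure μ) :=
  isFiniteMeasure_withDensity_ofReal hμ.integrableOn.2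

/-- The density vanishes exactly off `memSet μ` in the half-line. This translates almost-everywhere
statements for the weighted measure into Lebesgue ones. -/
theorem ae_iff (hμ : IsMemoryKernel μ δ) {p : ℝ → Prop} :
    (∀ᵐ s ∂memMeasure μ, p s) ↔ ∀ᵐ s, s ∈ memSet μ → p s := by
  rw [memMeasure, ae_withDensity_iff' hμ.aemeasurable, ae_restrict_iff' measurableSet_Ioi]
  refine eventually_congr (Eventually.of_forall fun s => ?_)
  simp only [memSet, mem_ofPred_eq, mem_Ioi, ne_eq, ENNReal.ofReal_eq_zero, not_le, and_imp]

theorem integral_eq (hμ : IsMemoryKernel μ δ) {E : Type*} [NormedAddCommGroup E] [NormedSpace ℝ E]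
    (g : ℝ → E) : ∫ s, g s ∂memMeasure μ = ∫ s in Ioi 0, μ s • g s := by
  rw [memMeasure, integral_withDensity_eq_integral_toReal_smul₀ hμ.aemeasurable (by simp)]
  refine setIntegral_congr_fun measurableSet_Ioi fun s hs => ?_
  rw [ENNReal.toReal_ofReal (hμ.nonneg s hs)]

/-- The kernel decreases, so on `(0, r]` it is at least `μ r > 0` and Lebesgue measure is dominated
by `(μ r)⁻¹` times the weighted one. -/
theorem memLp_restrict (hμ : IsMemoryKernel μ δ) (hδ : 0 < δ) {E : Type*} [NormedAddCommGroup E]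
    {g : ℝ → E} (hg : MemLp g 2 (memMeasure μ)) {r : ℝ} (hr : r ∈ memSet μ) :
    MemLp g 2 (volume.restrict (Ioc 0 r)) := by
  refine hg.of_measure_le_smul (c := (ENNReal.ofReal (μ r))⁻¹)
    (ENNReal.inv_ne_top.2 (by simpa using hr.2)) ?_
  rw [Measure.le_iff]
  intro A hA
  have h1 : ENNReal.ofReal (μ r) * volume (A ∩ Ioc 0 r) ≤ memMeasure μ A := by
    rw [memMeasure, withDensity_apply _ hA, Measure.restrict_restrict hA, ← setLIntegral_const]
    calc _ ≤ ∫⁻ s in A ∩ Ioc 0 r, ENNReal.ofReal (μ s) := by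
          refine setLIntegral_mono' (hA.inter measurableSet_Ioc) fun s hs => ?_
          exact ENNReal.ofReal_le_ofReal (hμ.antitoneOn hδ hs.2.1.le hr.1.le hs.2.2)
      _ ≤ _ := lintegral_mono_set (inter_subset_inter_right _ Ioc_subset_Ioi_self)
  rw [Measure.restrict_apply hA, Measure.smul_apply, smul_eq_mul]
  rwa [← ENNReal.div_eq_inv_mul, ENNReal.le_div_iff_mul_le (by simp [hr.2]) (by simp), mul_comm]

theorem intervalIntegrable (hμ : IsMemoryKernel μ δ) (hδ : 0 < δ) {E : Type*}
    [NormedAddCommGroup E] {g : ℝ → E} (hg : MemLp g 2 (memMeasure μ)) {r : ℝ}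
    (hr : r ∈ memSet μ) : IntervalIntegrable g volume 0 r := by
  rw [intervalIntegrable_iff_integrableOn_Ioc_of_le hr.1.le]
  exact (hμ.memLp_restrict hδ hg hr).integrable (by norm_num)

/-- The set where a memory kernel is positive is empty or exhausted by intervals `(0, rₙ]`. -/
theorem memSet_eq_iUnion (hμ : IsMemoryKernel μ δ) (hδ : 0 < δ) :
    memSet μ = ∅ ∨ ∃ r : ℕ → ℝ, Monotone r ∧ (∀ n, r n ∈ memSet μ) ∧
      ⋃ n, Ioc 0 (r n) = memSet μ := by
  rcases (memSet μ).eq_empty_or_nonempty with h | ⟨x, hx⟩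
  · exact Or.inl h
  refine Or.inr ?_
  have main : ∀ r : ℕ → ℝ, Monotone r → (∀ n, r n ∈ memSet μ) →
      (∀ s ∈ memSet μ, ∃ n, s ≤ r n) → ∃ r : ℕ → ℝ, Monotone r ∧ (∀ n, r n ∈ memSet μ) ∧
      ⋃ n, Ioc 0 (r n) = memSet μ := by
    intro r hm hr hs
    refine ⟨r, hm, hr, Subset.antisymm ?_ ?_⟩
    · exact iUnion_subset fun n s hs => hμ.mem_memSet_of_le hδ (hr n) hs.1 hs.2
    · intro s h
      obtain ⟨n, hn⟩ := hs s h
      exact mem_iUnion.2 ⟨n, h.1, hn⟩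
  by_cases hb : BddAbove (memSet μ)
  · have hpos : 0 < sSup (memSet μ) := hx.1.trans_le (le_csSup hb hx)
    obtain ⟨u, hu, hu0, hut⟩ := exists_seq_strictMono_tendsto' hpos
    refine main u hu.monotone (fun n => ?_) fun s hs => ?_
    · obtain ⟨p, hp, hup⟩ := exists_lt_of_lt_csSup ⟨x, hx⟩ (hu0 n).2
      exact hμ.mem_memSet_of_le hδ hp (hu0 n).1 hup.le
    -- The supremum is not attained because the set is open.
    · have h1 : s < sSup (memSet μ) := by
        obtain ⟨ε, hε, hball⟩ := Metric.isOpen_iff.1 hμ.isOpen_memSet s hs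
        have h2 : s + ε / 2 ∈ memSet μ := hball (by
          rw [Metric.mem_ball, Real.dist_eq, add_sub_cancel_left, abs_of_pos (by positivity)]
          linarith)
        have := le_csSup hb h2
        linarith
      obtain ⟨n, hn⟩ := (hut.eventually (lt_mem_nhds h1)).exists
      exact ⟨n, hn.le⟩
  · rw [not_bddAbove_iff] at hb
    refine main (fun n => n + 1) (fun a b h => by simpa using h) (fun n => ?_) fun s _ => ?_
    · obtain ⟨p, hp, h⟩ := hb (n + 1)
      exact hμ.mem_memSet_of_le hδ hp (by positivity) h.le
    · obtain ⟨n, hn⟩ := exists_nat_ge s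
      exact ⟨n, by linarith⟩

theorem integral_eq_memSet (hμ : IsMemoryKernel μ δ) {E : Type*} [NormedAddCommGroup E]
    [NormedSpace ℝ E] (g : ℝ → E) :
    ∫ s, g s ∂memMeasure μ = ∫ s in memSet μ, μ s • g s := by
  rw [hμ.integral_eq, setIntegral_eq_of_subset_of_forall_sdiff_eq_zero measurableSet_Ioi
    (show memSet μ ⊆ Ioi 0 from fun s hs => hs.1)]
  intro s hs
  have : μ s = 0 := le_antisymm (not_lt.1 fun h => hs.2 ⟨hs.1, h⟩) (hμ.nonneg s hs.1)
  rw [this, zero_smul]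

theorem integrable_iff (hμ : IsMemoryKernel μ δ) {E : Type*} [NormedAddCommGroup E]
    [NormedSpace ℝ E] (g : ℝ → E) :
    Integrable g (memMeasure μ) ↔ IntegrableOn (fun s => μ s • g s) (Ioi 0) := by
  rw [memMeasure, integrable_withDensity_iff_integrable_smul₀' hμ.aemeasurable (by simp)]
  refine integrableOn_congr_fun (fun s hs => ?_) measurableSet_Ioi
  rw [ENNReal.toReal_ofReal (hμ.nonneg s hs)]

/-- If all `∫₀ʳ μ g` with `μ r > 0` are nonnegative, then so is the full integral. -/
theorem integral_nonneg_of_forall (hμ : IsMemoryKernel μ δ) (hδ : 0 < δ) {g : ℝ → ℝ}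
    (hg : Integrable g (memMeasure μ))
    (h : ∀ r ∈ memSet μ, 0 ≤ ∫ s in (0 : ℝ)..r, μ s * g s) : 0 ≤ ∫ s, g s ∂memMeasure μ := by
  rw [hμ.integral_eq_memSet]
  rcases hμ.memSet_eq_iUnion hδ with h0 | ⟨r, hm, hr, hU⟩
  · simp [h0]
  · rw [hU.symm]
    have h1 := (hμ.integrable_iff g).1 hg
    refine ge_of_tendsto (tendsto_setIntegral_of_monotone (s := fun n => Ioc 0 (r n))
      (fun _ => measurableSet_Ioc) (fun a b hab => Ioc_subset_Ioc_right (hm hab)) (h1.mono_set ?_))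
      (Eventually.of_forall fun n => ?_)
    · rw [hU]; exact fun s hs => hs.1
    · have := h (r n) (hr n)
      rwa [intervalIntegral.integral_of_le (hr n).1.le] at this

/-- A function with uniformly bounded `∫₀ʳ μ ‖Y‖²`, `μ r > 0`, is in the weighted space. -/
theorem memLp_of_forall (hμ : IsMemoryKernel μ δ) (hδ : 0 < δ) {E : Type*} [NormedAddCommGroup E]
    {Y : ℝ → E} (hY : ContinuousOn Y (memSet μ)) {B : ℝ}
    (h : ∀ r ∈ memSet μ, ∫ s in Ioc 0 r, μ s * ‖Y s‖ ^ 2 ≤ B)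
    (hi : ∀ r ∈ memSet μ, IntegrableOn (fun s => μ s * ‖Y s‖ ^ 2) (Ioc 0 r)) :
    MemLp Y 2 (memMeasure μ) := by
  have hms : MeasurableSet (memSet μ) := hμ.isOpen_memSet.measurableSet
  have hrest : memMeasure μ = (volume.restrict (memSet μ)).withDensity
      fun s => ENNReal.ofReal (μ s) := by
    have hcompl : memMeasure μ (memSet μ)ᶜ = 0 := by
      have : ∀ᵐ s ∂memMeasure μ, s ∈ memSet μ := hμ.ae_iff.2 (by simp)
      exact this
    rw [← Measure.restrict_eq_self_of_ae_mem (s := memSet μ) (μ := memMeasure μ)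
      (hμ.ae_iff.2 (by simp)), memMeasure, restrict_withDensity hms,
      Measure.restrict_restrict hms]
    congr 2
    exact inter_eq_left.2 fun s hs => hs.1
  have hYm : AEStronglyMeasurable Y (memMeasure μ) := by
    rw [hrest]
    exact (hY.aestronglyMeasurable hms).mono_ac (withDensity_absolutelyContinuous _ _)
  rw [memLp_two_iff_integrable_sq_norm hYm, hμ.integrable_iff]
  have h1 : IntegrableOn (fun s => μ s * ‖Y s‖ ^ 2) (memSet μ) := by
    rcases hμ.memSet_eq_iUnion hδ with h0 | ⟨r, hm, hr, hU⟩
    · simp [h0]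
    · have hμm : ContinuousOn μ (memSet μ) := hμ.continuousOn.mono fun s hs => le_of_lt hs.1
      refine ⟨(hμm.mul (hY.norm.pow 2)).aestronglyMeasurable hms, ?_⟩
      rw [hasFiniteIntegral_iff_ofReal ((ae_restrict_iff' hms).2 (Eventually.of_forall fun s hs =>
        mul_nonneg hs.2.le (sq_nonneg _))), ← hU, setLIntegral_iUnion_of_directed]
      · refine lt_of_le_of_lt (iSup_le fun n => ?_) (ENNReal.ofReal_lt_top (r := B))
        rw [← ofReal_integral_eq_lintegral_ofReal (hi _ (hr n))]
        · exact ENNReal.ofReal_le_ofReal (h _ (hr n))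
        · exact (ae_restrict_iff' measurableSet_Ioc).2 (Eventually.of_forall fun s hs =>
            mul_nonneg (hμ.nonneg s hs.1) (sq_nonneg _))
      · exact (monotone_nat_of_le_succ fun n =>
          Ioc_subset_Ioc_right (hm (Nat.le_succ n))).directed_le
  refine h1.of_forall_sdiff_eq_zero measurableSet_Ioi fun s hs => ?_
  have : μ s = 0 := le_antisymm (not_lt.1 fun h => hs.2 ⟨hs.1, h⟩) (hμ.nonneg s hs.1)
  rw [this, zero_mul]

end IsMemoryKernel

end MemoryMeasure

/-! ### Differentiation in the memory variable and its resolvent. -/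

section MemoryDerivative

variable {E : Type*} [NormedAddCommGroup E] [InnerProductSpace ℝ E] {μ : ℝ → ℝ} {δ : ℝ}

theorem integral_Ioi_test {ψ : ℝ → ℝ} (hψ : tsupport ψ ⊆ memSet μ) (g : ℝ → E) :
    ∫ s in Ioi 0, ψ s • g s = ∫ s, ψ s • g s := by
  refine setIntegral_eq_integral_of_forall_compl_eq_zero fun s hs => ?_
  rw [image_eq_zero_of_notMem_tsupport fun h => hs (hψ h).1, zero_smul]

theorem integral_test_congr {ψ : ℝ → ℝ} (hψ : tsupport ψ ⊆ memSet μ)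
    {g g' : ℝ → E} (h : ∀ᵐ s, s ∈ memSet μ → g s = g' s) :
    ∫ s, ψ s • g s = ∫ s, ψ s • g' s := by
  refine integral_congr_ae ?_
  filter_upwards [h] with s hs
  by_cases h1 : s ∈ memSet μ
  · rw [hs h1]
  · rw [image_eq_zero_of_notMem_tsupport fun h => h1 (hψ h), zero_smul, zero_smul]

theorem continuousOn_primitive_Icc {g : ℝ → E}
    (hg : ∀ r ∈ memSet μ, IntervalIntegrable g volume 0 r) {r : ℝ}
    (hr : r ∈ memSet μ) : ContinuousOn (fun s => ∫ τ in (0 : ℝ)..s, g τ) (Icc 0 r) := by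
  have := intervalIntegral.continuousOn_primitive_interval' (hg r hr) left_mem_uIcc
  rwa [uIcc_of_le hr.1.le] at this

namespace IsMemoryKernel

omit [InnerProductSpace ℝ E] in
theorem locallyIntegrableOn (hμ : IsMemoryKernel μ δ) (hδ : 0 < δ) {g : ℝ → E}
    (hg : MemLp g 2 (memMeasure μ)) : LocallyIntegrableOn g (memSet μ) := by
  rw [locallyIntegrableOn_iff hμ.isOpen_memSet.isLocallyClosed]
  intro K hK hKc
  rcases K.eq_empty_or_nonempty with rfl | hne
  · simp
  obtain ⟨b, hbK, hb⟩ := hKc.exists_isGreatest hne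
  have h1 : IntegrableOn g (Ioc 0 b) := (hμ.memLp_restrict hδ hg (hK hbK)).integrable (by norm_num)
  exact h1.mono_set fun s hs => ⟨(hK hs).1, hb hs⟩

theorem continuousOn_primitive_memSet (hμ : IsMemoryKernel μ δ) {g : ℝ → E}
    (hg : ∀ r ∈ memSet μ, IntervalIntegrable g volume 0 r) :
    ContinuousOn (fun s => ∫ τ in (0 : ℝ)..s, g τ) (memSet μ) := by
  intro s hs
  obtain ⟨ε, hε, hball⟩ := Metric.isOpen_iff.1 hμ.isOpen_memSet s hs
  have h2 : s + ε / 2 ∈ memSet μ := hball (by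
    rw [Metric.mem_ball, Real.dist_eq, add_sub_cancel_left, abs_of_pos (by positivity)]
    linarith)
  refine ((continuousOn_primitive_Icc hg h2).continuousAt ?_).continuousWithinAt
  exact Icc_mem_nhds hs.1 (by linarith)

/-- The integral of a test function against `g` is an integral over an interval `[0, r]` with
`μ r > 0`. -/
theorem integral_test_eq (hμ : IsMemoryKernel μ δ) {φ : ℝ → ℝ} (hφ : HasCompactSupport φ)
    (hφP : tsupport φ ⊆ memSet μ) :
    φ = 0 ∨ ∃ r ∈ memSet μ, φ r = 0 ∧ ∀ (ψ : ℝ → ℝ) (g : ℝ → E), tsupport ψ ⊆ tsupport φ →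
      ∫ s, ψ s • g s = ∫ s in (0 : ℝ)..r, ψ s • g s := by
  rcases (tsupport φ).eq_empty_or_nonempty with h | hne
  · exact Or.inl (tsupport_eq_empty_iff.1 h)
  refine Or.inr ?_
  obtain ⟨b, hbK, hb⟩ := hφ.isCompact.exists_isGreatest hne
  obtain ⟨ε, hε, hball⟩ := Metric.isOpen_iff.1 hμ.isOpen_memSet b (hφP hbK)
  have h2 : b + ε / 2 ∈ memSet μ := hball (by
    rw [Metric.mem_ball, Real.dist_eq, add_sub_cancel_left, abs_of_pos (by positivity)]
    linarith)
  refine ⟨b + ε / 2, h2, image_eq_zero_of_notMem_tsupport fun h => ?_, fun ψ g hψ => ?_⟩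
  · have := hb h
    linarith
  · rw [intervalIntegral.integral_of_le h2.1.le, setIntegral_eq_integral_of_forall_compl_eq_zero]
    intro s hs
    have h4 : s ∉ tsupport ψ := fun h => by
      have h3 := hb (hψ h)
      exact hs ⟨(hφP (hψ h)).1, by linarith⟩
    rw [image_eq_zero_of_notMem_tsupport h4, zero_smul]

variable [CompleteSpace E]

/-- The weak derivative with zero boundary value characterizes primitives. -/
theorem hasMemDeriv_iff (hμ : IsMemoryKernel μ δ) (hδ : 0 < δ) {η ζ : L2mem μ E} :
    HasMemDeriv η ζ ↔ ∀ᵐ s, s ∈ memSet μ → η s = ∫ τ in (0 : ℝ)..s, ζ τ := by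
  have hζ : ∀ r ∈ memSet μ, IntervalIntegrable ζ volume 0 r := fun r hr =>
    hμ.intervalIntegrable hδ (Lp.memLp ζ) hr
  have hη := Lp.memLp η
  set Z : ℝ → E := fun s => ∫ τ in (0 : ℝ)..s, ζ τ with hZ
  have hlim : ∀ r ∈ memSet μ, Tendsto Z (𝓝[>] 0) (𝓝 0) := by
    intro r hr
    have h1 := (continuousOn_primitive_Icc hζ hr) 0 ⟨le_rfl, hr.1.le⟩
    have h2 := h1.mono_of_mem_nhdsWithin (Icc_mem_nhdsGT hr.1)
    have h3 : Z 0 = 0 := by simp [hZ]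
    rw [ContinuousWithinAt] at h2
    change Tendsto Z _ (𝓝 (Z 0)) at h2
    rwa [h3] at h2
  have htest : ∀ φ : ℝ → ℝ, ContDiff ℝ (⊤ : ℕ∞) φ → HasCompactSupport φ → tsupport φ ⊆ memSet μ →
      ∫ s, deriv φ s • Z s = -∫ s, φ s • ζ s := by
    intro φ hφ hφc hφP
    rcases hμ.integral_test_eq (E := E) hφc hφP with rfl | ⟨r, hr, hφr, h⟩
    · simp
    · rw [h _ _ tsupport_deriv_subset, h _ _ Subset.rfl]
      exact integral_deriv_smul_primitive (hζ r hr) (hφ.of_le (by norm_cast)) hφr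
  constructor
  · rintro ⟨hw, g, hg, hg0⟩
    -- The difference of `η` and the primitive `Z` has zero weak derivative, hence is constant on
    -- the interval `memSet μ`.
    have hloc : LocallyIntegrableOn (fun s => η s - Z s) (memSet μ) :=
      (hμ.locallyIntegrableOn hδ hη).sub
        ((hμ.continuousOn_primitive_memSet hζ).locallyIntegrableOn
          hμ.isOpen_memSet.measurableSet)
    obtain ⟨c, hc⟩ := exists_ae_eq_const_of_integral_deriv_smul_eq_zero hμ.isOpen_memSet
      (hμ.ordConnected_memSet hδ) hloc fun φ hφ hφc hφP => by
        have hd : tsupport (deriv φ) ⊆ memSet μ := tsupport_deriv_subset.trans hφP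
        have hi : ∀ {k : ℝ → E}, LocallyIntegrableOn k (memSet μ) →
            Integrable fun s => deriv φ s • k s := fun hk => by
          have h1 := (hk.integrableOn_compact_subset hd hφc.deriv).continuousOn_smul
            (hφ.continuous_deriv (by norm_cast)).continuousOn hφc.deriv
          refine h1.integrable_of_forall_notMem_eq_zero fun s hs => ?_
          rw [image_eq_zero_of_notMem_tsupport hs, zero_smul]
        have h1 := hw φ hφ hφc hφP
        rw [integral_Ioi_test hd, integral_Ioi_test hφP] at h1
        simp only [smul_sub]
        rw [integral_sub (hi (hμ.locallyIntegrableOn hδ hη))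
          (hi ((hμ.continuousOn_primitive_memSet hζ).locallyIntegrableOn
            hμ.isOpen_memSet.measurableSet)), h1, htest φ hφ hφc hφP, sub_self]
    rcases (memSet μ).eq_empty_or_nonempty with h0 | ⟨r, hr⟩
    · simp [h0]
    have hae : ∀ᵐ s, s ∈ Ioc 0 r → g s - Z s = c := by
      filter_upwards [hc, hμ.ae_iff.1 hg] with s h1 h2 hs
      have := hμ.mem_memSet_of_le hδ hr hs.1 hs.2
      rw [h2 this, h1 this]
    -- Near `0` the difference `g - Z` equals `c` almost everywhere but tends to `0`; if `c ≠ 0`, a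
    -- whole interval `(0, min u r]` would be null.
    have hc0 : c = 0 := by
      have h1 : Tendsto (fun s => g s - Z s) (𝓝[>] 0) (𝓝 0) := by
        simpa using hg0.sub (hlim r hr)
      by_contra hne
      have h2 := h1.eventually (isOpen_ne.mem_nhds (Ne.symm hne))
      obtain ⟨u, hu, hu'⟩ := mem_nhdsGT_iff_exists_Ioc_subset.1 h2
      have h3 : volume (Ioc 0 (min u r)) ≠ 0 := by
        simp [hr.1, show (0 : ℝ) < u from hu]
      refine h3 (measure_mono_null (fun s hs => ?_) hae)
      intro h4
      exact hu' ⟨hs.1, hs.2.trans (min_le_left _ _)⟩ (h4 ⟨hs.1, hs.2.trans (min_le_right _ _)⟩)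
    filter_upwards [hc] with s h1 hs
    have := h1 hs
    rwa [hc0, sub_eq_zero] at this
  · intro h
    refine ⟨fun φ hφ hφc hφP => ?_, ?_⟩
    · have hd : tsupport (deriv φ) ⊆ memSet μ := tsupport_deriv_subset.trans hφP
      rw [integral_Ioi_test hd, integral_Ioi_test hφP, integral_test_congr hd h]
      exact htest φ hφ hφc hφP
    · rcases (memSet μ).eq_empty_or_nonempty with h0 | ⟨r, hr⟩
      · refine ⟨fun _ => 0, hμ.ae_iff.2 ?_, tendsto_const_nhds⟩
        simp [h0]
      · exact ⟨Z, hμ.ae_iff.2 (h.mono fun s hs h' => (hs h').symm), hlim r hr⟩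

theorem hasMemDeriv_add (hμ : IsMemoryKernel μ δ) (hδ : 0 < δ) {η ζ η' ζ' : L2mem μ E}
    (h : HasMemDeriv η ζ) (h' : HasMemDeriv η' ζ') : HasMemDeriv (η + η') (ζ + ζ') := by
  rw [hμ.hasMemDeriv_iff hδ] at *
  filter_upwards [h, h', hμ.ae_iff.1 (Lp.coeFn_add η η')] with s h1 h2 h3 hs
  rw [h3 hs, Pi.add_apply, h1 hs, h2 hs, ← intervalIntegral.integral_add
    (hμ.intervalIntegrable hδ (Lp.memLp ζ) hs) (hμ.intervalIntegrable hδ (Lp.memLp ζ') hs)]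
  refine intervalIntegral.integral_congr_ae ?_
  filter_upwards [hμ.ae_iff.1 (Lp.coeFn_add ζ ζ')] with τ h4 hτ
  rw [uIoc_of_le hs.1.le] at hτ
  rw [h4 (hμ.mem_memSet_of_le hδ hs hτ.1 hτ.2), Pi.add_apply]

theorem hasMemDeriv_smul (hμ : IsMemoryKernel μ δ) (hδ : 0 < δ) (c : ℝ) {η ζ : L2mem μ E}
    (h : HasMemDeriv η ζ) : HasMemDeriv (c • η) (c • ζ) := by
  rw [hμ.hasMemDeriv_iff hδ] at *
  filter_upwards [h, hμ.ae_iff.1 (Lp.coeFn_smul c η)] with s h1 h3 hs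
  rw [h3 hs, Pi.smul_apply, h1 hs, ← intervalIntegral.integral_smul]
  refine intervalIntegral.integral_congr_ae ?_
  filter_upwards [hμ.ae_iff.1 (Lp.coeFn_smul c ζ)] with τ h4 hτ
  rw [uIoc_of_le hs.1.le] at hτ
  rw [h4 (hμ.mem_memSet_of_le hδ hs hτ.1 hτ.2), Pi.smul_apply]

theorem eq_zero_of_hasMemDeriv_zero (hμ : IsMemoryKernel μ δ) (hδ : 0 < δ) {ζ : L2mem μ E}
    (h : HasMemDeriv 0 ζ) : ζ = 0 := by
  have h0 : ∀ᵐ s, s ∈ memSet μ → (0 : L2mem μ E) s = 0 :=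
    hμ.ae_iff.1 (Lp.coeFn_zero E 2 (memMeasure μ))
  have := hμ.isOpen_memSet.ae_eq_zero_of_integral_contDiff_smul_eq_zero
    (hμ.locallyIntegrableOn hδ (Lp.memLp ζ)) fun φ hφ hφc hφP => by
      have h1 := h.1 φ hφ hφc hφP
      have hd : tsupport (deriv φ) ⊆ memSet μ := tsupport_deriv_subset.trans hφP
      rw [integral_Ioi_test hd, integral_Ioi_test hφP, integral_test_congr hd h0] at h1
      simpa using h1.symm
  rw [Lp.eq_zero_iff_ae_eq_zero]
  exact hμ.ae_iff.2 this

/-- Differentiation in the memory variable is accretive. -/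
theorem inner_nonneg_of_hasMemDeriv (hμ : IsMemoryKernel μ δ) (hδ : 0 < δ) {η ζ : L2mem μ E}
    (h : HasMemDeriv η ζ) : 0 ≤ inner ℝ ζ η := by
  rw [hμ.hasMemDeriv_iff hδ] at h
  rw [L2.inner_def]
  refine hμ.integral_nonneg_of_forall hδ (L2.integrable_inner ζ η) fun r hr => ?_
  -- The weight is `μ` itself; rate `0` suffices because `μ' ≤ 0`.
  have h1 := mul_integral_weight_norm_sq_le (l := 0) hr.1
    (hμ.intervalIntegrable hδ (Lp.memLp ζ) hr) (hμ.continuousOn.mono Icc_subset_Ici_self)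
    hμ.contDiffOn hr.2.le (fun s hs => by
      have := hμ.deriv_nonpos hδ hs
      linarith)
  rw [zero_mul] at h1
  refine h1.trans_eq (intervalIntegral.integral_congr_ae ?_)
  filter_upwards [h] with s h2 hs
  rw [uIoc_of_le hr.1.le] at hs
  rw [h2 (hμ.mem_memSet_of_le hδ hr hs.1 hs.2), real_inner_comm]

/-- The resolvent of differentiation in the memory variable. -/
theorem exists_memory_resolvent (hμ : IsMemoryKernel μ δ) (hδ : 0 < δ) {l : ℝ} (hl : 0 < l)
    (g : L2mem μ E) : ∃ η : L2mem μ E, HasMemDeriv η (g - l • η) ∧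
      ∀ᵐ s, s ∈ memSet μ → η s = Real.exp (-l * s) • ∫ τ in (0 : ℝ)..s, Real.exp (l * τ) • g τ := by
  have hg : ∀ r ∈ memSet μ, IntervalIntegrable g volume 0 r := fun r hr =>
    hμ.intervalIntegrable hδ (Lp.memLp g) hr
  have hec : Continuous fun τ : ℝ => Real.exp (l * τ) := by fun_prop
  have heg : ∀ r ∈ memSet μ, IntervalIntegrable (fun τ => Real.exp (l * τ) • g τ) volume 0 r :=
    fun r hr => (hg r hr).continuousOn_smul hec.continuousOn
  set Z : ℝ → E := fun s => ∫ τ in (0 : ℝ)..s, Real.exp (l * τ) • g τ with hZ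
  set Y : ℝ → E := fun s => Real.exp (-l * s) • Z s with hY
  have hem : ContDiff ℝ 1 fun s : ℝ => Real.exp (-l * s) := by fun_prop
  have hYc : ∀ r ∈ memSet μ, ContinuousOn Y (Icc 0 r) := fun r hr =>
    hem.continuous.continuousOn.smul (continuousOn_primitive_Icc heg hr)
  have hYeq : ∀ r ∈ memSet μ, Y r = ∫ s in (0 : ℝ)..r, (g s - l • Y s) := by
    intro r hr
    have hYi : IntervalIntegrable Y volume 0 r :=
      ContinuousOn.intervalIntegrable_of_Icc hr.1.le (hYc r hr)
    -- The exponential is shifted by its value at `r` so that the boundary term at `r` vanishes.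
    have h1 := integral_deriv_smul_primitive (heg r hr)
      (φ := fun s => Real.exp (-l * s) - Real.exp (-l * r)) (hem.sub contDiff_const) (sub_self _)
    have hd : ∀ s, deriv (fun s => Real.exp (-l * s) - Real.exp (-l * r)) s
        = -l * Real.exp (-l * s) := fun s => by
      have := (((hasDerivAt_id s).const_mul (-l)).exp.sub_const (Real.exp (-l * r))).deriv
      simp only [id, mul_one] at this
      rw [this, mul_comm]
    have e1 : ∫ s in (0 : ℝ)..r, deriv (fun s => Real.exp (-l * s) - Real.exp (-l * r)) s •
        (∫ τ in (0 : ℝ)..s, Real.exp (l * τ) • g τ) = -(l • ∫ s in (0 : ℝ)..r, Y s) := by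
      rw [← neg_smul, ← intervalIntegral.integral_smul]
      refine intervalIntegral.integral_congr fun s _ => ?_
      simp only [hd, hY, hZ, mul_smul]
    have e2 : ∫ s in (0 : ℝ)..r, (Real.exp (-l * s) - Real.exp (-l * r)) • Real.exp (l * s) • g s
        = (∫ s in (0 : ℝ)..r, g s) - Y r := by
      simp only [hY, hZ]
      rw [← intervalIntegral.integral_smul, ← intervalIntegral.integral_sub (hg r hr)
        (show IntervalIntegrable (fun s => Real.exp (-l * r) • Real.exp (l * s) • g s) volume 0 r
          from (heg r hr).smul _)]
      refine intervalIntegral.integral_congr fun s _ => ?_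
      simp only [sub_smul]
      simp only [smul_smul, ← Real.exp_add]
      simp
    rw [e1, e2, neg_sub] at h1
    rw [intervalIntegral.integral_sub (hg r hr)
      (show IntervalIntegrable (fun s => l • Y s) volume 0 r from hYi.smul l), intervalIntegral.integral_smul,
      sub_eq_add_neg, h1]
    abel
  have hYcm : ContinuousOn Y (memSet μ) :=
    hem.continuous.continuousOn.smul (hμ.continuousOn_primitive_memSet heg)
  have hYsq : ∀ r ∈ memSet μ, IntervalIntegrable (fun s => μ s * ‖Y s‖ ^ 2) volume 0 r :=
    fun r hr => ContinuousOn.intervalIntegrable_of_Icc hr.1.le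
      ((hμ.continuousOn.mono Icc_subset_Ici_self).mul ((hYc r hr).norm.pow 2))
  have hgsq : IntegrableOn (fun s => μ s * ‖g s‖ ^ 2) (Ioi 0) :=
    (hμ.integrable_iff _).1 ((memLp_two_iff_integrable_sq_norm (Lp.aestronglyMeasurable g)).1
      (Lp.memLp g))
  -- With weight `μ e^{-2ls}` the energy inequality reads `l ∫ μ ‖Y‖² ≤ ∫ μ (Y, g)`. Young's
  -- inequality then gives `∫ μ ‖Y‖² ≤ l⁻² ∫ μ ‖g‖²`, uniformly in `r`.
  have hYL : MemLp Y 2 (memMeasure μ) := by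
    refine hμ.memLp_of_forall hδ hYcm (B := (∫ s in Ioi 0, μ s * ‖g s‖ ^ 2) / l ^ 2)
      (fun r hr => ?_) fun r hr => (hYsq r hr).1
    have hρd : ∀ s > 0, HasDerivAt (fun s => μ s * Real.exp (-(2 * l) * s))
        (deriv μ s * Real.exp (-(2 * l) * s) + μ s * (Real.exp (-(2 * l) * s) * (-(2 * l)))) s := by
      intro s hs
      have d1 : HasDerivAt μ (deriv μ s) s :=
        ((hμ.contDiffOn.differentiableOn (by norm_num) s hs).differentiableAt
          (Ioi_mem_nhds hs)).hasDerivAt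
      have d2 := ((hasDerivAt_id s).const_mul (-(2 * l))).exp
      simp only [id, mul_one] at d2
      exact d1.mul d2
    have h1 := mul_integral_weight_norm_sq_le (l := l)
      (ρ := fun s => μ s * Real.exp (-(2 * l) * s)) hr.1 (heg r hr)
      ((hμ.continuousOn.mono Icc_subset_Ici_self).mul (by fun_prop))
      (hμ.contDiffOn.mul (ContDiff.contDiffOn (by fun_prop)))
      (mul_nonneg hr.2.le (Real.exp_nonneg _)) (fun s hs => by
        rw [(hρd s hs).deriv]
        have := mul_nonpos_of_nonpos_of_nonneg (hμ.deriv_nonpos hδ hs)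
          (Real.exp_nonneg (-(2 * l) * s))
        linarith)
    have e0 : ∀ s, Real.exp (-(2 * l) * s) = Real.exp (-l * s) ^ 2 := fun s => by
      rw [← Real.exp_nat_mul]; congr 1; push_cast; ring
    have e1 : ∀ s, μ s * Real.exp (-(2 * l) * s) * ‖Z s‖ ^ 2 = μ s * ‖Y s‖ ^ 2 := fun s => by
      simp only [hY]
      rw [norm_smul, Real.norm_of_nonneg (Real.exp_nonneg _), mul_pow, e0, mul_assoc]
    have e2 : ∀ s, μ s * Real.exp (-(2 * l) * s) * inner ℝ (Z s) (Real.exp (l * s) • g s)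
        = μ s * inner ℝ (Y s) (g s) := fun s => by
      simp only [hY]
      rw [inner_smul_left, inner_smul_right, conj_trivial, mul_assoc, ← mul_assoc (Real.exp _),
        ← Real.exp_add]
      congr 3; ring
    change l * (∫ s in (0 : ℝ)..r, μ s * Real.exp (-(2 * l) * s) * ‖Z s‖ ^ 2) ≤
      ∫ s in (0 : ℝ)..r, μ s * Real.exp (-(2 * l) * s) *
        inner ℝ (Z s) (Real.exp (l * s) • g s) at h1
    simp only [e1, e2] at h1
    have hgr : IntervalIntegrable (fun s => μ s * ‖g s‖ ^ 2) volume 0 r := by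
      rw [intervalIntegrable_iff_integrableOn_Ioc_of_le hr.1.le]
      exact hgsq.mono_set Ioc_subset_Ioi_self
    have hm : ContinuousOn μ (Icc 0 r) := hμ.continuousOn.mono Icc_subset_Ici_self
    have hgi : IntervalIntegrable (fun s => μ s * inner ℝ (Y s) (g s)) volume 0 r := by
      have h3 : IntervalIntegrable (fun s => (μ s * ‖Y s‖) * ‖g s‖) volume 0 r :=
        (hg r hr).norm.continuousOn_mul (by
          rw [uIcc_of_le hr.1.le]; exact hm.mul (hYc r hr).norm)
      refine h3.mono_fun ?_ ?_
      · rw [uIoc_of_le hr.1.le]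
        have hs : MeasurableSet (Ioc 0 r) := measurableSet_Ioc
        refine ((hm.mono Ioc_subset_Icc_self).aestronglyMeasurable hs).mul ?_
        exact AEStronglyMeasurable.inner
          (((hYc r hr).mono Ioc_subset_Icc_self).aestronglyMeasurable hs)
          (hg r hr).1.aestronglyMeasurable
      · refine Eventually.of_forall fun s => ?_
        simp only [norm_mul, norm_norm, mul_assoc]
        exact mul_le_mul_of_nonneg_left (norm_inner_le_norm _ _) (norm_nonneg _)
    have h2 : ∫ s in (0 : ℝ)..r, μ s * inner ℝ (Y s) (g s)
        ≤ ∫ s in (0 : ℝ)..r, (l / 2 * (μ s * ‖Y s‖ ^ 2) + 1 / (2 * l) * (μ s * ‖g s‖ ^ 2)) := by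
      refine intervalIntegral.integral_mono_on hr.1.le hgi
        (((hYsq r hr).const_mul _).add (hgr.const_mul _)) fun s hs => ?_
      have hμs : 0 ≤ μ s := hr.2.le.trans (hμ.antitoneOn hδ hs.1 hr.1.le hs.2)
      have h4 : inner ℝ (Y s) (g s) ≤ l / 2 * ‖Y s‖ ^ 2 + 1 / (2 * l) * ‖g s‖ ^ 2 := by
        refine (real_inner_le_norm _ _).trans ?_
        have h5 : l / 2 * ‖Y s‖ ^ 2 + 1 / (2 * l) * ‖g s‖ ^ 2 - ‖Y s‖ * ‖g s‖
            = (l * ‖Y s‖ - ‖g s‖) ^ 2 / (2 * l) := by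
          field_simp; ring
        have h6 : 0 ≤ (l * ‖Y s‖ - ‖g s‖) ^ 2 / (2 * l) := by positivity
        linarith
      calc _ ≤ μ s * (l / 2 * ‖Y s‖ ^ 2 + 1 / (2 * l) * ‖g s‖ ^ 2) :=
            mul_le_mul_of_nonneg_left h4 hμs
        _ = _ := by ring
    rw [intervalIntegral.integral_add ((hYsq r hr).const_mul _) (hgr.const_mul _),
      intervalIntegral.integral_const_mul, intervalIntegral.integral_const_mul] at h2
    have h3 : ∫ s in (0 : ℝ)..r, μ s * ‖g s‖ ^ 2 ≤ ∫ s in Ioi 0, μ s * ‖g s‖ ^ 2 := by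
      rw [intervalIntegral.integral_of_le hr.1.le]
      refine setIntegral_mono_set hgsq ?_ (Eventually.of_forall Ioc_subset_Ioi_self)
      exact (ae_restrict_iff' measurableSet_Ioi).2 (Eventually.of_forall fun s hs =>
        mul_nonneg (hμ.nonneg s hs) (sq_nonneg _))
    rw [← intervalIntegral.integral_of_le hr.1.le, le_div_iff₀ (by positivity)]
    have h7 : 1 / (2 * l) * (∫ s in (0 : ℝ)..r, μ s * ‖g s‖ ^ 2)
        ≤ 1 / (2 * l) * ∫ s in Ioi 0, μ s * ‖g s‖ ^ 2 :=
      mul_le_mul_of_nonneg_left h3 (by positivity)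
    have h8 : l / 2 * (∫ s in (0 : ℝ)..r, μ s * ‖Y s‖ ^ 2)
        ≤ 1 / (2 * l) * ∫ s in Ioi 0, μ s * ‖g s‖ ^ 2 := by linarith
    have h9 := mul_le_mul_of_nonneg_left h8 (show 0 ≤ 2 * l by positivity)
    have h10 : 2 * l * (1 / (2 * l) * ∫ s in Ioi 0, μ s * ‖g s‖ ^ 2)
        = ∫ s in Ioi 0, μ s * ‖g s‖ ^ 2 := by field_simp
    rw [h10] at h9
    calc _ = 2 * l * (l / 2 * ∫ s in (0 : ℝ)..r, μ s * ‖Y s‖ ^ 2) := by ring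
      _ ≤ _ := h9
  have hηY := hμ.ae_iff.1 hYL.coeFn_toLp
  refine ⟨hYL.toLp Y, (hμ.hasMemDeriv_iff hδ).2 ?_, hηY⟩
  filter_upwards [hηY] with s h1 hs
  rw [h1 hs, hYeq s hs]
  refine intervalIntegral.integral_congr_ae ?_
  filter_upwards [hηY, hμ.ae_iff.1 (Lp.coeFn_sub g (l • hYL.toLp Y)),
    hμ.ae_iff.1 (Lp.coeFn_smul l (hYL.toLp Y))] with τ h2 h3 h4 hτ
  rw [uIoc_of_le hs.1.le] at hτ
  have hm := hμ.mem_memSet_of_le hδ hs hτ.1 hτ.2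
  rw [h3 hm, Pi.sub_apply, h4 hm, Pi.smul_apply, h2 hm]

end IsMemoryKernel

end MemoryDerivative

/-! ### Means of memories and their response to a constant forcing. -/

section MemoryMean

variable {E : Type*} [NormedAddCommGroup E] [InnerProductSpace ℝ E] {μ : ℝ → ℝ} {δ : ℝ}

/-- The integral `∫ μ(s) η(s) ds`. -/
def memMean (η : L2mem μ E) : E := ∫ s, η s ∂memMeasure μ

namespace IsMemoryKernel

omit [InnerProductSpace ℝ E] in
theorem integrable_coe (hμ : IsMemoryKernel μ δ) (η : L2mem μ E) : Integrable η (memMeasure μ) := by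
  have := hμ.isFiniteMeasure
  exact (Lp.memLp η).integrable (by norm_num)

theorem memMean_congr (hμ : IsMemoryKernel μ δ) {η : L2mem μ E} {g : ℝ → E}
    (h : ∀ᵐ s, s ∈ memSet μ → η s = g s) : memMean η = ∫ s, g s ∂memMeasure μ :=
  integral_congr_ae (hμ.ae_iff.2 h)

theorem memMean_add (hμ : IsMemoryKernel μ δ) (η η' : L2mem μ E) :
    memMean (η + η') = memMean η + memMean η' := by
  rw [memMean, integral_congr_ae (Lp.coeFn_add η η')]
  exact integral_add (hμ.integrable_coe η) (hμ.integrable_coe η')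

theorem memMean_smul (c : ℝ) (η : L2mem μ E) : memMean (c • η) = c • memMean η := by
  rw [memMean, integral_congr_ae (Lp.coeFn_smul c η)]
  exact integral_smul c _

omit [InnerProductSpace ℝ E] in
/-- The constant function with value `w` in the weighted space. -/
theorem exists_const (hμ : IsMemoryKernel μ δ) (w : E) :
    ∃ k : L2mem μ E, k =ᵐ[memMeasure μ] fun _ => w := by
  have := hμ.isFiniteMeasure
  exact ⟨Lp.const 2 _ w, Lp.coeFn_const 2 _ w⟩

variable [CompleteSpace E]

theorem inner_memMean (hμ : IsMemoryKernel μ δ) (η : L2mem μ E) (w : E) :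
    inner ℝ w (memMean η) = ∫ s, inner ℝ w (η s) ∂memMeasure μ :=
  ((innerSL ℝ w).integral_comp_comm (hμ.integrable_coe η)).symm

/-- The forcing terms `w` and `v` in the memory equations enter the dissipation through this
pairing, which cancels the memory integrals in the other equations. -/
theorem inner_const (hμ : IsMemoryKernel μ δ) {k : L2mem μ E} {w : E}
    (hk : k =ᵐ[memMeasure μ] fun _ => w) (η : L2mem μ E) :
    inner ℝ k η = inner ℝ w (memMean η) := by
  rw [hμ.inner_memMean, L2.inner_def]
  refine integral_congr_ae ?_
  filter_upwards [hk] with s hs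
  rw [hs]

/-- It replaces the integrals in the dual spaces by Riesz functionals of the mean. -/
theorem integral_smul_innerSL (hμ : IsMemoryKernel μ δ) (η : L2mem μ E) :
    ∫ s in Ioi 0, μ s • innerSL ℝ (η s) = innerSL ℝ (memMean η) := by
  rw [← hμ.integral_eq fun s => innerSL ℝ (η s)]
  exact (innerSL ℝ : E →L[ℝ] E →L[ℝ] ℝ).integral_comp_comm (hμ.integrable_coe η)

/-- The resolvent of the memory variable driven by a constant, and the mean of the solution. -/
theorem exists_memory_response (hμ : IsMemoryKernel μ δ) (hδ : 0 < δ) {l : ℝ} (hl : 0 < l) :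
    ∃ c : ℝ, 0 ≤ c ∧ ((∃ s > 0, μ s ≠ 0) → 0 < c) ∧ ∀ f : L2mem μ E, ∃ m₀ : E, ∀ w : E,
      ∃ η ζ : L2mem μ E, HasMemDeriv η ζ ∧ memMean η = c • w + m₀ ∧
        (l • η - f : L2mem μ E) =ᵐ[memMeasure μ] fun s => -ζ s + w := by
  -- The solution of `l κ + κ' = 1`, `κ 0 = 0`. The response to the constant `w` is `κ • w`, so `c =
  -- ∫ μ κ`.
  set κ : ℝ → ℝ := fun s => (1 - Real.exp (-l * s)) / l with hκ
  have hκ0 : ∀ s, 0 ≤ s → 0 ≤ κ s := fun s hs => by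
    refine div_nonneg (sub_nonneg.2 (Real.exp_le_one_iff.2 ?_)) hl.le
    nlinarith
  have hκle : ∀ s, 0 ≤ s → κ s ≤ 1 / l := fun s _ => by
    refine div_le_div_of_nonneg_right ?_ hl.le
    linarith [Real.exp_nonneg (-l * s)]
  have hκc : Continuous κ := by fun_prop
  have hκi : IntegrableOn (fun s => μ s * κ s) (Ioi 0) := by
    refine Integrable.mono' (hμ.integrableOn.norm.mul_const (1 / l))
      (hμ.integrableOn.aestronglyMeasurable.mul hκc.aestronglyMeasurable) ?_
    refine (ae_restrict_iff' measurableSet_Ioi).2 (Eventually.of_forall fun s hs => ?_)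
    rw [norm_mul, Real.norm_of_nonneg (hκ0 s (le_of_lt hs))]
    exact mul_le_mul_of_nonneg_left (hκle s (le_of_lt hs)) (norm_nonneg _)
  have hnn : ∀ s ∈ Ioi (0 : ℝ), 0 ≤ μ s * κ s := fun s hs =>
    mul_nonneg (hμ.nonneg s hs) (hκ0 s (le_of_lt hs))
  refine ⟨∫ s in Ioi 0, μ s * κ s, setIntegral_nonneg measurableSet_Ioi hnn, ?_, fun f => ?_⟩
  · rintro ⟨s, hs, hne⟩
    have hsP : s ∈ memSet μ := ⟨hs, lt_of_le_of_ne (hμ.nonneg s hs) hne.symm⟩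
    rw [setIntegral_pos_iff_support_of_nonneg_ae
      ((ae_restrict_iff' measurableSet_Ioi).2 (Eventually.of_forall hnn)) hκi]
    -- Strict positivity: `κ > 0` on `(0, ∞)`, and the set where `μ > 0` is open and nonempty, so it
    -- has positive measure.
    have hsub : memSet μ ⊆ Function.support (fun s => μ s * κ s) ∩ Ioi 0 := fun r hr => by
      refine ⟨mul_ne_zero hr.2.ne' (div_ne_zero (sub_ne_zero.2 ?_) hl.ne'), hr.1⟩
      exact (Real.exp_lt_one_iff.2 (mul_neg_of_neg_of_pos (neg_lt_zero.2 hl) hr.1)).ne'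
    exact (hμ.isOpen_memSet.measure_pos volume ⟨s, hsP⟩).trans_le (measure_mono hsub)
  · obtain ⟨η₀, hη₀, -⟩ := hμ.exists_memory_resolvent hδ hl f
    refine ⟨memMean η₀, fun w => ?_⟩
    obtain ⟨k, hk⟩ := hμ.exists_const w
    obtain ⟨ηw, hηw, hf⟩ := hμ.exists_memory_resolvent hδ hl k
    -- Superposition: `ηw` responds to `w`, while `η₀` responds to the datum `f` and contributes
    -- only the constant `m₀`.
    refine ⟨ηw + η₀, _, hμ.hasMemDeriv_add hδ hηw hη₀, ?_, ?_⟩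
    · rw [hμ.memMean_add]
      congr 1
      have h1 : ∀ᵐ s, s ∈ memSet μ → ηw s = κ s • w := by
        filter_upwards [hf] with s h1 hs
        rw [h1 hs]
        have h2 : ∫ τ in (0 : ℝ)..s, Real.exp (l * τ) • k τ
            = ∫ τ in (0 : ℝ)..s, Real.exp (l * τ) • w := by
          refine intervalIntegral.integral_congr_ae ?_
          filter_upwards [hμ.ae_iff.1 hk] with τ h3 hτ
          rw [uIoc_of_le hs.1.le] at hτ
          rw [h3 (hμ.mem_memSet_of_le hδ hs hτ.1 hτ.2)]
        have h4 : ∫ τ in (0 : ℝ)..s, Real.exp (l * τ) = (Real.exp (l * s) - 1) / l := by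
          rw [intervalIntegral.integral_comp_mul_left (fun x => Real.exp x) hl.ne', integral_exp]
          simp [div_eq_inv_mul]
        rw [h2, intervalIntegral.integral_smul_const, h4, smul_smul]
        congr 1
        simp only [hκ]
        rw [← mul_div_assoc, mul_sub, ← Real.exp_add]
        simp
      rw [hμ.memMean_congr h1, hμ.integral_eq]
      simp only [smul_smul]
      exact integral_smul_const _ w
    · have e : l • (ηw + η₀) - f = -(k - l • ηw + (f - l • η₀)) + k := by
        rw [smul_add]; abel
      rw [e]
      filter_upwards [Lp.coeFn_add (-(k - l • ηw + (f - l • η₀))) k,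
        Lp.coeFn_neg (k - l • ηw + (f - l • η₀)), hk] with s h1 h2 h3
      rw [h1, Pi.add_apply, h2, Pi.neg_apply, h3]

end IsMemoryKernel

end MemoryMean

/-! ### The reduced stationary problem. -/

section LaxMilgram

variable {F₁ F₂ H : Type*} [NormedAddCommGroup F₁] [InnerProductSpace ℝ F₁] [CompleteSpace F₁]
  [NormedAddCommGroup F₂] [InnerProductSpace ℝ F₂] [CompleteSpace F₂]
  [NormedAddCommGroup H] [InnerProductSpace ℝ H]

/-- Solvability of a pair of variational equations with a skew-symmetric coupling. -/
theorem exists_coupled_solution (J₁ A₁ : F₁ →L[ℝ] H) (J₂ : F₂ →L[ℝ] H) {l b₁ b₂ : ℝ} (ν : ℝ)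
    (hl : 0 ≤ l) (hb₁ : 0 < b₁) (hb₂ : 0 < b₂) (L₁ : F₁ →L[ℝ] ℝ) (L₂ : F₂ →L[ℝ] ℝ) :
    ∃ (w : F₁) (v : F₂),
      (∀ φ, l * inner ℝ (J₁ w) (J₁ φ) + b₁ * inner ℝ w φ - ν * inner ℝ (J₂ v) (A₁ φ) = L₁ φ) ∧
      ∀ ψ, l * inner ℝ (J₂ v) (J₂ ψ) + b₂ * inner ℝ v ψ + ν * inner ℝ (A₁ w) (J₂ ψ) = L₂ ψ := by
  let p₁ : WithLp 2 (F₁ × F₂) →L[ℝ] F₁ := WithLp.fstL 2 ℝ F₁ F₂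
  let p₂ : WithLp 2 (F₁ × F₂) →L[ℝ] F₂ := WithLp.sndL 2 ℝ F₁ F₂
  let B : WithLp 2 (F₁ × F₂) →L[ℝ] WithLp 2 (F₁ × F₂) →L[ℝ] ℝ :=
    l • (innerSL ℝ).bilinearComp (J₁.comp p₁) (J₁.comp p₁) + b₁ • (innerSL ℝ).bilinearComp p₁ p₁
      - ν • (innerSL ℝ).bilinearComp (J₂.comp p₂) (A₁.comp p₁)
      + l • (innerSL ℝ).bilinearComp (J₂.comp p₂) (J₂.comp p₂)
      + b₂ • (innerSL ℝ).bilinearComp p₂ p₂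
      + ν • (innerSL ℝ).bilinearComp (A₁.comp p₁) (J₂.comp p₂)
  have hB : ∀ x y, B x y = l * inner ℝ (J₁ x.fst) (J₁ y.fst) + b₁ * inner ℝ x.fst y.fst
      - ν * inner ℝ (J₂ x.snd) (A₁ y.fst) + l * inner ℝ (J₂ x.snd) (J₂ y.snd)
      + b₂ * inner ℝ x.snd y.snd + ν * inner ℝ (A₁ x.fst) (J₂ y.snd) := fun x y => rfl
  -- On the diagonal the two `ν`-terms cancel, so neither the sign nor the size of the coupling
  -- matters.
  have hco : IsCoercive B := by
    refine ⟨min b₁ b₂, lt_min hb₁ hb₂, fun x => ?_⟩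
    rw [hB, real_inner_comm (J₂ x.snd) (A₁ x.fst)]
    simp only [real_inner_self_eq_norm_sq]
    have h1 : ‖x‖ * ‖x‖ = ‖x.fst‖ ^ 2 + ‖x.snd‖ ^ 2 := by
      rw [← pow_two, WithLp.prod_norm_sq_eq_of_L2]
    have h2 : min b₁ b₂ * ‖x.fst‖ ^ 2 ≤ b₁ * ‖x.fst‖ ^ 2 :=
      mul_le_mul_of_nonneg_right (min_le_left _ _) (sq_nonneg _)
    have h3 : min b₁ b₂ * ‖x.snd‖ ^ 2 ≤ b₂ * ‖x.snd‖ ^ 2 :=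
      mul_le_mul_of_nonneg_right (min_le_right _ _) (sq_nonneg _)
    have h4 : 0 ≤ l * ‖J₁ x.fst‖ ^ 2 := by positivity
    have h5 : 0 ≤ l * ‖J₂ x.snd‖ ^ 2 := by positivity
    rw [mul_assoc, h1, mul_add]
    linarith
  let z := hco.continuousLinearEquivOfBilin.symm
    ((InnerProductSpace.toDual ℝ (WithLp 2 (F₁ × F₂))).symm (L₁.comp p₁ + L₂.comp p₂))
  have hz : ∀ y, B z y = L₁ y.fst + L₂ y.snd := fun y => by
    rw [← hco.continuousLinearEquivOfBilin_apply, ContinuousLinearEquiv.apply_symm_apply,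
      InnerProductSpace.toDual_symm_apply]
    rfl
  refine ⟨z.fst, z.snd, fun φ => ?_, fun ψ => ?_⟩
  · have := hz (WithLp.toLp 2 (φ, 0))
    rw [hB] at this
    simpa using this
  · have := hz (WithLp.toLp 2 (0, ψ))
    rw [hB] at this
    simpa using this

end LaxMilgram

/-! ### Change to an equivalent norm. -/

section Conjugation

variable {X : Type*} [NormedAddCommGroup X] [InnerProductSpace ℝ X] [CompleteSpace X]

/-- A relation which becomes maximal dissipative after a linear change of variables is the
generator of a bounded semigroup. -/
theorem exists_semigroup_of_conj (T : X ≃L[ℝ] X) {G : X → X → Prop}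
    (hG : IsMaxDissipative fun x y => G (T.symm x) (T.symm y)) :
    ∃ (S : ℝ → X →L[ℝ] X) (C : ℝ), IsC0Semigroup S ∧ IsBddSemigroup S C ∧ IsGenerator G S ∧
      Dense {x | ∃ y, G x y} := by
  obtain ⟨S, hS, hgen, hcontr, hneg⟩ := hG.exists_semigroup
  -- Contractivity holds only after the change of variables; undoing it costs the condition number
  -- of `T`.
  let C : ℝ := ‖(T.symm : X →L[ℝ] X)‖ * ‖(T : X →L[ℝ] X)‖
  have hC : 0 ≤ C := by positivity
  let S' : ℝ → X →L[ℝ] X := fun t =>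
    (T.symm : X →L[ℝ] X).comp ((S t).comp (T : X →L[ℝ] X))
  have hS'a : ∀ t x, S' t x = T.symm (S t (T x)) := fun t x => rfl
  have hbound : ∀ t x, ‖S' t x‖ ≤ C * ‖x‖ := fun t x => by
    calc ‖S' t x‖ ≤ ‖(T.symm : X →L[ℝ] X)‖ * ‖S t (T x)‖ :=
          (T.symm : X →L[ℝ] X).le_opNorm _
      _ ≤ ‖(T.symm : X →L[ℝ] X)‖ * (‖(T : X →L[ℝ] X)‖ * ‖x‖) := by
          gcongr
          exact (hcontr t _).trans ((T : X →L[ℝ] X).le_opNorm x)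
      _ = C * ‖x‖ := by simp only [C]; ring
  have hC0 : IsC0Semigroup S' := by
    refine ⟨?_, fun s hs t ht => ?_, fun x => ?_⟩
    · ext x
      rw [hS'a, hS.zero]
      simp
    · ext x
      rw [hS'a, hS.add s hs t ht]
      simp [hS'a]
    · have := (T.symm.continuous.tendsto _).comp (hS.tendsto (T x))
      rwa [T.symm_apply_apply] at this
  have hneg' : ∀ t, S' t = S' (max t 0) := fun t => by
    ext x
    rw [hS'a, hS'a, hneg t]
  refine ⟨S', C, hC0, ⟨hC0.zero, hC0.add, ?_, hC, hbound⟩, fun x y => ?_, ?_⟩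
  · exact continuous_semigroup hC0.zero hC0.add (fun t _ => hbound t) hneg' hC0.tendsto
  · have h1 := hgen (T x) (T y)
    simp only [ContinuousLinearEquiv.symm_apply_apply] at h1
    rw [h1]
    have e : ∀ h : ℝ, h⁻¹ • (S' h x - x) = T.symm (h⁻¹ • (S h (T x) - T x)) := fun h => by
      simp [hS'a]
    simp only [e]
    constructor
    · intro h
      have := (T.symm.continuous.tendsto _).comp h
      rwa [T.symm_apply_apply] at this
    · intro h
      have := (T.continuous.tendsto _).comp h
      refine this.congr fun r => T.apply_symm_apply _
  · have h := T.symm.surjective.denseRange.dense_image T.symm.continuous hG.dense_domain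
    refine h.mono ?_
    rintro _ ⟨x, ⟨y, hy⟩, rfl⟩
    exact ⟨T.symm y, hy⟩

end Conjugation

/-! ### Maximal dissipativity of the linear operator. -/

section PhaseSpace

variable {H : Type*} [NormedAddCommGroup H] [InnerProductSpace ℝ H] [CompleteSpace H]
  {A : SpectralOperator H} {μ₁ μ₂ : ℝ → ℝ}

theorem SpectralOperator.e_mem_powDomain (A : SpectralOperator H) (s : ℝ) (k : ℕ) :
    A.e k ∈ A.powDomain s := by
  refine summable_of_ne_finset_zero (s := {k}) fun j hj => ?_
  rw [A.e.orthonormal.2 (fun h => hj (by simp [h]))]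
  simp

/-- The eigenvectors belong to every `F_s` and form a Hilbert basis. -/
theorem SpectralOperator.eq_zero_of_inner_toH (A : SpectralOperator H) (s : ℝ) {z : H}
    (h : ∀ φ : A.F s, inner ℝ z (A.toH s φ) = 0) : z = 0 := by
  apply A.e.repr.injective
  ext k
  have := h (A.ofMem (A.e_mem_powDomain s k))
  rw [A.toH_ofMem, real_inner_comm] at this
  simp [A.e.repr_apply_apply, this]

theorem Phase.inner_eq (U V : Phase A μ₁ μ₂) :
    inner ℝ U V = inner ℝ (Phase.u U) (Phase.u V) + inner ℝ (Phase.w U) (Phase.w V)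
      + inner ℝ (Phase.v U) (Phase.v V) + inner ℝ (Phase.η₁ U) (Phase.η₁ V)
      + inner ℝ (Phase.η₂ U) (Phase.η₂ V) := by
  simp only [WithLp.prod_inner_apply, add_assoc]
  rfl

theorem Phase.norm_sq_eq (U : Phase A μ₁ μ₂) :
    ‖U‖ ^ 2 = ‖Phase.u U‖ ^ 2 + ‖Phase.w U‖ ^ 2 + ‖Phase.v U‖ ^ 2 + ‖Phase.η₁ U‖ ^ 2
      + ‖Phase.η₂ U‖ ^ 2 := by
  simp only [← real_inner_self_eq_norm_sq, Phase.inner_eq]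

/-- Multiplication of the displacement by a constant. -/
def Phase.scale (A : SpectralOperator H) (μ₁ μ₂ : ℝ → ℝ) {c : ℝ} (hc : c ≠ 0) :
    Phase A μ₁ μ₂ ≃L[ℝ] Phase A μ₁ μ₂ :=
  (WithLp.prodContinuousLinearEquiv 2 ℝ (A.F 1) _).trans
    (((ContinuousLinearEquiv.smulLeft (Units.mk0 c hc)).prodCongr
      (ContinuousLinearEquiv.refl ℝ _)).trans
      (WithLp.prodContinuousLinearEquiv 2 ℝ (A.F 1) _).symm)

theorem Phase.scale_u {c : ℝ} (hc : c ≠ 0) (U : Phase A μ₁ μ₂) :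
    Phase.u (Phase.scale A μ₁ μ₂ hc U) = c • Phase.u U := rfl
theorem Phase.scale_w {c : ℝ} (hc : c ≠ 0) (U : Phase A μ₁ μ₂) :
    Phase.w (Phase.scale A μ₁ μ₂ hc U) = Phase.w U := rfl
theorem Phase.scale_v {c : ℝ} (hc : c ≠ 0) (U : Phase A μ₁ μ₂) :
    Phase.v (Phase.scale A μ₁ μ₂ hc U) = Phase.v U := rfl
theorem Phase.scale_η₁ {c : ℝ} (hc : c ≠ 0) (U : Phase A μ₁ μ₂) :
    Phase.η₁ (Phase.scale A μ₁ μ₂ hc U) = Phase.η₁ U := rfl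
theorem Phase.scale_η₂ {c : ℝ} (hc : c ≠ 0) (U : Phase A μ₁ μ₂) :
    Phase.η₂ (Phase.scale A μ₁ μ₂ hc U) = Phase.η₂ U := rfl

theorem Phase.ext_components {U V : Phase A μ₁ μ₂} (hu : Phase.u U = Phase.u V)
    (hw : Phase.w U = Phase.w V) (hv : Phase.v U = Phase.v V) (h₁ : Phase.η₁ U = Phase.η₁ V)
    (h₂ : Phase.η₂ U = Phase.η₂ V) : U = V := by
  rw [← sub_eq_zero, ← norm_eq_zero, ← sq_eq_zero_iff, Phase.norm_sq_eq]
  have e1 : Phase.u (U - V) = 0 := sub_eq_zero.2 hu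
  have e2 : Phase.w (U - V) = 0 := sub_eq_zero.2 hw
  have e3 : Phase.v (U - V) = 0 := sub_eq_zero.2 hv
  have e4 : Phase.η₁ (U - V) = 0 := sub_eq_zero.2 h₁
  have e5 : Phase.η₂ (U - V) = 0 := sub_eq_zero.2 h₂
  simp [e1, e2, e3, e4, e5]

/-- The conditions in the dual spaces become variational identities against `φ` and `ψ`; the
representatives in `H` are eliminated in favour of the components of `V`. -/
theorem lGraph_iff {β ν ω δ₁ δ₂ : ℝ} (hμ₁ : IsMemoryKernel μ₁ δ₁) (hμ₂ : IsMemoryKernel μ₂ δ₂)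
    {U V : Phase A μ₁ μ₂} : LGraph A β ν ω μ₁ μ₂ U V ↔
    ∃ (w : A.F 1) (v : A.F (1 / 2)) (ζ₁ : L2mem μ₁ (A.F 1)) (ζ₂ : L2mem μ₂ (A.F (1 / 2))),
      A.toH 1 w = Phase.w U ∧ A.toH (1 / 2) v = Phase.v U ∧
      HasMemDeriv (Phase.η₁ U) ζ₁ ∧ HasMemDeriv (Phase.η₂ U) ζ₂ ∧
      (∀ φ : A.F 1, β * inner ℝ (Phase.u U) φ + inner ℝ (memMean (Phase.η₁ U)) φ
        - ν * inner ℝ (Phase.v U) (A.pow 1 φ) = -inner ℝ (Phase.w V) (A.toH 1 φ)) ∧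
      (∀ ψ : A.F (1 / 2), ω * inner ℝ v ψ + inner ℝ (memMean (Phase.η₂ U)) ψ
        = -inner ℝ (Phase.v V + ν • A.pow 1 w) (A.toH (1 / 2) ψ)) ∧
      Phase.u V = w ∧ (Phase.η₁ V =ᵐ[memMeasure μ₁] fun s => -ζ₁ s + w) ∧
      (Phase.η₂ V =ᵐ[memMeasure μ₂] fun s => -ζ₂ s + v) := by
  have := A.completeSpace_F zero_le_one
  have := A.completeSpace_F one_half_pos.le
  have i₁ : (∫ s in Ioi 0, μ₁ s • A.powNeg 1 (Phase.η₁ U s)) = innerSL ℝ (memMean (Phase.η₁ U)) :=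
    hμ₁.integral_smul_innerSL _
  have i₂ : (∫ s in Ioi 0, μ₂ s • A.powNeg (1 / 2) (Phase.η₂ U s))
      = innerSL ℝ (memMean (Phase.η₂ U)) := hμ₂.integral_smul_innerSL _
  unfold LGraph
  rw [i₁, i₂]
  constructor
  · rintro ⟨w, v, ζ₁, ζ₂, x, y, h1, h2, h3, h4, h5, h6, h7, h8, h9, h10, h11⟩
    refine ⟨w, v, ζ₁, ζ₂, h1, h2, h3, h4, fun φ => ?_, fun ψ => ?_, h7, h10, h11⟩
    · rw [h8, inner_neg_left, neg_neg]
      exact DFunLike.congr_fun h5 φ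
    · rw [h9, sub_add_cancel, inner_neg_left, neg_neg]
      exact DFunLike.congr_fun h6 ψ
  · rintro ⟨w, v, ζ₁, ζ₂, h1, h2, h3, h4, h5, h6, h7, h10, h11⟩
    refine ⟨w, v, ζ₁, ζ₂, -Phase.w V, -(Phase.v V + ν • A.pow 1 w), h1, h2, h3, h4, ?_, ?_, h7,
      (neg_neg _).symm, by rw [neg_neg, add_sub_cancel_right], h10, h11⟩
    · ext φ
      refine (h5 φ).trans ?_
      rw [← inner_neg_left]
      rfl
    · ext ψ
      refine (h6 ψ).trans ?_
      rw [← inner_neg_left]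
      rfl

/-- The scaling turns `‖u‖_1²` into `β ‖u‖_1²`, the weight for which the elastic term cancels
against `u' = w`. The range condition comes from the reduced problem for `(w, v)`. -/
theorem isMaxDissipative_lGraph {β ν ω δ₁ δ₂ : ℝ} (hβ : 0 < β) (hω : 0 ≤ ω) (hδ₁ : 0 < δ₁)
    (hδ₂ : 0 < δ₂) (hμ₁ : IsMemoryKernel μ₁ δ₁) (hμ₂ : IsMemoryKernel μ₂ δ₂)
    (hωμ : 0 < ω ∨ ∃ s > 0, μ₂ s ≠ 0) :
    IsMaxDissipative fun U V : Phase A μ₁ μ₂ =>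
      LGraph A β ν ω μ₁ μ₂ ((Phase.scale A μ₁ μ₂ (Real.sqrt_pos.2 hβ).ne').symm U)
        ((Phase.scale A μ₁ μ₂ (Real.sqrt_pos.2 hβ).ne').symm V) := by
  have := A.completeSpace_F zero_le_one
  have := A.completeSpace_F one_half_pos.le
  set T := Phase.scale A μ₁ μ₂ (Real.sqrt_pos.2 hβ).ne' with hT
  refine ⟨fun {U V U' V'} h h' => ?_, fun c U V h => ?_, fun {V} h => ?_, fun {U V} h => ?_,
    fun l hl Z => ?_⟩
  · rw [map_add, map_add]
    generalize T.symm U = U, T.symm V = V, T.symm U' = U', T.symm V' = V' at *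
    rw [lGraph_iff hμ₁ hμ₂] at *
    obtain ⟨w, v, ζ₁, ζ₂, h1, h2, h3, h4, h5, h6, h7, h10, h11⟩ := h
    obtain ⟨w', v', ζ₁', ζ₂', h1', h2', h3', h4', h5', h6', h7', h10', h11'⟩ := h'
    refine ⟨w + w', v + v', ζ₁ + ζ₁', ζ₂ + ζ₂', ?_, ?_, hμ₁.hasMemDeriv_add hδ₁ h3 h3',
      hμ₂.hasMemDeriv_add hδ₂ h4 h4', fun φ => ?_, fun ψ => ?_, ?_, ?_, ?_⟩
    · rw [map_add, h1, h1']; rfl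
    · rw [map_add, h2, h2']; rfl
    · change β * inner ℝ (Phase.u U + Phase.u U') φ
        + inner ℝ (memMean (Phase.η₁ U + Phase.η₁ U')) φ
        - ν * inner ℝ (Phase.v U + Phase.v U') (A.pow 1 φ)
        = -inner ℝ (Phase.w V + Phase.w V') (A.toH 1 φ)
      rw [hμ₁.memMean_add]
      simp only [inner_add_left]
      linear_combination h5 φ + h5' φ
    · change ω * inner ℝ (v + v') ψ + inner ℝ (memMean (Phase.η₂ U + Phase.η₂ U')) ψ
        = -inner ℝ (Phase.v V + Phase.v V' + ν • A.pow 1 (w + w')) (A.toH (1 / 2) ψ)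
      rw [hμ₂.memMean_add]
      have e := h6 ψ
      have e' := h6' ψ
      simp only [inner_add_left, map_add, smul_add] at e e' ⊢
      linear_combination e + e'
    · rw [← h7, ← h7']; rfl
    · filter_upwards [h10, h10', Lp.coeFn_add (Phase.η₁ V) (Phase.η₁ V'), Lp.coeFn_add ζ₁ ζ₁']
        with s a1 a2 a3 a4
      refine a3.trans ?_
      rw [a4, Pi.add_apply, Pi.add_apply, a1, a2]; abel
    · filter_upwards [h11, h11', Lp.coeFn_add (Phase.η₂ V) (Phase.η₂ V'), Lp.coeFn_add ζ₂ ζ₂']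
        with s a1 a2 a3 a4
      refine a3.trans ?_
      rw [a4, Pi.add_apply, Pi.add_apply, a1, a2]; abel
  · rw [map_smul, map_smul]
    generalize T.symm U = U, T.symm V = V at *
    rw [lGraph_iff hμ₁ hμ₂] at *
    obtain ⟨w, v, ζ₁, ζ₂, h1, h2, h3, h4, h5, h6, h7, h10, h11⟩ := h
    refine ⟨c • w, c • v, c • ζ₁, c • ζ₂, ?_, ?_, hμ₁.hasMemDeriv_smul hδ₁ c h3,
      hμ₂.hasMemDeriv_smul hδ₂ c h4, fun φ => ?_, fun ψ => ?_, ?_, ?_, ?_⟩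
    · rw [map_smul, h1]; rfl
    · rw [map_smul, h2]; rfl
    · change β * inner ℝ (c • Phase.u U) φ + inner ℝ (memMean (c • Phase.η₁ U)) φ
        - ν * inner ℝ (c • Phase.v U) (A.pow 1 φ) = -inner ℝ (c • Phase.w V) (A.toH 1 φ)
      rw [IsMemoryKernel.memMean_smul]
      simp only [real_inner_smul_left]
      linear_combination c * h5 φ
    · change ω * inner ℝ (c • v) ψ + inner ℝ (memMean (c • Phase.η₂ U)) ψ
        = -inner ℝ (c • Phase.v V + ν • A.pow 1 (c • w)) (A.toH (1 / 2) ψ)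
      rw [IsMemoryKernel.memMean_smul]
      have e := h6 ψ
      simp only [inner_add_left, map_smul, real_inner_smul_left] at e ⊢
      linear_combination c * e
    · rw [← h7]; rfl
    · filter_upwards [h10, Lp.coeFn_smul c (Phase.η₁ V), Lp.coeFn_smul c ζ₁] with s a1 a2 a3
      refine a2.trans ?_
      rw [a3, Pi.smul_apply, Pi.smul_apply, a1, smul_add, smul_neg]
    · filter_upwards [h11, Lp.coeFn_smul c (Phase.η₂ V), Lp.coeFn_smul c ζ₂] with s a1 a2 a3
      refine a2.trans ?_
      rw [a3, Pi.smul_apply, Pi.smul_apply, a1, smul_add, smul_neg]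
  · rw [map_zero] at h
    suffices h0 : T.symm V = 0 by simpa using h0
    generalize T.symm V = V at *
    rw [lGraph_iff hμ₁ hμ₂] at h
    obtain ⟨w, v, ζ₁, ζ₂, h1, h2, h3, h4, h5, h6, h7, h10, h11⟩ := h
    have hw : w = 0 := A.toH_injective 1 (h1.trans (map_zero _).symm)
    have hv : v = 0 := A.toH_injective (1 / 2) (h2.trans (map_zero _).symm)
    have hz₁ : ζ₁ = 0 := hμ₁.eq_zero_of_hasMemDeriv_zero hδ₁ h3
    have hz₂ : ζ₂ = 0 := hμ₂.eq_zero_of_hasMemDeriv_zero hδ₂ h4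
    subst hw hv hz₁ hz₂
    have m₁ : memMean (Phase.η₁ (0 : Phase A μ₁ μ₂)) = 0 := by
      have := IsMemoryKernel.memMean_smul (0 : ℝ) (Phase.η₁ (0 : Phase A μ₁ μ₂))
      rw [zero_smul, zero_smul] at this
      exact this
    have m₂ : memMean (Phase.η₂ (0 : Phase A μ₁ μ₂)) = 0 := by
      have := IsMemoryKernel.memMean_smul (0 : ℝ) (Phase.η₂ (0 : Phase A μ₁ μ₂))
      rw [zero_smul, zero_smul] at this
      exact this
    have u0 : Phase.u (0 : Phase A μ₁ μ₂) = 0 := rfl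
    have v0 : Phase.v (0 : Phase A μ₁ μ₂) = 0 := rfl
    rw [m₁, u0, v0] at h5
    rw [m₂] at h6
    refine Phase.ext_components h7 (A.eq_zero_of_inner_toH 1 fun φ => ?_)
      (A.eq_zero_of_inner_toH (1 / 2) fun ψ => ?_) ?_ ?_
    · simpa using (h5 φ).symm
    · simpa using (h6 ψ).symm
    · refine (Lp.eq_zero_iff_ae_eq_zero (f := Phase.η₁ V)).2 ?_
      filter_upwards [h10, Lp.coeFn_zero (A.F 1) 2 (memMeasure μ₁)] with s a1 a2
      rw [a1, a2]; simp
    · refine (Lp.eq_zero_iff_ae_eq_zero (f := Phase.η₂ V)).2 ?_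
      filter_upwards [h11, Lp.coeFn_zero (A.F (1 / 2)) 2 (memMeasure μ₂)] with s a1 a2
      rw [a1, a2]; simp
  · obtain ⟨U, rfl⟩ := T.surjective U
    obtain ⟨V, rfl⟩ := T.surjective V
    rw [T.symm_apply_apply, T.symm_apply_apply, lGraph_iff hμ₁ hμ₂] at h
    obtain ⟨w, v, ζ₁, ζ₂, h1, h2, h3, h4, h5, h6, h7, h10, h11⟩ := h
    rw [Phase.inner_eq]
    simp only [hT, Phase.scale_u, Phase.scale_w, Phase.scale_v, Phase.scale_η₁, Phase.scale_η₂,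
      real_inner_smul_left, real_inner_smul_right]
    have q : √β * (√β * inner ℝ (Phase.u V) (Phase.u U)) = β * inner ℝ (Phase.u U) w := by
      rw [← mul_assoc, Real.mul_self_sqrt hβ.le, h7, real_inner_comm]
    obtain ⟨k₁, hk₁⟩ := hμ₁.exists_const w
    obtain ⟨k₂, hk₂⟩ := hμ₂.exists_const v
    have e₁ : Phase.η₁ V = -ζ₁ + k₁ := by
      apply Lp.ext
      filter_upwards [h10, hk₁, Lp.coeFn_add (-ζ₁) k₁, Lp.coeFn_neg ζ₁] with s a1 a2 a3 a4
      rw [a1, a3, Pi.add_apply, a4, a2, Pi.neg_apply]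
    have e₂ : Phase.η₂ V = -ζ₂ + k₂ := by
      apply Lp.ext
      filter_upwards [h11, hk₂, Lp.coeFn_add (-ζ₂) k₂, Lp.coeFn_neg ζ₂] with s a1 a2 a3 a4
      rw [a1, a3, Pi.add_apply, a4, a2, Pi.neg_apply]
    rw [q, e₁, e₂, inner_add_left, inner_add_left, hμ₁.inner_const hk₁, hμ₂.inner_const hk₂,
      inner_neg_left, inner_neg_left, real_inner_comm (memMean _) w,
      real_inner_comm (memMean _) v]
    -- Testing with the velocity and the temperature themselves cancels the coupling and the memory
    -- means; `ω ‖v‖²` and the two accretive memory terms remain.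
    have a5 := h5 w
    have a6 := h6 v
    rw [h1] at a5
    rw [h2, inner_add_left, real_inner_smul_left, real_inner_self_eq_norm_sq] at a6
    have a7 := hμ₁.inner_nonneg_of_hasMemDeriv hδ₁ h3
    have a8 := hμ₂.inner_nonneg_of_hasMemDeriv hδ₂ h4
    have a9 : 0 ≤ ω * ‖v‖ ^ 2 := by positivity
    rw [real_inner_comm (Phase.v U) (A.pow 1 w)] at a6
    linarith
  · obtain ⟨F, rfl⟩ := T.surjective Z
    obtain ⟨c₁, hc₁, -, hres₁⟩ := hμ₁.exists_memory_response (E := A.F 1) hδ₁ hl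
    obtain ⟨c₂, hc₂, hc₂', hres₂⟩ := hμ₂.exists_memory_response (E := A.F (1 / 2)) hδ₂ hl
    have hb₁ : 0 < β / l + c₁ := by positivity
    -- Coercivity in the temperature comes from instantaneous conduction (`ω > 0`) or from the
    -- memory (`c₂ > 0`).
    have hb₂ : 0 < ω + c₂ := by
      rcases hωμ with h | h
      · linarith
      · linarith [hc₂' h]
    obtain ⟨m₁, hm₁⟩ := hres₁ (Phase.η₁ F)
    obtain ⟨m₂, hm₂⟩ := hres₂ (Phase.η₂ F)
    obtain ⟨w, v, hw, hv⟩ := exists_coupled_solution (A.toHL zero_le_one) (A.powL 1)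
      (A.toHL one_half_pos.le) ν hl.le hb₁ hb₂
      ((innerSL ℝ (Phase.w F)).comp (A.toHL zero_le_one) - (β / l) • innerSL ℝ (Phase.u F)
        - innerSL ℝ m₁)
      ((innerSL ℝ (Phase.v F)).comp (A.toHL one_half_pos.le) - innerSL ℝ m₂)
    obtain ⟨η₁, ζ₁, hη₁, hM₁, hf₁⟩ := hm₁ w
    obtain ⟨η₂, ζ₂, hη₂, hM₂, hf₂⟩ := hm₂ v
    -- The first equation `l u - w = u_F` determines the displacement; inserting it produces the
    -- coefficient `β / l` in the reduced problem.
    let U : Phase A μ₁ μ₂ := Phase.mk (l⁻¹ • (Phase.u F + w)) (A.toH 1 w) (A.toH (1 / 2) v) η₁ η₂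
    refine ⟨T U, T (l • U - F), ?_, by rw [← map_smul, ← map_sub, sub_sub_cancel]⟩
    rw [T.symm_apply_apply, T.symm_apply_apply, lGraph_iff hμ₁ hμ₂]
    refine ⟨w, v, ζ₁, ζ₂, rfl, rfl, hη₁, hη₂, fun φ => ?_, fun ψ => ?_, ?_, hf₁, hf₂⟩
    · change β * inner ℝ (l⁻¹ • (Phase.u F + w)) φ + inner ℝ (memMean η₁) φ
        - ν * inner ℝ (A.toH (1 / 2) v) (A.pow 1 φ)
        = -inner ℝ (l • A.toH 1 w - Phase.w F) (A.toH 1 φ)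
      have e : l * inner ℝ (A.toH 1 w) (A.toH 1 φ) + (β / l + c₁) * inner ℝ w φ
        - ν * inner ℝ (A.toH (1 / 2) v) (A.pow 1 φ) = inner ℝ (Phase.w F) (A.toH 1 φ)
          - (β / l) * inner ℝ (Phase.u F) φ - inner ℝ m₁ φ := hw φ
      rw [hM₁]
      simp only [inner_add_left, inner_sub_left, real_inner_smul_left]
      linear_combination e
    · change ω * inner ℝ v ψ + inner ℝ (memMean η₂) ψ
        = -inner ℝ (l • A.toH (1 / 2) v - Phase.v F + ν • A.pow 1 w) (A.toH (1 / 2) ψ)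
      have e : l * inner ℝ (A.toH (1 / 2) v) (A.toH (1 / 2) ψ) + (ω + c₂) * inner ℝ v ψ
        + ν * inner ℝ (A.pow 1 w) (A.toH (1 / 2) ψ) = inner ℝ (Phase.v F) (A.toH (1 / 2) ψ)
          - inner ℝ m₂ ψ := hv ψ
      rw [hM₂]
      simp only [inner_add_left, inner_sub_left, real_inner_smul_left]
      linear_combination e
    · change l • l⁻¹ • (Phase.u F + w) - Phase.u F = w
      rw [smul_inv_smul₀ hl.ne', add_sub_cancel_left]

end PhaseSpace

/-! ### Smoothness and local Lipschitz continuity of the nonlinearity. -/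

section Nonlinearity

variable {H : Type*} [NormedAddCommGroup H] [InnerProductSpace ℝ H] [CompleteSpace H]

namespace SpectralOperator

variable (A : SpectralOperator H)

theorem powDomain_antitone : Antitone A.powDomain := fun r s h v hv => by
  refine Summable.of_nonneg_of_le (fun k => mul_nonneg (Real.rpow_nonneg (A.lam_pos k).le _)
    (sq_nonneg _)) (fun k => ?_) (Summable.mul_left (A.lam 0 ^ (2 * (r - s))) hv)
  rw [← mul_assoc]
  exact mul_le_mul_of_nonneg_right (A.lam_rpow_le h k) (sq_nonneg _)

theorem toH_incl {r s : ℝ} (h : r ≤ s) (u : A.F s) : A.toH r (A.incl h u) = A.toH s u :=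
  Submodule.coe_inclusion (A.powDomain_antitone h) u

theorem inner_pow_incl {r s : ℝ} (h : r ≤ s) (hrs : r + r = s) (u w : A.F s) :
    inner ℝ (A.pow r (A.incl h u)) (A.pow r (A.incl h w)) = inner ℝ (A.pow s u) (A.toH s w) := by
  subst hrs
  refine (A.hasSum_inner' _ _).unique ?_
  convert A.hasSum_inner' (A.pow (r + r) u) (A.toH (r + r) w) using 2 with k
  rw [A.inner_pow_e, A.inner_pow_e, A.inner_pow_e, A.toH_incl, A.toH_incl,
    Real.rpow_add (A.lam_pos k)]
  ring

theorem inner_pow_half (u w : A.F 1) :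
    inner ℝ (A.pow (1 / 2) (A.incl one_half_lt_one.le u))
      (A.pow (1 / 2) (A.incl one_half_lt_one.le w)) = inner ℝ (A.pow 1 u) (A.toH 1 w) :=
  A.inner_pow_incl one_half_lt_one.le (add_halves 1) u w

/-- Interpolation: `‖A^{1/2} u‖² = (A u, u)` and Cauchy–Schwarz. It shows that the argument of `M`
is of lower order. -/
theorem norm_pow_half_sq_le (u : A.F 1) :
    ‖A.pow (1 / 2) (A.incl one_half_lt_one.le u)‖ ^ 2 ≤ ‖u‖ * ‖A.toH 1 u‖ := by
  rw [← real_inner_self_eq_norm_sq, inner_pow_half, A.norm_F]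
  exact real_inner_le_norm _ _

/-- The power `A^{1/2}` as a continuous map on `F_1`. -/
def halfPow : A.F 1 →L[ℝ] H :=
  (A.pow (1 / 2) ∘ₗ A.incl one_half_lt_one.le).mkContinuous √(A.lam 0 ^ (-1 : ℝ)) fun u => by
    have h := A.norm_toH_le zero_le_one u
    have h0 : 0 ≤ A.lam 0 ^ (-1 : ℝ) := Real.rpow_nonneg A.lam_zero_pos.le _
    refine abs_le_of_sq_le_sq' ?_ (by positivity) |>.2
    rw [mul_pow, Real.sq_sqrt h0]
    refine (A.norm_pow_half_sq_le u).trans ?_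
    nlinarith [norm_nonneg u]

theorem inner_halfPow (u w : A.F 1) :
    inner ℝ (A.halfPow u) (A.halfPow w) = inner ℝ (A.pow 1 u) (A.toH 1 w) := A.inner_pow_half u w

theorem norm_halfPow_sq_le (u : A.F 1) : ‖A.halfPow u‖ ^ 2 ≤ ‖u‖ * ‖A.toH 1 u‖ :=
  A.norm_pow_half_sq_le u

end SpectralOperator

variable (A : SpectralOperator H) (μ₁ μ₂ : ℝ → ℝ)

/-- The displacement as a continuous map. -/
def Phase.uL : Phase A μ₁ μ₂ →L[ℝ] A.F 1 := WithLp.fstL 2 ℝ _ _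

/-- The embedding of the velocity component. -/
def Phase.ofVelocity : H →ₗᵢ[ℝ] Phase A μ₁ μ₂ where
  toFun z := Phase.mk 0 z 0 0 0
  map_add' x y := Phase.ext_components (add_zero _).symm rfl (add_zero _).symm (add_zero _).symm
    (add_zero _).symm
  map_smul' c x := Phase.ext_components (smul_zero _).symm rfl (smul_zero _).symm
    (smul_zero _).symm (smul_zero _).symm
  norm_map' x := by
    refine (sq_eq_sq₀ (norm_nonneg _) (norm_nonneg _)).1 ?_
    rw [Phase.norm_sq_eq]
    change ‖(0 : A.F 1)‖ ^ 2 + ‖x‖ ^ 2 + ‖(0 : H)‖ ^ 2 + ‖(0 : L2mem μ₁ (A.F 1))‖ ^ 2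
      + ‖(0 : L2mem μ₂ (A.F (1 / 2)))‖ ^ 2 = _
    simp

variable {A μ₁ μ₂}

theorem Phase.norm_u_le (U : Phase A μ₁ μ₂) : ‖Phase.u U‖ ≤ ‖U‖ := by
  refine abs_le_of_sq_le_sq' ?_ (norm_nonneg _) |>.2
  rw [Phase.norm_sq_eq]
  nlinarith [sq_nonneg ‖Phase.w U‖, sq_nonneg ‖Phase.v U‖, sq_nonneg ‖Phase.η₁ U‖,
    sq_nonneg ‖Phase.η₂ U‖]

variable {M : ℝ → ℝ} {p : H}

theorem nonlin_eq (U : Phase A μ₁ μ₂) : nonlin A μ₁ μ₂ M p U =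
    Phase.ofVelocity A μ₁ μ₂ (-(M (‖A.halfPow (Phase.uL A μ₁ μ₂ U)‖ ^ 2) •
      A.powL 1 (Phase.uL A μ₁ μ₂ U)) + p) := rfl

/-- The squared norm is smooth on a Hilbert space and takes values in `[0, ∞)`, the set on which `M`
is known to be `C¹`. -/
theorem contDiff_nonlin (hM : ContDiffOn ℝ 1 M (Ici 0)) : ContDiff ℝ 1 (nonlin A μ₁ μ₂ M p) := by
  have h1 : ContDiff ℝ 1 fun U : Phase A μ₁ μ₂ => ‖A.halfPow (Phase.uL A μ₁ μ₂ U)‖ ^ 2 :=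
    ((A.halfPow.contDiff.comp (Phase.uL A μ₁ μ₂).contDiff)).norm_sq ℝ
  have h2 : ContDiff ℝ 1 fun U : Phase A μ₁ μ₂ => M (‖A.halfPow (Phase.uL A μ₁ μ₂ U)‖ ^ 2) :=
    hM.comp_contDiff h1 fun U => mem_Ici.2 (sq_nonneg _)
  have h3 : ContDiff ℝ 1 fun U : Phase A μ₁ μ₂ => A.powL 1 (Phase.uL A μ₁ μ₂ U) :=
    (A.powL 1).contDiff.comp (Phase.uL A μ₁ μ₂).contDiff
  exact (Phase.ofVelocity A μ₁ μ₂).contDiff.comp ((h2.smul h3).neg.add contDiff_const)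

/-- In infinite dimensions `C¹` does not bound the derivative on balls. Here the argument of `M`
stays in the compact interval `[0, (k R)²]`, where `M` is bounded and Lipschitz. -/
theorem exists_lipschitz_nonlin (hM : ContDiffOn ℝ 1 M (Ici 0)) (R : ℝ) :
    ∃ K ≥ 0, ∀ U V : Phase A μ₁ μ₂, ‖U‖ ≤ R → ‖V‖ ≤ R →
      ‖nonlin A μ₁ μ₂ M p U - nonlin A μ₁ μ₂ M p V‖ ≤ K * ‖U - V‖ := by
  rcases lt_or_ge R 0 with hR | hR
  · exact ⟨0, le_rfl, fun U V hU => absurd ((norm_nonneg U).trans hU) (not_le.2 hR)⟩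
  obtain ⟨k, hk0, hk⟩ : ∃ k ≥ 0, ∀ u, ‖A.halfPow u‖ ≤ k * ‖u‖ :=
    ⟨_, A.halfPow.opNorm_nonneg, A.halfPow.le_opNorm⟩
  have hMc : ContDiffOn ℝ 1 M (Icc 0 ((k * R) ^ 2)) := hM.mono Icc_subset_Ici_self
  obtain ⟨B, hB⟩ := isCompact_Icc.exists_bound_of_continuousOn hMc.continuousOn
  obtain ⟨K, hK⟩ := hMc.exists_lipschitzOnWith one_ne_zero (convex_Icc _ _) isCompact_Icc
  have hB0 : 0 ≤ B := (norm_nonneg _).trans (hB 0 ⟨le_rfl, by positivity⟩)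
  have hh : ∀ U : Phase A μ₁ μ₂, ‖A.halfPow (Phase.u U)‖ ≤ k * ‖U‖ := fun U =>
    (hk _).trans (mul_le_mul_of_nonneg_left (Phase.norm_u_le U) hk0)
  have hmem : ∀ U : Phase A μ₁ μ₂, ‖U‖ ≤ R →
      ‖A.halfPow (Phase.u U)‖ ^ 2 ∈ Icc 0 ((k * R) ^ 2) := fun U hU =>
    ⟨sq_nonneg _, by
      gcongr
      exact (hh U).trans (by gcongr)⟩
  refine ⟨K * (2 * k * k * R) * R + B, by positivity, fun U V hU hV => ?_⟩
  rw [nonlin_eq, nonlin_eq, ← map_sub, LinearIsometry.norm_map]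
  change ‖-(M (‖A.halfPow (Phase.u U)‖ ^ 2) • A.pow 1 (Phase.u U)) + p
    - (-(M (‖A.halfPow (Phase.u V)‖ ^ 2) • A.pow 1 (Phase.u V)) + p)‖ ≤ _
  have e : -(M (‖A.halfPow (Phase.u U)‖ ^ 2) • A.pow 1 (Phase.u U)) + p
      - (-(M (‖A.halfPow (Phase.u V)‖ ^ 2) • A.pow 1 (Phase.u V)) + p)
      = -((M (‖A.halfPow (Phase.u U)‖ ^ 2) - M (‖A.halfPow (Phase.u V)‖ ^ 2)) • A.pow 1 (Phase.u U)
        + M (‖A.halfPow (Phase.u V)‖ ^ 2) • A.pow 1 (Phase.u U - Phase.u V)) := by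
    rw [map_sub, sub_smul, smul_sub]; abel
  rw [e, norm_neg]
  have hq : |‖A.halfPow (Phase.u U)‖ ^ 2 - ‖A.halfPow (Phase.u V)‖ ^ 2|
      ≤ 2 * k * k * R * ‖U - V‖ := by
    have h1 : |‖A.halfPow (Phase.u U)‖ - ‖A.halfPow (Phase.u V)‖| ≤ k * ‖U - V‖ := by
      refine (abs_norm_sub_norm_le _ _).trans ?_
      rw [← map_sub]
      exact hh (U - V)
    have h2 : |‖A.halfPow (Phase.u U)‖ + ‖A.halfPow (Phase.u V)‖| ≤ 2 * k * R := by
      rw [abs_of_nonneg (by positivity)]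
      have := (hh U).trans (mul_le_mul_of_nonneg_left hU hk0)
      have := (hh V).trans (mul_le_mul_of_nonneg_left hV hk0)
      linarith
    rw [sq_sub_sq, abs_mul]
    calc _ ≤ 2 * k * R * (k * ‖U - V‖) := mul_le_mul h2 h1 (abs_nonneg _) (by positivity)
      _ = _ := by ring
  have hMq := hK.dist_le_mul _ (hmem U hU) _ (hmem V hV)
  rw [Real.dist_eq, Real.dist_eq] at hMq
  refine (norm_add_le _ _).trans ?_
  rw [norm_smul, norm_smul, ← A.norm_F, ← A.norm_F, Real.norm_eq_abs, add_mul]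
  gcongr ?_ + ?_
  · calc _ ≤ (K * (2 * k * k * R * ‖U - V‖)) * R := by
          gcongr
          · exact hMq.trans (mul_le_mul_of_nonneg_left hq K.2)
          · exact (Phase.norm_u_le U).trans hU
      _ = _ := by ring
  · exact mul_le_mul (hB _ (hmem V hV)) (Phase.norm_u_le (U - V)) (norm_nonneg _) hB0

end Nonlinearity

/-! ### The energy and the a priori bound. -/

section Energy

variable {H : Type*} [NormedAddCommGroup H] [InnerProductSpace ℝ H] [CompleteSpace H]
  {A : SpectralOperator H} {μ₁ μ₂ : ℝ → ℝ} {β ν ω δ₁ δ₂ : ℝ}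

variable (A μ₁ μ₂) in
/-- The displacement as an element of `H`. -/
def Phase.displ : Phase A μ₁ μ₂ →L[ℝ] H := (A.toHL zero_le_one).comp (Phase.uL A μ₁ μ₂)

/-- The energy of a state, with potential `P` and a lower order correction. -/
def Phase.energy (hβ : 0 < β) (K : ℝ) (P : ℝ → ℝ) (p : H) (U : Phase A μ₁ μ₂) : ℝ :=
  ‖Phase.scale A μ₁ μ₂ (Real.sqrt_pos.2 hβ).ne' U‖ ^ 2
    + P (‖A.halfPow (Phase.uL A μ₁ μ₂ U)‖ ^ 2) - 2 * inner ℝ p (Phase.displ A μ₁ μ₂ U)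
    + K * ‖Phase.displ A μ₁ μ₂ U‖ ^ 2

theorem Phase.norm_scale_sq (hβ : 0 < β) (U : Phase A μ₁ μ₂) :
    ‖Phase.scale A μ₁ μ₂ (Real.sqrt_pos.2 hβ).ne' U‖ ^ 2 = β * ‖Phase.u U‖ ^ 2 + ‖Phase.w U‖ ^ 2
      + ‖Phase.v U‖ ^ 2 + ‖Phase.η₁ U‖ ^ 2 + ‖Phase.η₂ U‖ ^ 2 := by
  rw [Phase.norm_sq_eq, Phase.scale_u, Phase.scale_w, Phase.scale_v, Phase.scale_η₁,
    Phase.scale_η₂, norm_smul, mul_pow, Real.norm_eq_abs, sq_abs, Real.sq_sqrt hβ.le]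

/-- By interpolation and Young, `a ‖A^{1/2} u‖²` costs `β / 2` of the elastic energy and `a² / (2
β)` of the correction. Of the extra `2 ‖u‖²`, one half absorbs `2 (p, u)` and the other survives on
the left. -/
theorem Phase.le_energy (hβ : 0 < β) {a b : ℝ} (ha : 0 ≤ a) {P : ℝ → ℝ}
    (hP : ∀ z ≥ 0, -a * z - b ≤ P z) (p : H) (U : Phase A μ₁ μ₂) :
    β / 2 * ‖Phase.u U‖ ^ 2 + ‖Phase.w U‖ ^ 2 + ‖Phase.v U‖ ^ 2 + ‖Phase.η₁ U‖ ^ 2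
      + ‖Phase.η₂ U‖ ^ 2 + ‖Phase.displ A μ₁ μ₂ U‖ ^ 2
      ≤ Phase.energy hβ (a ^ 2 / (2 * β) + 2) P p U + ‖p‖ ^ 2 + b := by
  rw [Phase.energy, Phase.norm_scale_sq hβ]
  have h1 := hP _ (sq_nonneg ‖A.halfPow (Phase.uL A μ₁ μ₂ U)‖)
  have h2 : ‖A.halfPow (Phase.uL A μ₁ μ₂ U)‖ ^ 2 ≤ ‖Phase.u U‖ * ‖Phase.displ A μ₁ μ₂ U‖ :=
    A.norm_halfPow_sq_le (Phase.u U)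
  have h3 := mul_le_mul_of_nonneg_left h2 ha
  have h4 : a * (‖Phase.u U‖ * ‖Phase.displ A μ₁ μ₂ U‖)
      ≤ β / 2 * ‖Phase.u U‖ ^ 2 + a ^ 2 / (2 * β) * ‖Phase.displ A μ₁ μ₂ U‖ ^ 2 := by
    have e : β / 2 * ‖Phase.u U‖ ^ 2 + a ^ 2 / (2 * β) * ‖Phase.displ A μ₁ μ₂ U‖ ^ 2
        - a * (‖Phase.u U‖ * ‖Phase.displ A μ₁ μ₂ U‖)
        = (β * ‖Phase.u U‖ - a * ‖Phase.displ A μ₁ μ₂ U‖) ^ 2 / (2 * β) := by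
      field_simp
      ring
    have := div_nonneg (sq_nonneg (β * ‖Phase.u U‖ - a * ‖Phase.displ A μ₁ μ₂ U‖))
      (by positivity : 0 ≤ 2 * β)
    linarith
  have h5 := real_inner_le_norm p (Phase.displ A μ₁ μ₂ U)
  have h6 := sq_nonneg (‖p‖ - ‖Phase.displ A μ₁ μ₂ U‖)
  nlinarith

/-- Along a classical solution the derivative of the energy is of lower order. -/
theorem Phase.hasDerivAt_energy (hβ : 0 < β) (hω : 0 ≤ ω) (hδ₁ : 0 < δ₁) (hδ₂ : 0 < δ₂)
    (hμ₁ : IsMemoryKernel μ₁ δ₁) (hμ₂ : IsMemoryKernel μ₂ δ₂) (hωμ : 0 < ω ∨ ∃ s > 0, μ₂ s ≠ 0)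
    {K : ℝ} (hK : 0 ≤ K) {M P : ℝ → ℝ} (hP : ∀ z ≥ 0, HasDerivAt P (M z) z) {p : H} {t : ℝ}
    {U : ℝ → Phase A μ₁ μ₂} {V : Phase A μ₁ μ₂} (hV : LGraph A β ν ω μ₁ μ₂ (U t) V)
    (hU : HasDerivAt U (V + nonlin A μ₁ μ₂ M p (U t)) t) :
    ∃ E', HasDerivAt (fun τ => Phase.energy hβ K P p (U τ)) E' t ∧
      E' ≤ K * (‖Phase.displ A μ₁ μ₂ (U t)‖ ^ 2 + ‖Phase.w (U t)‖ ^ 2) := by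
  have hdis := (isMaxDissipative_lGraph (A := A) (ν := ν) hβ hω hδ₁ hδ₂ hμ₁ hμ₂ hωμ).dissip
    (x := Phase.scale A μ₁ μ₂ (Real.sqrt_pos.2 hβ).ne' (U t))
    (y := Phase.scale A μ₁ μ₂ (Real.sqrt_pos.2 hβ).ne' V) (by
      rwa [ContinuousLinearEquiv.symm_apply_apply, ContinuousLinearEquiv.symm_apply_apply])
  obtain ⟨w, -, -, -, hw, -, -, -, -, -, hVu, -, -⟩ := (lGraph_iff hμ₁ hμ₂).1 hV
  set T := Phase.scale A μ₁ μ₂ (Real.sqrt_pos.2 hβ).ne'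
  set f := nonlin A μ₁ μ₂ M p (U t)
  have hu : Phase.uL A μ₁ μ₂ (V + f) = w := by
    change Phase.u V + 0 = w
    rw [hVu, add_zero]
  -- Dissipativity in the scaled norm leaves only the work of the force `f`, which acts on the
  -- velocity.
  have hT : inner ℝ (T (U t)) (T (V + f)) ≤ inner ℝ (Phase.w (U t)) (Phase.w f) := by
    rw [map_add, inner_add_right, real_inner_comm]
    have : inner ℝ (T (U t)) (T f) = inner ℝ (Phase.w (U t)) (Phase.w f) := by
      rw [Phase.inner_eq]
      simp only [T, Phase.scale_u, Phase.scale_w, Phase.scale_v, Phase.scale_η₁, Phase.scale_η₂]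
      have e1 : Phase.u f = 0 := rfl
      have e3 : Phase.v f = 0 := rfl
      have e4 : Phase.η₁ f = 0 := rfl
      have e5 : Phase.η₂ f = 0 := rfl
      simp [e1, e3, e4, e5]
    linarith
  have hfw : Phase.w f = -(M (‖A.halfPow (Phase.uL A μ₁ μ₂ (U t))‖ ^ 2) •
      A.pow 1 (Phase.uL A μ₁ μ₂ (U t))) + p := rfl
  rw [hfw, inner_add_right, inner_neg_right, real_inner_smul_right] at hT
  have d1 := ((T : Phase A μ₁ μ₂ →L[ℝ] Phase A μ₁ μ₂).hasFDerivAt.comp_hasDerivAt t hU).norm_sq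
  have d2 := ((A.halfPow.comp (Phase.uL A μ₁ μ₂)).hasFDerivAt.comp_hasDerivAt t hU).norm_sq
  have d3 := (hP (‖A.halfPow (Phase.uL A μ₁ μ₂ (U t))‖ ^ 2) (sq_nonneg _)).comp t d2
  have d4 := (Phase.displ A μ₁ μ₂).hasFDerivAt.comp_hasDerivAt t hU
  have d5 := (innerSL ℝ p).hasFDerivAt.comp_hasDerivAt t d4
  refine ⟨_, ((d1.add d3).sub (d5.const_mul 2)).add (d4.norm_sq.const_mul K), ?_⟩
  have hj : Phase.displ A μ₁ μ₂ (V + f) = Phase.w (U t) := by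
    rw [← hw, ← hu]; rfl
  -- Since `(A^{1/2} u, A^{1/2} w) = (A u, w)`, the derivative of the potential is exactly opposite
  -- to the work of the nonlinear force; likewise for `p`. Only the correction contributes.
  have hh : inner ℝ ((A.halfPow.comp (Phase.uL A μ₁ μ₂)) (U t))
      ((A.halfPow.comp (Phase.uL A μ₁ μ₂)) (V + f))
      = inner ℝ (Phase.w (U t)) (A.pow 1 (Phase.uL A μ₁ μ₂ (U t))) := by
    rw [ContinuousLinearMap.comp_apply, ContinuousLinearMap.comp_apply, hu, A.inner_halfPow, hw,
      real_inner_comm]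
  simp only [Function.comp_apply, hj, hh, innerSL_apply_apply, ContinuousLinearEquiv.coe_coe]
  rw [real_inner_comm (Phase.w (U t)) p]
  have h5 := real_inner_le_norm (Phase.displ A μ₁ μ₂ (U t)) (Phase.w (U t))
  have h6 := sq_nonneg (‖Phase.displ A μ₁ μ₂ (U t)‖ - ‖Phase.w (U t)‖)
  have h7 : 2 * inner ℝ (Phase.displ A μ₁ μ₂ (U t)) (Phase.w (U t))
      ≤ ‖Phase.displ A μ₁ μ₂ (U t)‖ ^ 2 + ‖Phase.w (U t)‖ ^ 2 := by nlinarith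
  have h8 := mul_le_mul_of_nonneg_left h7 hK
  linarith

/-- A differential inequality `g' ≤ K g` in the interior of an interval. -/
theorem le_mul_exp_of_deriv_le {g g' : ℝ → ℝ} {K T : ℝ} (hT : 0 ≤ T)
    (hc : ContinuousOn g (Icc 0 T)) (hd : ∀ t ∈ Ioo 0 T, HasDerivAt g (g' t) t)
    (hle : ∀ t ∈ Ioo 0 T, g' t ≤ K * g t) : g T ≤ g 0 * Real.exp (K * T) := by
  have hd' : ∀ t ∈ Ioo 0 T, HasDerivAt (fun t => g t * Real.exp (-K * t))
      (g' t * Real.exp (-K * t) + g t * (Real.exp (-K * t) * (-K * 1))) t := fun t ht =>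
    (hd t ht).mul ((hasDerivAt_id t).const_mul (-K)).exp
  have hanti : AntitoneOn (fun t => g t * Real.exp (-K * t)) (Icc 0 T) := by
    refine antitoneOn_of_deriv_nonpos (convex_Icc 0 T)
      (hc.mul (Continuous.continuousOn (by fun_prop))) ?_ ?_
    · rw [interior_Icc]
      exact fun t ht => (hd' t ht).differentiableAt.differentiableWithinAt
    · rw [interior_Icc]
      intro t ht
      rw [(hd' t ht).deriv]
      have := mul_nonneg (sub_nonneg.2 (hle t ht)) (Real.exp_nonneg (-K * t))
      linarith
  have h := hanti (left_mem_Icc.2 hT) (right_mem_Icc.2 hT) hT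
  simp only [mul_zero, Real.exp_zero, mul_one] at h
  calc g T = g T * Real.exp (-K * T) * Real.exp (K * T) := by
        rw [mul_assoc, ← Real.exp_add]; simp
    _ ≤ _ := mul_le_mul_of_nonneg_right h (Real.exp_nonneg _)

/-- The a priori bound for classical solutions. -/
theorem exists_apriori_bound (hβ : 0 < β) (hω : 0 ≤ ω) (hδ₁ : 0 < δ₁) (hδ₂ : 0 < δ₂)
    (hμ₁ : IsMemoryKernel μ₁ δ₁) (hμ₂ : IsMemoryKernel μ₂ δ₂) (hωμ : 0 < ω ∨ ∃ s > 0, μ₂ s ≠ 0)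
    {M : ℝ → ℝ} (hM : ContinuousOn M (Ici 0)) {a b : ℝ} (ha : 0 ≤ a)
    (hMab : ∀ z ≥ 0, -a * z - b ≤ ∫ ξ in (0 : ℝ)..z, M ξ) (p : H) (T : ℝ) (ρ : ℝ) :
    ∃ B, ∀ T' ∈ Icc 0 T, ∀ (U₀ : Phase A μ₁ μ₂) (U : ℝ → Phase A μ₁ μ₂), ‖U₀‖ ≤ ρ → U 0 = U₀ →
      ContinuousOn U (Icc 0 T') → (0 < T' → IsClassicalSolution (LGraph A β ν ω μ₁ μ₂)
        (nonlin A μ₁ μ₂ M p) T' U₀ U) → ‖U T'‖ ≤ B := by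
  have hM' : Continuous fun ξ => M (max ξ 0) :=
    hM.comp_continuous (by fun_prop) fun ξ => le_max_right ξ 0
  -- Extending `M` by the constant `M 0` to negative arguments makes its primitive differentiable at
  -- `0` from both sides.
  let P : ℝ → ℝ := fun z => ∫ ξ in (0 : ℝ)..z, M (max ξ 0)
  have hPd : ∀ z, HasDerivAt P (M (max z 0)) z := fun z =>
    (hM'.integral_hasStrictDerivAt 0 z).hasDerivAt
  have hPd' : ∀ z ≥ 0, HasDerivAt P (M z) z := fun z hz => by
    have := hPd z
    rwa [max_eq_left hz] at this
  have hPc : Continuous P := continuous_iff_continuousAt.2 fun z => (hPd z).continuousAt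
  have hPab : ∀ z ≥ 0, -a * z - b ≤ P z := fun z hz => by
    refine (hMab z hz).trans_eq (intervalIntegral.integral_congr fun ξ hξ => ?_)
    rw [uIcc_of_le hz] at hξ
    simp only [max_eq_left hξ.1]
  set K := a ^ 2 / (2 * β) + 2 with hK
  have hK0 : 0 ≤ K := by positivity
  have hEc : Continuous (Phase.energy (A := A) (μ₁ := μ₁) (μ₂ := μ₂) hβ K P p) := by
    unfold Phase.energy
    fun_prop
  obtain ⟨B₀, hB₀⟩ : ∃ B₀, ∀ U : Phase A μ₁ μ₂, ‖U‖ ≤ ρ →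
      Phase.energy hβ K P p U + (‖p‖ ^ 2 + b) ≤ B₀ := by
    rcases lt_or_ge ρ 0 with hρ | hρ
    · exact ⟨0, fun U hU => absurd ((norm_nonneg U).trans hU) (not_le.2 hρ)⟩
    obtain ⟨B₁, hB₁⟩ := (isCompact_Icc (a := 0) (b := (‖A.halfPow.comp (Phase.uL A μ₁ μ₂)‖ * ρ) ^ 2)
      ).exists_bound_of_continuousOn hPc.continuousOn
    refine ⟨(‖(Phase.scale A μ₁ μ₂ (Real.sqrt_pos.2 hβ).ne' :
      Phase A μ₁ μ₂ →L[ℝ] Phase A μ₁ μ₂)‖ * ρ) ^ 2 + B₁ + 2 * (‖p‖ * (‖Phase.displ A μ₁ μ₂‖ * ρ))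
      + K * (‖Phase.displ A μ₁ μ₂‖ * ρ) ^ 2 + (‖p‖ ^ 2 + b), fun U hU => ?_⟩
    have h1 : ‖Phase.scale A μ₁ μ₂ (Real.sqrt_pos.2 hβ).ne' U‖ ≤ _ :=
      (Phase.scale A μ₁ μ₂ (Real.sqrt_pos.2 hβ).ne' :
        Phase A μ₁ μ₂ →L[ℝ] Phase A μ₁ μ₂).le_opNorm_of_le hU
    have h2 := (Phase.displ A μ₁ μ₂).le_opNorm_of_le hU
    have h3 : P (‖A.halfPow (Phase.uL A μ₁ μ₂ U)‖ ^ 2) ≤ B₁ := by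
      refine (le_abs_self _).trans (hB₁ _ ⟨sq_nonneg _, ?_⟩)
      gcongr
      exact (A.halfPow.comp (Phase.uL A μ₁ μ₂)).le_opNorm_of_le hU
    have h4 : -inner ℝ p (Phase.displ A μ₁ μ₂ U) ≤ ‖p‖ * (‖Phase.displ A μ₁ μ₂‖ * ρ) :=
      (neg_le_abs _).trans ((abs_real_inner_le_norm _ _).trans (by gcongr))
    have h5 : ‖Phase.scale A μ₁ μ₂ (Real.sqrt_pos.2 hβ).ne' U‖ ^ 2 ≤ _ :=
      pow_le_pow_left₀ (norm_nonneg _) h1 2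
    have h6 : K * ‖Phase.displ A μ₁ μ₂ U‖ ^ 2 ≤ K * (‖Phase.displ A μ₁ μ₂‖ * ρ) ^ 2 := by gcongr
    rw [Phase.energy]
    linarith
  -- The coercivity constant of the energy with respect to the norm of the phase space, read off
  -- from `Phase.le_energy`.
  set m := min (β / 2) 1 with hm
  have hm0 : 0 < m := lt_min (by positivity) one_pos
  have hlow : ∀ U : Phase A μ₁ μ₂, m * ‖U‖ ^ 2 ≤ Phase.energy hβ K P p U + (‖p‖ ^ 2 + b) ∧
      ‖Phase.displ A μ₁ μ₂ U‖ ^ 2 + ‖Phase.w U‖ ^ 2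
        ≤ Phase.energy hβ K P p U + (‖p‖ ^ 2 + b) := fun U => by
    have h := Phase.le_energy hβ ha hPab p U
    rw [← hK, add_assoc (Phase.energy _ _ _ _ _)] at h
    have h1 : m ≤ β / 2 := min_le_left _ _
    have h2 : m ≤ 1 := min_le_right _ _
    rw [Phase.norm_sq_eq]
    constructor
    · nlinarith [sq_nonneg ‖Phase.u U‖, sq_nonneg ‖Phase.w U‖, sq_nonneg ‖Phase.v U‖,
        sq_nonneg ‖Phase.η₁ U‖, sq_nonneg ‖Phase.η₂ U‖, sq_nonneg ‖Phase.displ A μ₁ μ₂ U‖]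
    · nlinarith [sq_nonneg ‖Phase.u U‖, sq_nonneg ‖Phase.v U‖,
        sq_nonneg ‖Phase.η₁ U‖, sq_nonneg ‖Phase.η₂ U‖]
  refine ⟨√(B₀ * Real.exp (K * T) / m), fun T' hT' U₀ U hU₀ h0 hUc hcl => ?_⟩
  have key : Phase.energy hβ K P p (U T') + (‖p‖ ^ 2 + b)
      ≤ (Phase.energy hβ K P p (U 0) + (‖p‖ ^ 2 + b)) * Real.exp (K * T') := by
    rcases hT'.1.eq_or_lt with hz | hpos
    · rw [← hz]; simp
    obtain ⟨-, U', V, -, hsol⟩ := hcl hpos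
    -- A two-sided derivative is available at interior times only; continuity of the energy takes
    -- care of the endpoints.
    have hd : ∀ t ∈ Ioo 0 T', ∃ E', HasDerivAt (fun τ => Phase.energy hβ K P p (U τ)) E' t ∧
        E' ≤ K * (‖Phase.displ A μ₁ μ₂ (U t)‖ ^ 2 + ‖Phase.w (U t)‖ ^ 2) := fun t ht => by
      obtain ⟨h1, h2, h3⟩ := hsol t ⟨ht.1.le, ht.2⟩
      have h4 := h1.hasDerivAt (Ico_mem_nhds ht.1 ht.2)
      rw [h3] at h4
      exact Phase.hasDerivAt_energy hβ hω hδ₁ hδ₂ hμ₁ hμ₂ hωμ hK0 hPd' h2 h4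
    choose! E' hE' hEle using hd
    refine le_mul_exp_of_deriv_le (g := fun t => Phase.energy hβ K P p (U t) + (‖p‖ ^ 2 + b))
      (g' := E') hT'.1 ((hEc.comp_continuousOn hUc).add continuousOn_const)
      (fun t ht => (hE' t ht).add_const _) fun t ht => ?_
    exact (hEle t ht).trans (mul_le_mul_of_nonneg_left (hlow _).2 hK0)
  have hB : 0 ≤ B₀ :=
    (mul_nonneg hm0.le (sq_nonneg _)).trans ((hlow U₀).1.trans (hB₀ U₀ hU₀))
  refine (le_abs_self _).trans (Real.abs_le_sqrt ?_)
  rw [le_div_iff₀ hm0, mul_comm]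
  refine (hlow _).1.trans (key.trans ?_)
  refine mul_le_mul (hB₀ _ (h0 ▸ hU₀)) (Real.exp_le_exp.2 ?_) (Real.exp_nonneg _) hB
  exact mul_le_mul_of_nonneg_left hT'.2 hK0

end Energy

end BergerPlate

end

/-! ### The main theorem. -/

open BergerPlate in
theorem theorem2p1 {H : Type*} [NormedAddCommGroup H] [InnerProductSpace ℝ H] [CompleteSpace H]
    (A : SpectralOperator H) (β ν ω : ℝ) (hβ : 0 < β) (hν : 0 < ν) (hω : ω ∈ Set.Ico (0 : ℝ) 1)
    (μ₁ μ₂ : ℝ → ℝ) (δ₁ δ₂ : ℝ) (hδ₁ : 0 < δ₁) (hδ₂ : 0 < δ₂)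
    (hμ₁ : IsMemoryKernel μ₁ δ₁) (hμ₂ : IsMemoryKernel μ₂ δ₂)
    (hωμ : 0 < ω ∨ ∃ s > 0, μ₂ s ≠ 0)
    (M : ℝ → ℝ) (hM : ContDiffOn ℝ 2 M (Set.Ici 0))
    (a b : ℝ) (ha : a ∈ Set.Ioo 0 (A.lam 0))
    (hMab : ∀ z ≥ 0, -a * z - b ≤ ∫ ξ in (0 : ℝ)..z, M ξ)
    (p : H) :
    ∃ expL : ℝ → Phase A μ₁ μ₂ →L[ℝ] Phase A μ₁ μ₂,
      IsC0Semigroup expL ∧ IsGenerator (LGraph A β ν ω μ₁ μ₂) expL ∧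
      ∃ S : ℝ → Phase A μ₁ μ₂ → Phase A μ₁ μ₂,
        (∀ U₀ : Phase A μ₁ μ₂, ∀ T > 0,
          IsMildSolution expL (nonlin A μ₁ μ₂ M p) T U₀ (fun t => S t U₀) ∧
          ∀ U : ℝ → Phase A μ₁ μ₂, IsMildSolution expL (nonlin A μ₁ μ₂ M p) T U₀ U →
            ∀ t ∈ Set.Icc 0 T, U t = S t U₀) ∧
        (∀ R T : ℝ, 0 < T → ∃ C > 0, ∀ U₁ U₂ : Phase A μ₁ μ₂, ‖U₁‖ ≤ R → ‖U₂‖ ≤ R →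
          ∀ t ∈ Set.Icc 0 T, ‖S t U₁ - S t U₂‖ ≤ C * ‖U₁ - U₂‖) ∧
        (∀ U₀ ∈ LDomain A β ν ω μ₁ μ₂, ∀ T > 0,
          IsClassicalSolution (LGraph A β ν ω μ₁ μ₂) (nonlin A μ₁ μ₂ M p) T U₀
            (fun t => S t U₀)) := by
  have := A.completeSpace_F zero_le_one
  have := A.completeSpace_F one_half_pos.le
  have hM1 : ContDiffOn ℝ 1 M (Set.Ici 0) := hM.of_le one_le_two
  obtain ⟨S, C, hS0, hS, hG, hD⟩ := exists_semigroup_of_conj _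
    (isMaxDissipative_lGraph (A := A) (ν := ν) hβ hω.1 hδ₁ hδ₂ hμ₁ hμ₂ hωμ)
  exact ⟨S, hS0, hG, hS.wellposed hG hD (contDiff_nonlin hM1) (exists_lipschitz_nonlin hM1)
    fun T _ ρ => exists_apriori_bound hβ hω.1 hδ₁ hδ₂ hμ₁ hμ₂ hωμ hM1.continuousOn ha.1.le hMab
      p T ρ⟩
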